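/- **Proposition 3.1.** Let $\mathfrak g$ be a finite-dimensional real Lie algebra. Let $Z(X,Y)=\log(\exp X\cdot\exp Y)$ be the Campbell–Hausdorff series (given by Dynkin's formula), and put $$j(X)=\det\nolimits_{\mathfrak g}\Big(\frac{1-e^{-\operatorname{ad}X}}{\operatorname{ad}X}\Big),\qquad D(X,Y)=\frac{j^{1/2}(X)\,j^{1/2}(Y)}{j^{1/2}(Z(X,Y))},$$ $$Z_t(X,Y)=\tfrac1t Z(tX,tY)\ \ (Z_0(X,Y)=X+Y),\qquad D_t(X,Y)=D(tX,tY).$$ There is an open neighbourhood $\mathcal O_0$ of $0$ in $\mathfrak g$ such that the series $Z$ converges absolutely on $\mathcal O_0\times\mathcal O_0$ to a $C^\infty$ function, $j>0$ on $\mathcal O_0$ and on $Z(\mathcal O_0\times\mathcal O_0)$, and the following holds for every open neighbourhood $\mathcal O\subseteq\mathcal O_0$ of $0$. Let $\beta=(F,G)\in C^\infty(\mathcal O\times\mathcal O,\mathfrak g\times\mathfrak g)$ with $\beta(0,0)=0$. Put $\beta_t(X,Y)=\frac1t\beta(tX,tY)$ for $t\neq0$, and $\beta_0(X,Y)=d\beta(0,0)(X,Y)$.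 Let $(e_i)$ be a basis of $\mathfrak g$, let $(\hat e_i)$ be the basis of $\mathfrak g\times\mathfrak g$ made of two copies of $(e_i)$, and write $\beta_t=\sum_i\beta_t^i\hat e_i$. Then the two conditions (a) and (b) are equivalent. (a) For all $(X,Y)\in\mathcal O\times\mathcal O$, $$X+Y-Z(Y,X)=(1-e^{-\operatorname{ad}X})F(X,Y)+(e^{\operatorname{ad}Y}-1)G(X,Y)\tag{7}$$ and $$\operatorname{tr}_{\mathfrak g}\big(\operatorname{ad}X\circ\partial_XF+\operatorname{ad}Y\circ\partial_YG\big)=\tfrac12\operatorname{tr}_{\mathfrak g}\Big(\frac{\operatorname{ad}X}{e^{\operatorname{ad}X}-1}+\frac{\operatorname{ad}Y}{e^{\operatorname{ad}Y}-1}-\frac{\operatorname{ad}Z(X,Y)}{e^{\operatorname{ad}Z(X,Y)}-1}-1\Big).\tag{8}$$ (b) For all $t\in[0,1]$, on the distributions with compact support in $\frac1t\mathcal O\times\frac1t\mathcal O$ (in $\mathfrak g\times\mathfrak g$ if $t=0$), $$\partial_t m_t=-m_t\circ V(\beta_t).$$ Here $m_t=(Z_t)_*\circ D_t$, that is, $\langle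 m_tu,f\rangle=\langle u,\,D_t\cdot(f\circ Z_t)\rangle$ for $f\in C^\infty(\mathfrak g)$, and $V(\beta_t)=\sum_i\beta_t^i\,L(\hat e_i)$, where $L(v)$, for $v\in\mathfrak g\times\mathfrak g$, is the Lie derivative of the adjoint action: $(L(v)\varphi)(p)=d\varphi(p)([p,v])$ on functions and $\langle L(v)u,\varphi\rangle=-\langle u,L(v)\varphi\rangle$ on distributions. The equation in (b) is understood weakly: for each $u$ with compact support in $\frac1t\mathcal O\times\frac1t\mathcal O$ and each $f\in C^\infty(\mathfrak g)$, the function $s\mapsto\langle m_su,f\rangle$, defined for $s\in[0,1]$ near $t$, is differentiable at $s=t$ (as a function on $[0,1]$), with derivative $-\langle m_tV(\beta_t)u,f\rangle$. -/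

import Mathlib

open scoped Topology ContDiff

noncomputable section

namespace KV

/-! ## Compactly supported distributions -/

section Distributions

variable {E F : Type*} [NormedAddCommGroup E] [NormedSpace ℝ E]
  [NormedAddCommGroup F] [NormedSpace ℝ F]

open TopologicalSpace (Opens)

/-- The space `C^∞(Ω)` of smooth real functions on the open set `Ω`.  An element is represented by
a function on the whole space that is smooth on `Ω`; its values outside `Ω` play no role below. -/
def SmoothFn (Ω : Opens E) : Submodule ℝ (E → ℝ) where
  carrier := {φ | ContDiffOn ℝ ∞ φ (Ω : Set E)}
  add_mem' hf hg := ContDiffOn.add hf hg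
  zero_mem' := contDiffOn_const
  smul_mem' c _ hf := ContDiffOn.const_smul c hf

/-- `DerivBound φ K N M`: on the set `K`, all derivatives of `φ` of order at most `N` are bounded
by `M`. The least such `M ≥ 0` is the usual `C^N(K)` seminorm of `φ`. -/
def DerivBound (φ : E → ℝ) (K : Set E) (N : ℕ) (M : ℝ) : Prop :=
  0 ≤ M ∧ ∀ k ≤ N, ∀ x ∈ K, ‖iteratedFDeriv ℝ k φ x‖ ≤ M

/-- The space `𝓓'_comp(Ω)` of distributions with compact support in `Ω`, that is, the space of
linear forms on `C^∞(Ω)` that are continuous for uniform convergence of all derivatives on compact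
subsets of `Ω`: `|u(φ)| ≤ C ‖φ‖_{C^N(K)}` for some compact `K ⊆ Ω`, some `N` and some `C`. -/
def CompDistribution (Ω : Opens E) : Submodule ℝ (SmoothFn Ω →ₗ[ℝ] ℝ) where
  carrier := {u | ∃ K : Set E, K ⊆ Ω ∧ IsCompact K ∧ ∃ (N : ℕ) (C : ℝ),
    ∀ (φ : SmoothFn Ω) (M : ℝ), DerivBound φ.1 K N M → |u φ| ≤ C * M}
  add_mem' := by
    rintro u v ⟨K, hK, hKc, N, C, h⟩ ⟨K', hK', hKc', N', C', h'⟩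
    refine ⟨K ∪ K', Set.union_subset hK hK', hKc.union hKc', max N N', C + C', ?_⟩
    intro φ M ⟨hM, hb⟩
    have h1 := h φ M ⟨hM, fun k hk x hx => hb k (hk.trans (le_max_left _ _)) x (Or.inl hx)⟩
    have h2 := h' φ M ⟨hM, fun k hk x hx => hb k (hk.trans (le_max_right _ _)) x (Or.inr hx)⟩
    calc |(u + v) φ| ≤ |u φ| + |v φ| := abs_add_le _ _
      _ ≤ (C + C') * M := by linarith
  zero_mem' := ⟨∅, by simp, isCompact_empty, 0, 0, by simp⟩
  smul_mem' := by
    rintro c u ⟨K, hK, hKc, N, C, h⟩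
    refine ⟨K, hK, hKc, N, |c| * C, fun φ M hM => ?_⟩
    have := h φ M hM
    calc |(c • u) φ| = |c| * |u φ| := by simp [abs_mul]
      _ ≤ |c| * (C * M) := by gcongr
      _ = |c| * C * M := by ring

/-- Continuity of a linear operator between spaces of smooth functions. -/
def IsContinuousOp {Ω : Opens E} {Ω' : Opens F} (T : SmoothFn Ω' →ₗ[ℝ] SmoothFn Ω) : Prop :=
  ∀ K : Set E, K ⊆ Ω → IsCompact K → ∀ N : ℕ, ∃ K' : Set F, K' ⊆ Ω' ∧ IsCompact K' ∧
    ∃ (N' : ℕ) (C : ℝ), ∀ (φ : SmoothFn Ω') (M : ℝ),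
      DerivBound φ.1 K' N' M → DerivBound (T φ).1 K N (C * M)

/-- The transpose `𝓓'_comp(Ω) → 𝓓'_comp(Ω')`, `⟨u T, φ⟩ = ⟨u, T φ⟩`, of a continuous operator
`T : C^∞(Ω') → C^∞(Ω)`. -/
def transposeOp {Ω : Opens E} {Ω' : Opens F} (T : SmoothFn Ω' →ₗ[ℝ] SmoothFn Ω)
    (hT : IsContinuousOp T) : CompDistribution Ω →ₗ[ℝ] CompDistribution Ω' :=
  T.dualMap.restrict (by
    rintro u ⟨K, hK, hKc, N, C, h⟩
    obtain ⟨K', hK', hKc', N', C', h'⟩ := hT K hK hKc N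
    refine ⟨K', hK', hKc', N', C * C', fun φ M hM => ?_⟩
    have := h (T φ) (C' * M) (h' φ M hM)
    calc |T.dualMap u φ| ≤ C * (C' * M) := this
      _ = C * C' * M := by ring)

theorem exists_deriv_bound {Ω : Opens E} {f : E → F} (hf : ContDiffOn ℝ ∞ f Ω) {K : Set E}
    (hK : K ⊆ Ω) (hKc : IsCompact K) (N : ℕ) :
    ∃ B : ℝ, 1 ≤ B ∧ ∀ k ≤ N, ∀ x ∈ K, ‖iteratedFDerivWithin ℝ k f Ω x‖ ≤ B := by
  have h1 : ∀ k : ℕ, ∃ B : ℝ, ∀ x ∈ K, ‖iteratedFDerivWithin ℝ k f Ω x‖ ≤ B := fun k =>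
    hKc.exists_bound_of_continuousOn
      ((hf.continuousOn_iteratedFDerivWithin (by exact_mod_cast le_top)
        Ω.isOpen.uniqueDiffOn).mono hK)
  choose B hB using h1
  refine ⟨1 + ∑ k ∈ Finset.range (N + 1), |B k|, ?_, fun k hk x hx => ?_⟩
  · have : 0 ≤ ∑ k ∈ Finset.range (N + 1), |B k| := Finset.sum_nonneg fun _ _ => abs_nonneg _
    linarith
  · have h2 := Finset.single_le_sum (f := fun k => |B k|) (fun _ _ => abs_nonneg _)
      (Finset.mem_range.2 (Nat.lt_succ_of_le hk))
    have h3 := (hB k x hx).trans (le_abs_self _)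
    linarith

theorem leibniz_bound {n N : ℕ} (hn : n ≤ N) {a b : ℕ → ℝ} {B M : ℝ} (hB : 0 ≤ B)
    (ha : ∀ i ≤ N, a i ≤ B) (hb : ∀ i ≤ N, b i ≤ M) (hb0 : ∀ i, 0 ≤ b i) :
    ∑ i ∈ Finset.range (n + 1), (n.choose i : ℝ) * a i * b (n - i) ≤ 2 ^ N * B * M := by
  have hM : 0 ≤ M := (hb0 0).trans (hb 0 (Nat.zero_le _))
  calc ∑ i ∈ Finset.range (n + 1), (n.choose i : ℝ) * a i * b (n - i)
      ≤ ∑ i ∈ Finset.range (n + 1), (n.choose i : ℝ) * (B * M) := by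
        refine Finset.sum_le_sum fun i hi => ?_
        rw [mul_assoc]
        have hi' : i ≤ N := (Nat.lt_succ_iff.1 (Finset.mem_range.1 hi)).trans hn
        exact mul_le_mul_of_nonneg_left (mul_le_mul (ha i hi')
          (hb _ ((Nat.sub_le _ _).trans hn)) (hb0 _) hB) (by positivity)
    _ = 2 ^ n * (B * M) := by
        rw [← Finset.sum_mul]; congr 1; exact_mod_cast Nat.sum_range_choose n
    _ ≤ 2 ^ N * B * M := by
        rw [mul_assoc]
        exact mul_le_mul_of_nonneg_right (pow_le_pow_right₀ (by norm_num) hn) (by positivity)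

/-- Multiplication by a smooth function `h` on `C^∞(Ω)`. -/
def mulFn (Ω : Opens E) (h : E → ℝ) (hh : ContDiffOn ℝ ∞ h Ω) :
    SmoothFn Ω →ₗ[ℝ] SmoothFn Ω where
  toFun φ := ⟨fun x => h x * φ.1 x, ContDiffOn.mul hh φ.2⟩
  map_add' φ ψ := by ext x; simp [mul_add]
  map_smul' c φ := by ext x; simp [mul_left_comm]

theorem mulFn_continuous (Ω : Opens E) (h : E → ℝ) (hh : ContDiffOn ℝ ∞ h Ω) :
    IsContinuousOp (mulFn Ω h hh) := by
  intro K hK hKc N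
  obtain ⟨B, hB1, hB⟩ := exists_deriv_bound hh hK hKc N
  refine ⟨K, hK, hKc, N, 2 ^ N * B, fun φ M ⟨hM, hb⟩ => ⟨by positivity, fun k hk x hx => ?_⟩⟩
  have hw := fun (f : E → ℝ) (i : ℕ) => iteratedFDerivWithin_of_isOpen (𝕜 := ℝ) (f := f) i
    Ω.isOpen (hK hx)
  rw [← hw]
  refine (norm_iteratedFDerivWithin_mul_le hh φ.2 Ω.isOpen.uniqueDiffOn (hK hx) (n := k)
    (by exact_mod_cast le_top)).trans
    (leibniz_bound hk (a := fun i => ‖iteratedFDerivWithin ℝ i h Ω x‖)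
      (b := fun i => ‖iteratedFDerivWithin ℝ i φ.1 Ω x‖) (by linarith)
      (fun i hi => hB i hi x hx) (fun i hi => ?_) (fun _ => norm_nonneg _))
  rw [hw]
  exact hb i hi x hx

/-- Composition with a smooth map `Z : Ω → F`, from `C^∞(F)` to `C^∞(Ω)`. -/
def compFn (Ω : Opens E) (Z : E → F) (hZ : ContDiffOn ℝ ∞ Z Ω) :
    SmoothFn (⊤ : Opens F) →ₗ[ℝ] SmoothFn Ω where
  toFun φ := ⟨fun x => φ.1 (Z x), ContDiffOn.comp φ.2 hZ (fun _ _ => trivial)⟩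
  map_add' _ _ := rfl
  map_smul' _ _ := rfl

theorem compFn_continuous (Ω : Opens E) (Z : E → F) (hZ : ContDiffOn ℝ ∞ Z Ω) :
    IsContinuousOp (compFn Ω Z hZ) := by
  intro K hK hKc N
  obtain ⟨B, hB1, hB⟩ := exists_deriv_bound hZ hK hKc N
  refine ⟨Z '' K, fun _ _ => trivial, hKc.image_of_continuousOn (hZ.continuousOn.mono hK), N,
    N.factorial * B ^ N, fun φ M ⟨hM, hb⟩ => ⟨by positivity, fun k hk x hx => ?_⟩⟩
  rw [← iteratedFDerivWithin_of_isOpen (𝕜 := ℝ) k Ω.isOpen (hK hx)]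
  have h1 := norm_iteratedFDerivWithin_comp_le (n := k) (C := M) (D := B) φ.2 hZ
    (by exact_mod_cast le_top) (⊤ : Opens F).isOpen.uniqueDiffOn Ω.isOpen.uniqueDiffOn
    (fun _ _ => trivial) (hK hx)
    (fun i hi => by
      rw [iteratedFDerivWithin_of_isOpen (𝕜 := ℝ) i (⊤ : Opens F).isOpen trivial]
      exact hb i (hi.trans hk) _ ⟨x, hx, rfl⟩)
    (fun i hi1 hi => (hB i (hi.trans hk) x hx).trans (le_self_pow₀ hB1 (by lia)))
  refine h1.trans ?_
  calc (k.factorial : ℝ) * M * B ^ k ≤ N.factorial * M * B ^ N := by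
        gcongr
    _ = N.factorial * B ^ N * M := by ring

/-- The derivation `φ ↦ (x ↦ dφ(x) (A x))` of `C^∞(Ω)` defined by a smooth vector field `A`
(extended by `0` outside `Ω`). -/
def vectorFieldFn (Ω : Opens E) (A : E → E) (hA : ContDiffOn ℝ ∞ A Ω) :
    SmoothFn Ω →ₗ[ℝ] SmoothFn Ω where
  toFun φ := ⟨(Ω : Set E).indicator fun x => fderiv ℝ φ.1 x (A x),
    (ContDiffOn.clm_apply (ContDiffOn.fderiv_of_isOpen (m := ∞) φ.2 Ω.isOpen (by simp)) hA).congr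
      fun _ hx => Set.indicator_of_mem hx _⟩
  map_add' φ ψ := by
    ext x
    by_cases hx : x ∈ (Ω : Set E)
    · have h (f : SmoothFn Ω) : DifferentiableAt ℝ f.1 x :=
        (ContDiffOn.contDiffAt f.2 (Ω.isOpen.mem_nhds hx)).differentiableAt (by simp)
      simp [hx, fderiv_add (h φ) (h ψ)]
    · simp [hx]
  map_smul' c φ := by
    ext x
    by_cases hx : x ∈ (Ω : Set E)
    · have h : DifferentiableAt ℝ φ.1 x :=
        (ContDiffOn.contDiffAt φ.2 (Ω.isOpen.mem_nhds hx)).differentiableAt (by simp)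
      simp [hx, fderiv_const_smul h]
    · simp [hx]

theorem vectorFieldFn_continuous (Ω : Opens E) (A : E → E) (hA : ContDiffOn ℝ ∞ A Ω) :
    IsContinuousOp (vectorFieldFn Ω A hA) := by
  intro K hK hKc N
  obtain ⟨B, hB1, hB⟩ := exists_deriv_bound hA hK hKc N
  refine ⟨K, hK, hKc, N + 1, 2 ^ N * B, fun φ M ⟨hM, hb⟩ => ⟨by positivity, fun k hk x hx => ?_⟩⟩
  have hu := Ω.isOpen.uniqueDiffOn (𝕜 := ℝ)
  have he : Set.EqOn (vectorFieldFn Ω A hA φ).1 (fun y => fderivWithin ℝ φ.1 Ω y (A y)) Ω := by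
    intro y hy
    have : (vectorFieldFn Ω A hA φ).1 y = fderiv ℝ φ.1 y (A y) :=
      Set.indicator_of_mem (f := fun x => fderiv ℝ φ.1 x (A x)) hy
    simp only [this, fderivWithin_of_isOpen Ω.isOpen hy]
  rw [← iteratedFDerivWithin_of_isOpen (𝕜 := ℝ) k Ω.isOpen (hK hx),
    iteratedFDerivWithin_congr he (hK hx)]
  have h1 := norm_iteratedFDerivWithin_clm_apply (n := k) (N := ∞)
    (ContDiffOn.fderivWithin (m := ∞) φ.2 hu (by simp)) hA hu (hK hx) (by exact_mod_cast le_top)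
  rw [← Finset.sum_flip] at h1
  refine h1.trans (le_trans (le_of_eq ?_) (leibniz_bound hk
    (a := fun i => ‖iteratedFDerivWithin ℝ i A Ω x‖)
    (b := fun i => ‖iteratedFDerivWithin ℝ i (fderivWithin ℝ φ.1 Ω) Ω x‖) (by linarith)
    (fun i hi => hB i hi x hx) (fun i hi => ?_) (fun _ => norm_nonneg _)))
  · refine Finset.sum_congr rfl fun i hi => ?_
    have hi' : i ≤ k := Nat.lt_succ_iff.1 (Finset.mem_range.1 hi)
    rw [Nat.choose_symm hi', Nat.sub_sub_self hi']
    ring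
  · rw [norm_iteratedFDerivWithin_fderivWithin hu (hK hx),
      iteratedFDerivWithin_of_isOpen (𝕜 := ℝ) _ Ω.isOpen (hK hx)]
    exact hb (i + 1) (by lia) x hx

open Classical in
/-- Multiplication of a distribution by a function `h`: `⟨h u, φ⟩ = ⟨u, h φ⟩` (for `h` smooth
on `Ω`, and `0` otherwise). -/
def mulDist (Ω : Opens E) (h : E → ℝ) : CompDistribution Ω →ₗ[ℝ] CompDistribution Ω :=
  if hh : ContDiffOn ℝ ∞ h Ω then transposeOp (mulFn Ω h hh) (mulFn_continuous Ω h hh) else 0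

open Classical in
/-- Direct image of a distribution by a map `Z : Ω → F`: `⟨Z_* u, f⟩ = ⟨u, f ∘ Z⟩` (for `Z` smooth
on `Ω`, and `0` otherwise). -/
def pushDist (Ω : Opens E) (Z : E → F) :
    CompDistribution Ω →ₗ[ℝ] CompDistribution (⊤ : Opens F) :=
  if hZ : ContDiffOn ℝ ∞ Z Ω then transposeOp (compFn Ω Z hZ) (compFn_continuous Ω Z hZ) else 0

end Distributions

/-! ## Lie algebras, the Campbell–Hausdorff series and its dilations -/

/-- A Lie ring with a norm for its additive group; no compatibility of norm and bracket is
required. It only combines two Mathlib classes over the same additive group. -/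
class NormedLieRing (𝔤 : Type*) extends NormedAddCommGroup 𝔤, LieRing 𝔤

/-- A real Lie algebra with a norm for its vector space; no compatibility of norm and bracket is
required. (Every finite-dimensional real Lie algebra has such norms, all of them equivalent.) -/
class NormedLieAlgebra (𝔤 : Type*) [NormedLieRing 𝔤] extends NormedSpace ℝ 𝔤, LieAlgebra ℝ 𝔤

section BCH

/-- The free associative algebra on the two letters `x = ι 0` and `y = ι 1`. -/
abbrev Ass : Type := FreeAlgebra ℝ (Fin 2)

/-- The power series `exp (T a) = ∑ aⁿ Tⁿ / n!`. -/
def expT (a : Ass) : PowerSeries Ass := PowerSeries.mk fun n => ((n.factorial : ℝ)⁻¹) • a ^ n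

/-- The homogeneous component of degree `n` of
`log (e^x e^y) = ∑_{k ≥ 1} (-1)^(k-1) / k (e^x e^y - 1)^k` in the free associative algebra:
the coefficient of `Tⁿ` in `log (e^{T x} e^{T y})`. -/
def logExpExp (n : ℕ) : Ass :=
  ∑ k ∈ Finset.Icc 1 n, ((-1 : ℝ) ^ (k - 1) / k) •
    PowerSeries.coeff n ((expT (FreeAlgebra.ι ℝ 0) * expT (FreeAlgebra.ι ℝ 1) - 1) ^ k)

variable {𝔤 : Type*} [LieRing 𝔤] [LieAlgebra ℝ 𝔤]

/-- The iterated bracket `[w₁, [w₂, … [w_{n-1}, w_n]]]`; it is `0` for the empty word. -/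
def nestedBracket : List 𝔤 → 𝔤
  | [] => 0
  | [a] => a
  | a :: b :: l => ⁅a, nestedBracket (b :: l)⁆

/-- The action of a letter `X` on `𝔤 × ℝ` by `(v, c) ↦ ([X, v] + c X, 0)`. -/
def letterAct (X : 𝔤) : Module.End ℝ (𝔤 × ℝ) :=
  LinearMap.prod
    ((LieAlgebra.ad ℝ 𝔤 X : Module.End ℝ 𝔤).comp (LinearMap.fst ℝ 𝔤 ℝ) +
      (LinearMap.toSpanSingleton ℝ 𝔤 X).comp (LinearMap.snd ℝ 𝔤 ℝ)) 0

/-- The Dynkin map from the free associative algebra to `𝔤` at a pair `(X, Y)`: the linear map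
that sends the word `w₁ ⋯ w_n` to `[w₁, [w₂, … [w_{n-1}, w_n]]]` evaluated at
`x = X`, `y = Y` (see `dynkinMap_word`). -/
def dynkinMap (X Y : 𝔤) : Ass →ₗ[ℝ] 𝔤 :=
  (LinearMap.fst ℝ 𝔤 ℝ).comp ((LinearMap.applyₗ ((0, 1) : 𝔤 × ℝ)).comp
    (FreeAlgebra.lift ℝ fun i : Fin 2 => letterAct (![X, Y] i)).toLinearMap)

theorem dynkinMap_word (X Y : 𝔤) (w : List (Fin 2)) :
    dynkinMap X Y (w.map (FreeAlgebra.ι ℝ)).prod = nestedBracket (w.map ![X, Y]) := by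
  have key : ∀ w : List (Fin 2), w ≠ [] →
      (FreeAlgebra.lift ℝ fun i : Fin 2 => letterAct (![X, Y] i))
        (w.map (FreeAlgebra.ι ℝ)).prod ((0, 1) : 𝔤 × ℝ) =
      (nestedBracket (w.map ![X, Y]), 0) := by
    intro w
    induction w with
    | nil => simp
    | cons a w ih =>
      intro _
      cases w with
      | nil => simp [letterAct, nestedBracket]
      | cons b w =>
        have := ih (by simp)
        rw [List.map_cons, List.prod_cons, map_mul, Module.End.mul_apply, this]
        simp [letterAct, nestedBracket]
  cases w with
  | nil => simp [dynkinMap, nestedBracket]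
  | cons a w =>
    have := key (a :: w) (by simp)
    simp only [dynkinMap, LinearMap.comp_apply, AlgHom.toLinearMap_apply,
      LinearMap.applyₗ_apply_apply, this, LinearMap.fst_apply]

/-- The homogeneous component of degree `n` of the Campbell–Hausdorff series
`log (exp X · exp Y)`, by Dynkin's formula: a Lie polynomial which is homogeneous of degree `n` in
the free associative algebra is recovered as `1 / n` times its image under the Dynkin map. -/
def bchTerm (n : ℕ) (X Y : 𝔤) : 𝔤 := (n : ℝ)⁻¹ • dynkinMap X Y (logExpExp n)

end BCH

variable {𝔤 : Type*} [NormedLieRing 𝔤] [NormedLieAlgebra 𝔤]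

/-- The Campbell–Hausdorff series `Z(X, Y) = log (exp X · exp Y)`. -/
def Z (X Y : 𝔤) : 𝔤 := ∑' n, bchTerm n X Y

/-- `Z_t(X, Y) = Z(tX, tY) / t`, the Campbell–Hausdorff series for the bracket `t[·,·]`;
`Z_0(X, Y) = X + Y`. -/
def Zt (t : ℝ) (p : 𝔤 × 𝔤) : 𝔤 := if t = 0 then p.1 + p.2 else t⁻¹ • Z (t • p.1) (t • p.2)

/-- `β_t(X, Y) = β(tX, tY) / t`, extended by its limit `dβ(0)(X, Y)` at `t = 0`
(for `β(0, 0) = 0`). -/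
def dil (β : 𝔤 × 𝔤 → 𝔤 × 𝔤) (t : ℝ) (p : 𝔤 × 𝔤) : 𝔤 × 𝔤 :=
  if t = 0 then fderiv ℝ β 0 p else t⁻¹ • β (t • p)

/-- The set `(t⁻¹ 𝒪) × (t⁻¹ 𝒪)`; everything for `t = 0`. -/
def dilDom (𝒪 : Set 𝔤) (t : ℝ) : Set (𝔤 × 𝔤) := {p | t • p.1 ∈ 𝒪 ∧ t • p.2 ∈ 𝒪}

variable [FiniteDimensional ℝ 𝔤]

/-- `ad X` as a continuous linear map. -/
def ad (X : 𝔤) : 𝔤 →L[ℝ] 𝔤 := LinearMap.toContinuousLinearMap (LieAlgebra.ad ℝ 𝔤 X)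

/-- The trace over `𝔤`. -/
def tr (A : 𝔤 →L[ℝ] 𝔤) : ℝ := LinearMap.trace ℝ 𝔤 A.toLinearMap

/-- `(e^A - 1) / A = ∑ Aⁿ / (n + 1)!`. -/
def expDivided (A : 𝔤 →L[ℝ] 𝔤) : 𝔤 →L[ℝ] 𝔤 := ∑' n : ℕ, (((n + 1).factorial : ℝ)⁻¹) • A ^ n

/-- `A / (e^A - 1)`, the inverse of `(e^A - 1) / A` (where that is invertible). -/
def todd (A : 𝔤 →L[ℝ] 𝔤) : 𝔤 →L[ℝ] 𝔤 := Ring.inverse (expDivided A)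

/-- `j(X) = det ((1 - e^{-ad X}) / ad X)`. -/
def j (X : 𝔤) : ℝ := (expDivided (-ad X)).det

/-- The density function `D(X, Y) = j^{1/2}(X) j^{1/2}(Y) / j^{1/2}(Z(X, Y))`. -/
def D (X Y : 𝔤) : ℝ := √(j X) * √(j Y) / √(j (Z X Y))

/-- `D_t(X, Y) = D(tX, tY)`. -/
def Dt (t : ℝ) (p : 𝔤 × 𝔤) : ℝ := D (t • p.1) (t • p.2)

/-- The set `𝒪` is a small enough open neighbourhood of `0`: the Campbell–Hausdorff series
converges on `𝒪 × 𝒪` to a smooth function, and `j` is positive on `𝒪` and at all `Z(X, Y)`, so that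
its square root is smooth there and `A / (e^A - 1)` is defined at
`A = ad X`, `ad Y`, `ad Z(X, Y)`. -/
structure IsSmall (𝒪 : Set 𝔤) : Prop where
  isOpen : IsOpen 𝒪
  zero_mem : (0 : 𝔤) ∈ 𝒪
  summable : ∀ X ∈ 𝒪, ∀ Y ∈ 𝒪, Summable fun n => ‖bchTerm n X Y‖
  contDiffOn : ContDiffOn ℝ ∞ (fun p : 𝔤 × 𝔤 => Z p.1 p.2) (𝒪 ×ˢ 𝒪)
  j_pos : ∀ X ∈ 𝒪, 0 < j X
  j_pos_Z : ∀ X ∈ 𝒪, ∀ Y ∈ 𝒪, 0 < j (Z X Y)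

/-! ## The Kashiwara–Vergne equations -/

/-- The first equation, at `(X, Y)`, for `β = (F, G)`:
`X + Y - log (exp Y · exp X) = (1 - e^{-ad X}) F(X, Y) + (e^{ad Y} - 1) G(X, Y)`. -/
def KVFirst (β : 𝔤 × 𝔤 → 𝔤 × 𝔤) (X Y : 𝔤) : Prop :=
  X + Y - Z Y X =
    (1 - NormedSpace.exp (-ad X)) (β (X, Y)).1 + (NormedSpace.exp (ad Y) - 1) (β (X, Y)).2

/-- The trace equation, at `(X, Y)`, for `β = (F, G)`:
`tr (ad X ∘ ∂_X F + ad Y ∘ ∂_Y G)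
  = 1/2 tr (ad X / (e^{ad X} - 1) + ad Y / (e^{ad Y} - 1) - ad Z / (e^{ad Z} - 1) - 1)`
with `Z = Z(X, Y)`. -/
def KVTrace (β : 𝔤 × 𝔤 → 𝔤 × 𝔤) (X Y : 𝔤) : Prop :=
  tr (ad X ∘L fderiv ℝ (fun X' => (β (X', Y)).1) X + ad Y ∘L fderiv ℝ (fun Y' => (β (X, Y')).2) Y)
    = 1 / 2 * tr (todd (ad X) + todd (ad Y) - todd (ad (Z X Y)) - 1)

/-! ## The operators `m_t` and `V` on distributions -/

open TopologicalSpace (Opens)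

/-- The vector field `p ↦ [p, v]` on `𝔤 × 𝔤`, for the bracket of the product Lie algebra. -/
def adField (v : 𝔤 × 𝔤) (p : 𝔤 × 𝔤) : 𝔤 × 𝔤 := ⁅p, v⁆

theorem adField_contDiff (v : 𝔤 × 𝔤) : ContDiff ℝ ∞ (adField v) := by
  have h : adField v = fun p => (-(ad v.1 p.1), -(ad v.2 p.2)) := by
    funext p
    simp [adField, ad]
  rw [h]
  fun_prop

/-- The Lie derivative `L(v)` of the adjoint action of `𝔤 × 𝔤` on distributions:
`⟨L(v) u, φ⟩ = -⟨u, L(v) φ⟩`, where `(L(v) φ)(p) = dφ(p) [p, v]` on functions. -/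
def lieDist (Ω : Opens (𝔤 × 𝔤)) (v : 𝔤 × 𝔤) : CompDistribution Ω →ₗ[ℝ] CompDistribution Ω :=
  (-1 : ℝ) • transposeOp (vectorFieldFn Ω (adField v) (adField_contDiff v).contDiffOn)
    (vectorFieldFn_continuous Ω (adField v) (adField_contDiff v).contDiffOn)

/-- `V(β) = ∑ βⁱ L(êᵢ)` on distributions, where `(êᵢ)` is the basis of `𝔤 × 𝔤` made of two copies of
the basis `e` of `𝔤` and `β = ∑ βⁱ êᵢ`. -/
def V {n : ℕ} (e : Module.Basis (Fin n) ℝ 𝔤) (Ω : Opens (𝔤 × 𝔤)) (β : 𝔤 × 𝔤 → 𝔤 × 𝔤) :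
    CompDistribution Ω →ₗ[ℝ] CompDistribution Ω :=
  ∑ i, mulDist Ω (fun p => (e.prod e).repr (β p) i) ∘ₗ lieDist Ω (e.prod e i)

/-- The product `m_t = (Z_t)_* ∘ D_t`. -/
def m (Ω : Opens (𝔤 × 𝔤)) (t : ℝ) : CompDistribution Ω →ₗ[ℝ] CompDistribution (⊤ : Opens 𝔤) :=
  pushDist Ω (Zt t) ∘ₗ mulDist Ω (Dt t)

/-- The equation `∂_t m_t = - m_t ∘ V(β_t)` at time `t ∈ [0, 1]`, on the distributions with compact
support in `(t⁻¹ 𝒪) × (t⁻¹ 𝒪)`. The derivative is taken weakly, against every smooth function `f`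
on `𝔤`. Each such distribution `u` belongs to `𝓓'_comp(Ω)` for some open `Ω` contained in
`(s⁻¹ 𝒪) × (s⁻¹ 𝒪)` for all `s` near `t`, so that `m_s u` is defined for these `s`. -/
def TransportEq {n : ℕ} (e : Module.Basis (Fin n) ℝ 𝔤) (𝒪 : Set 𝔤) (β : 𝔤 × 𝔤 → 𝔤 × 𝔤) (t : ℝ) :
    Prop :=
  ∀ Ω : Opens (𝔤 × 𝔤), (∀ᶠ s in 𝓝[Set.Icc 0 1] t, (Ω : Set (𝔤 × 𝔤)) ⊆ dilDom 𝒪 s) →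
    ∀ (u : CompDistribution Ω) (f : SmoothFn (⊤ : Opens 𝔤)),
      HasDerivWithinAt (fun s => (m Ω s u).1 f) (-(m Ω t (V e Ω (dil β t) u)).1 f)
        (Set.Icc 0 1) t

end KV

end

noncomputable section

namespace KV

/-! ## Parametric integrals, Hadamard quotients and linear differential equations -/

section Calculus

universe u

/-! Tested on $f$, the equation in (b) compares $\langle u,\partial_t(D_t\cdot f\circ Z_t)\rangle$
with $\langle u,\sum_i L(\hat e_i)(\beta_t^i\varphi)\rangle$, where $\varphi=D_t\cdot f\circ Z_t$.
By Leibniz the last sum is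
$\varphi\cdot\mathrm{tr}(\mathrm{ad}X\,\partial_XF_t+\mathrm{ad}Y\,\partial_YG_t)+d\varphi([p,\beta_t])$
(`sum_fderiv_repr_mul`). Dirac distributions show that (b) forces this identity at every point;
conversely, a second-order Taylor expansion in $t$ with smooth remainder allows differentiation
under any compactly supported $u$ (`hasDerivWithinAt_compDistribution`). Taking $f=1$ and then $f$
linear splits the pointwise identity into two transport equations, one for $Z_t$ and one for $D_t$
(`PointTransport`).

For $t\ne0$ and $q=tp$ all powers of $t$ cancel (`pointTransport_iff`), leaving
$dZ_q(q-[q,\beta(q)])=Z(q)$ and $dD_q(q-[q,\beta(q)])=D(q)\,\mathrm{tr}(\cdots)$. So $t=1$ alone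
carries the information of (a), and $t=0$ follows by continuity.

These two equations are the Kashiwara–Vergne equations (`kv_iff`). With $\Phi(A)=(e^A-1)/A$, the
differential of $Z$ is given by
$\Phi(\mathrm{ad}Z)\,dZ(v)=\Phi(\mathrm{ad}X)v_1+e^{\mathrm{ad}X}\Phi(\mathrm{ad}Y)v_2$; inserting
$v=q-[q,\beta(q)]$ and using $Z(Y,X)=e^{-\mathrm{ad}X}Z(X,Y)$ gives the first equation. The second
is a logarithmic derivative of $D$: $j$ is invariant under the adjoint action, its radial derivative
is $j\cdot\mathrm{tr}(\mathrm{ad}X/(e^{\mathrm{ad}X}-1)-1)$, and the first equation makes the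
direction at $Z$ radial too.

The properties of $Z$ are derived from Dynkin's formula itself. The Dynkin map is a matrix entry of
a representation of the free algebra by affine operators $(x,c)\mapsto(Ax+cv,0)$, whose exponentials
have affine part $\Phi(A)v$. Evaluating $\log(e^{sx}e^{sy})$ there, and producing the factors $1/n$
by integration in $s$, gives $\frac{d}{ds}Z(sX,sY)$ explicitly (`Z_eq_integral`). The group law in
the adjoint representation, the exchange of $X$ and $Y$, and the formula for $dZ$ then follow by
uniqueness for differential equations along the ray $s\mapsto(sX,sY)$. -/

theorem hasFDerivAt_integral_of_contDiffOn {E F : Type*} [NormedAddCommGroup E] [NormedSpace ℝ E]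
    [NormedAddCommGroup F] [NormedSpace ℝ F] {f : E × ℝ → F} {U : Set E} {W : Set (E × ℝ)}
    (hU : IsOpen U) (hW : IsOpen W) (hUW : U ×ˢ Set.Icc (0 : ℝ) 1 ⊆ W) (hf : ContDiffOn ℝ ∞ f W)
    {x : E} (hx : x ∈ U) :
    HasFDerivAt (fun x => ∫ r in (0 : ℝ)..1, f (x, r))
      (∫ r in (0 : ℝ)..1, fderiv ℝ f (x, r) ∘L ContinuousLinearMap.inl ℝ E ℝ) x := by
  set f' : E × ℝ → E →L[ℝ] F := fun q => fderiv ℝ f q ∘L ContinuousLinearMap.inl ℝ E ℝ with hf'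
  have hc' : ContinuousOn f' W :=
    ((hf.fderiv_of_isOpen (m := ∞) hW (by simp)).continuousOn).clm_comp continuousOn_const
  have hsl (y : E) (hy : y ∈ U) : ∀ r ∈ Set.Icc (0 : ℝ) 1, (y, r) ∈ W := fun r hr => hUW ⟨hy, hr⟩
  have hcy (y : E) : ContinuousOn (fun r : ℝ => (y, r)) (Set.Icc (0 : ℝ) 1) :=
    (Continuous.prodMk_right y).continuousOn
  have hcf (y : E) (hy : y ∈ U) : ContinuousOn (fun r : ℝ => f (y, r)) (Set.Icc (0 : ℝ) 1) :=
    hf.continuousOn.comp (hcy y) (hsl y hy)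
  have hcf' : ContinuousOn (fun r : ℝ => f' (x, r)) (Set.Icc (0 : ℝ) 1) :=
    hc'.comp (hcy x) (hsl x hx)
  obtain ⟨B, hB⟩ := isCompact_Icc.exists_bound_of_continuousOn hcf'
  have hO : IsOpen (W ∩ (fun q => ‖f' q‖) ⁻¹' Set.Iio (B + 1)) :=
    hc'.norm.isOpen_inter_preimage hW isOpen_Iio
  -- Compactness of the interval gives one neighbourhood of `x` on which the derivative is bounded
  -- by `B + 1` for all `r`, as dominated convergence requires.
  obtain ⟨s, v, hs, -, hxs, hv, hsv⟩ := generalized_tube_lemma (isCompact_singleton (x := x))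
    (isCompact_Icc (a := (0 : ℝ)) (b := 1)) hO (by
      rintro ⟨y, r⟩ ⟨hy, hr⟩
      obtain rfl : y = x := hy
      exact ⟨hsl _ hx r hr, lt_of_le_of_lt (hB r hr) (lt_add_one B)⟩)
  have hxs : x ∈ s := hxs rfl
  have hI : Set.uIoc (0 : ℝ) 1 ⊆ Set.Icc 0 1 := by
    rw [Set.uIoc_of_le zero_le_one]; exact Set.Ioc_subset_Icc_self
  refine intervalIntegral.hasFDerivAt_integral_of_dominated_of_fderiv_le (𝕜 := ℝ)
    (F := fun x r => f (x, r)) (F' := fun x r => f' (x, r))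
    (bound := fun _ => B + 1) (hs.mem_nhds hxs) ?_ ?_
    ((hcf'.mono hI).aestronglyMeasurable measurableSet_uIoc)
    ?_ ?_ ?_
  · filter_upwards [hU.mem_nhds hx] with y hy
    exact ((hcf y hy).mono hI).aestronglyMeasurable measurableSet_uIoc
  · exact ((hcf x hx).mono (by rw [Set.uIcc_of_le zero_le_one])).intervalIntegrable
  · refine Filter.Eventually.of_forall fun r hr y hy => ?_
    exact le_of_lt (hsv (Set.mk_mem_prod hy (hv (hI hr)))).2
  · exact intervalIntegrable_const
  · refine Filter.Eventually.of_forall fun r hr y hy => ?_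
    have hm : (y, r) ∈ W := (hsv (Set.mk_mem_prod hy (hv (hI hr)))).1
    have h1 : HasFDerivAt f (fderiv ℝ f (y, r)) (y, r) :=
      ((hf.contDiffAt (hW.mem_nhds hm)).differentiableAt (by simp)).hasFDerivAt
    exact h1.comp y (hasFDerivAt_prodMk_left y r)

/-- Induction on the order of differentiability: the derivative of the integral is an integral of
the same kind, with values in `E →L[ℝ] F`. The common universe of `E` and `F` keeps this new target
inside the induction. -/
theorem contDiffOn_integral {E F : Type u} [NormedAddCommGroup E] [NormedSpace ℝ E]
    [NormedAddCommGroup F] [NormedSpace ℝ F] {f : E × ℝ → F} {U : Set E} {W : Set (E × ℝ)}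
    (hU : IsOpen U) (hW : IsOpen W) (hUW : U ×ˢ Set.Icc (0 : ℝ) 1 ⊆ W)
    (hf : ContDiffOn ℝ ∞ f W) :
    ContDiffOn ℝ ∞ (fun x => ∫ r in (0 : ℝ)..1, f (x, r)) U := by
  rw [contDiffOn_infty]
  intro n
  induction n generalizing F with
  | zero =>
    rw [Nat.cast_zero, contDiffOn_zero]
    exact fun x hx =>
      (hasFDerivAt_integral_of_contDiffOn hU hW hUW hf hx).continuousAt.continuousWithinAt
  | succ n ih =>
    rw [Nat.cast_succ, contDiffOn_succ_iff_fderiv_of_isOpen hU]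
    refine ⟨fun x hx => (hasFDerivAt_integral_of_contDiffOn hU hW hUW hf
      hx).differentiableAt.differentiableWithinAt, by simp, ?_⟩
    have h1 := ih (f := fun q => fderiv ℝ f q ∘L ContinuousLinearMap.inl ℝ E ℝ)
      ((hf.fderiv_of_isOpen (m := ∞) hW (by simp)).clm_comp contDiffOn_const)
    exact h1.congr fun x hx => (hasFDerivAt_integral_of_contDiffOn hU hW hUW hf hx).fderiv

/-- Hadamard's lemma in the first variable of `ℝ × E`. -/
theorem exists_hadamard_quotient {E : Type u} {F : Type u} [NormedAddCommGroup E]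
    [NormedSpace ℝ E] [NormedAddCommGroup F] [NormedSpace ℝ F] [CompleteSpace F]
    {W : Set (ℝ × E)} (hW : IsOpen W)
    {t : ℝ} (hconv : ∀ s p, (t, p) ∈ W → (s, p) ∈ W → ∀ r ∈ Set.Icc (0 : ℝ) 1,
      (t + r * (s - t), p) ∈ W)
    {h : ℝ × E → F} (hh : ContDiffOn ℝ ∞ h W) :
    ∃ R : ℝ × E → F, ContDiffOn ℝ ∞ R {q | q ∈ W ∧ (t, q.2) ∈ W} ∧
      ∀ s p, (t, p) ∈ W → (s, p) ∈ W → h (s, p) = h (t, p) + (s - t) • R (s, p) := by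
  -- The quotient is the mean of the time derivative over the segment from `t` to `s`, which stays
  -- in `W` by `hconv`.
  set g : (ℝ × E) × ℝ → ℝ × E := fun z => (t + z.2 * (z.1.1 - t), z.1.2) with hg
  have hgs : ContDiff ℝ ∞ g := by fun_prop
  have hd : ContDiffOn ℝ ∞ (fun q => fderiv ℝ h q (1, 0)) W :=
    (hh.fderiv_of_isOpen (m := ∞) hW (by simp)).clm_apply contDiffOn_const
  refine ⟨fun q => ∫ r in (0 : ℝ)..1, fderiv ℝ h (g (q, r)) (1, 0), ?_, ?_⟩
  · refine contDiffOn_integral (f := fun z => fderiv ℝ h (g z) (1, 0)) (W := g ⁻¹' W) ?_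
      (hW.preimage hgs.continuous) ?_ (hd.comp hgs.contDiffOn fun _ h => h)
    · exact hW.inter (hW.preimage (by fun_prop))
    · rintro ⟨⟨s, p⟩, r⟩ ⟨⟨h1, h2⟩, hr⟩
      exact hconv s p h2 h1 r hr
  · intro s p ht hs
    have hder : ∀ r ∈ Set.uIcc (0 : ℝ) 1, HasDerivAt (fun r => h (t + r * (s - t), p))
        ((s - t) • fderiv ℝ h (t + r * (s - t), p) (1, 0)) r := by
      intro r hr
      rw [Set.uIcc_of_le zero_le_one] at hr
      have hm := hconv s p ht hs r hr
      have h1 : HasFDerivAt h _ (t + r * (s - t), p) :=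
        ((hh.contDiffAt (hW.mem_nhds hm)).differentiableAt (by simp)).hasFDerivAt
      have h2 : HasDerivAt (fun r : ℝ => (t + r * (s - t), p)) ((s - t), (0 : E)) r := by
        have := ((hasDerivAt_id r).mul_const (s - t)).const_add t
        simp only [one_mul] at this
        exact this.prodMk (hasDerivAt_const r p)
      have h3 := h1.comp_hasDerivAt r h2
      refine h3.congr_deriv ?_
      rw [← map_smul]; simp
    have hci : ContinuousOn (fun r => fderiv ℝ h (t + r * (s - t), p) (1, 0))
        (Set.uIcc (0 : ℝ) 1) := by
      refine hd.continuousOn.comp (f := fun r : ℝ => (t + r * (s - t), p))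
        (Continuous.continuousOn (by fun_prop)) ?_
      rw [Set.uIcc_of_le zero_le_one]
      exact fun r hr => hconv s p ht hs r hr
    have := intervalIntegral.integral_eq_sub_of_hasDerivAt hder
      (hci.const_smul (s - t)).intervalIntegrable
    rw [intervalIntegral.integral_smul] at this
    simp only [hg]
    rw [this]
    simp

/-- A solution of a homogeneous linear differential equation that vanishes at `0` is zero. -/
theorem eq_zero_of_linear_ode {F : Type*} [NormedAddCommGroup F] [NormedSpace ℝ F]
    {L : ℝ → F →L[ℝ] F} {f : ℝ → F} (hL : ContinuousOn L (Set.Icc 0 1))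
    (hf : ∀ s ∈ Set.Icc (0 : ℝ) 1, HasDerivAt f (L s (f s)) s) (h0 : f 0 = 0) :
    ∀ s ∈ Set.Icc (0 : ℝ) 1, f s = 0 := by
  obtain ⟨K, hK⟩ := isCompact_Icc.exists_bound_of_continuousOn hL
  have hK0 : (0 : ℝ) ≤ K := (norm_nonneg _).trans (hK 0 (by simp))
  have := ODE_solution_unique_of_mem_Icc_right (v := fun t x => L t x) (s := fun _ => Set.univ)
    (K := K.toNNReal) (f := f) (g := fun _ => 0) (a := 0) (b := 1) ?_ ?_ ?_ (by simp) ?_ ?_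
    (by simp) h0
  · exact fun s hs => this hs
  · intro t ht
    refine LipschitzWith.lipschitzOnWith ((L t).lipschitz.weaken ?_)
    rw [← NNReal.coe_le_coe, Real.coe_toNNReal _ hK0]
    exact hK t ⟨ht.1, ht.2.le⟩
  · exact fun s hs => (hf s hs).continuousAt.continuousWithinAt
  · exact fun s hs => (hf s ⟨hs.1, hs.2.le⟩).hasDerivWithinAt
  · exact continuousOn_const
  · intro s _
    simpa using hasDerivWithinAt_const s (Set.Ici s) (0 : F)

/-- Symmetry of mixed partial derivatives for a function of `(r, x) ∈ ℝ × E`. -/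
theorem hasDerivAt_fderiv_of_contDiffAt {E F : Type*} [NormedAddCommGroup E] [NormedSpace ℝ E]
    [NormedAddCommGroup F] [NormedSpace ℝ F] {h : ℝ × E → F} {r : ℝ} {x u : E} {g : E → F}
    (hh : ContDiffAt ℝ 2 h (r, x)) (hg : ∀ᶠ y in 𝓝 x, HasDerivAt (fun r => h (r, y)) (g y) r) :
    DifferentiableAt ℝ g x ∧
      HasDerivAt (fun s => fderiv ℝ (fun y => h (s, y)) x u) (fderiv ℝ g x u) r := by
  have hd : ∀ᶠ q in 𝓝 (r, x), DifferentiableAt ℝ h q := by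
    filter_upwards [(hh.of_le (m := 1) (by norm_num)).eventually (by simp)] with q hq
    exact hq.differentiableAt (by simp)
  have hf' : DifferentiableAt ℝ (fderiv ℝ h) (r, x) :=
    (hh.fderiv_right (m := 1) (by norm_num)).differentiableAt (by simp)
  have hinl : ContinuousAt (fun s : ℝ => (s, x)) r := by fun_prop
  have hinr : ContinuousAt (fun y : E => (r, y)) x := by fun_prop
  have e1 : g =ᶠ[𝓝 x] fun y => fderiv ℝ h (r, y) (1, 0) := by
    filter_upwards [hinr.eventually hd, hg] with y hy hgy
    have h2 : HasDerivAt (fun s : ℝ => (s, y)) ((1 : ℝ), (0 : E)) r :=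
      (hasDerivAt_id r).prodMk (hasDerivAt_const r y)
    exact hgy.unique (hy.hasFDerivAt.comp_hasDerivAt r h2)
  have e2 : (fun s => fderiv ℝ (fun y => h (s, y)) x u) =ᶠ[𝓝 r]
      fun s => fderiv ℝ h (s, x) (0, u) := by
    filter_upwards [hinl.eventually hd] with s hs
    have h2 : HasFDerivAt (fun y => h (s, y)) _ x :=
      hs.hasFDerivAt.comp x (hasFDerivAt_prodMk_right s x)
    rw [h2.fderiv]
    simp
  have hsym := (hh.isSymmSndFDerivAt (by simp)) (1, 0) (0, u)
  have h3 : HasFDerivAt (fun y => fderiv ℝ h (r, y) (1, 0)) _ x :=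
    (((ContinuousLinearMap.apply ℝ F ((1 : ℝ), (0 : E))).hasFDerivAt.comp (r, x)
      hf'.hasFDerivAt).comp x (hasFDerivAt_prodMk_right r x))
  have h4 : HasDerivAt (fun s => fderiv ℝ h (s, x)) (fderiv ℝ (fderiv ℝ h) (r, x) (1, 0)) r :=
    hf'.hasFDerivAt.comp_hasDerivAt (f := fun s : ℝ => (s, x)) r
      ((hasDerivAt_id' r).prodMk (hasDerivAt_const r x))
  have h5 := h4.clm_apply (hasDerivAt_const r ((0 : ℝ), u))
  refine ⟨(h3.congr_of_eventuallyEq e1).differentiableAt, ?_⟩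
  rw [(h3.congr_of_eventuallyEq e1).fderiv]
  refine (h5.congr_of_eventuallyEq e2).congr_deriv ?_
  simpa using hsym

end Calculus

/-! ## The functions `exp` and `(exp - 1) / id` of `ad` -/

section ExpAd

universe u

variable {𝔤 : Type u} [NormedLieRing 𝔤] [NormedLieAlgebra 𝔤] [FiniteDimensional ℝ 𝔤]

theorem completeSpace_of_normedLieAlgebra (𝔤 : Type*) [NormedLieRing 𝔤] [NormedLieAlgebra 𝔤]
    [FiniteDimensional ℝ 𝔤] : CompleteSpace 𝔤 := FiniteDimensional.complete ℝ 𝔤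

attribute [local instance] completeSpace_of_normedLieAlgebra

open NormedSpace (exp)

/-- The adjoint representation as a continuous linear map. -/
def adL : 𝔤 →L[ℝ] (𝔤 →L[ℝ] 𝔤) :=
  LinearMap.toContinuousLinearMap
    { toFun := ad
      map_add' := fun x y => by ext z; simp [ad]
      map_smul' := fun c x => by ext z; simp [ad] }

theorem adL_apply (x : 𝔤) : adL x = ad x := rfl

theorem ad_apply (x y : 𝔤) : ad x y = ⁅x, y⁆ := rfl

theorem ad_add (x y : 𝔤) : ad (x + y) = ad x + ad y := map_add adL x y

theorem ad_smul (c : ℝ) (x : 𝔤) : ad (c • x) = c • ad x := map_smul adL c x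

theorem ad_zero : ad (0 : 𝔤) = 0 := map_zero adL

theorem ad_lie (x y : 𝔤) : ad ⁅x, y⁆ = ad x * ad y - ad y * ad x := by
  ext z
  simp [ad_apply]

/-- A real Banach algebra is a rational one. -/
abbrev normedAlgebraRat (𝔸 : Type*) [NormedRing 𝔸] [NormedAlgebra ℝ 𝔸] : NormedAlgebra ℚ 𝔸 :=
  NormedAlgebra.restrictScalars ℚ ℝ 𝔸

attribute [local instance] normedAlgebraRat

theorem contDiff_ad : ContDiff ℝ ∞ (ad : 𝔤 → 𝔤 →L[ℝ] 𝔤) :=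
  (adL : 𝔤 →L[ℝ] (𝔤 →L[ℝ] 𝔤)).contDiff

theorem contDiff_exp {𝔸 : Type*} [NormedRing 𝔸] [NormedAlgebra ℝ 𝔸] [CompleteSpace 𝔸] {n : ℕ∞ω} :
    ContDiff ℝ n (exp : 𝔸 → 𝔸) :=
  contDiff_iff_contDiffAt.2 fun x => (NormedSpace.exp_analytic (𝕂 := ℝ) x).contDiffAt

theorem hasSum_expDivided (A : 𝔤 →L[ℝ] 𝔤) :
    HasSum (fun n : ℕ => (((n + 1).factorial : ℝ)⁻¹) • A ^ n) (expDivided A) := by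
  refine Summable.hasSum (Summable.of_norm_bounded
    (NormedSpace.norm_expSeries_summable' (𝕂 := ℝ) A) fun n => ?_)
  rw [norm_smul, norm_smul]
  refine mul_le_mul_of_nonneg_right ?_ (norm_nonneg _)
  rw [norm_inv, norm_inv, RCLike.norm_natCast, RCLike.norm_natCast]
  gcongr
  lia

/-- Termwise integration of the exponential series, with $\int_0^1 r^n\,dr=1/(n+1)$. Smoothness, the
radial derivative and the reflection formula are all read off from this form. -/
theorem expDivided_eq_integral (A : 𝔤 →L[ℝ] 𝔤) :
    expDivided A = ∫ r in (0 : ℝ)..1, exp (r • A) := by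
  let f : ℕ → C(ℝ, 𝔤 →L[ℝ] 𝔤) := fun n =>
    ⟨fun r => (n.factorial : ℝ)⁻¹ • (r • A) ^ n, by fun_prop⟩
  have hf : Summable fun n => ‖(f n).restrict (⟨Set.uIcc (0 : ℝ) 1, isCompact_uIcc⟩ :
      TopologicalSpace.Compacts ℝ)‖ := by
    refine Summable.of_nonneg_of_le (fun n => by positivity)
      (fun n => ?_)
      (NormedSpace.norm_expSeries_summable' (𝕂 := ℝ) A)
    rw [ContinuousMap.norm_le _ (norm_nonneg _)]
    rintro ⟨r, hr⟩
    have hr : r ∈ Set.uIcc (0 : ℝ) 1 := hr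
    rw [Set.uIcc_of_le zero_le_one] at hr
    simp only [f, ContinuousMap.restrict_apply, ContinuousMap.coe_mk, smul_pow, norm_smul]
    refine mul_le_mul_of_nonneg_left ?_ (norm_nonneg _)
    refine mul_le_of_le_one_left (norm_nonneg _) ?_
    rw [norm_pow, Real.norm_of_nonneg hr.1]
    exact pow_le_one₀ hr.1 hr.2
  have h1 := intervalIntegral.hasSum_intervalIntegral_of_summable_norm (a := 0) (b := 1) hf
  have h2 : ∀ n, ∫ r in (0 : ℝ)..1, f n r = (((n + 1).factorial : ℝ)⁻¹) • A ^ n := by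
    intro n
    simp only [f, ContinuousMap.coe_mk, smul_pow]
    rw [intervalIntegral.integral_smul, intervalIntegral.integral_smul_const, integral_pow,
      smul_smul]
    congr 1
    rw [Nat.factorial_succ]
    push_cast
    field_simp
    simp
  simp only [h2] at h1
  rw [(hasSum_expDivided A).unique h1]
  refine intervalIntegral.integral_congr fun r _ => ?_
  exact (NormedSpace.exp_series_hasSum_exp' (𝕂 := ℝ) (r • A)).tsum_eq

theorem contDiff_expDivided : ContDiff ℝ ∞ (expDivided : (𝔤 →L[ℝ] 𝔤) → 𝔤 →L[ℝ] 𝔤) := by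
  have h := contDiffOn_integral (f := fun z : (𝔤 →L[ℝ] 𝔤) × ℝ => exp (z.2 • z.1))
    (U := Set.univ) (W := Set.univ) isOpen_univ isOpen_univ (Set.subset_univ _)
    (ContDiff.contDiffOn (contDiff_exp.comp (by fun_prop)))
  rw [contDiffOn_univ] at h
  convert h using 2 with A
  exact expDivided_eq_integral A

/-- By substitution in the integral form, the function is the primitive $\int_0^r e^{sA}\,ds$. -/
theorem hasDerivAt_smul_expDivided (A : 𝔤 →L[ℝ] 𝔤) (r : ℝ) :
    HasDerivAt (fun r : ℝ => r • expDivided (r • A)) (exp (r • A)) r := by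
  have hc : Continuous fun r : ℝ => exp (r • A) :=
    NormedSpace.exp_continuous.comp (by fun_prop)
  have h : (fun r : ℝ => r • expDivided (r • A)) = fun r => ∫ s in (0 : ℝ)..r, exp (s • A) := by
    funext r
    rw [expDivided_eq_integral]
    have := intervalIntegral.smul_integral_comp_mul_right (a := 0) (b := 1)
      (fun s : ℝ => exp (s • A)) r
    simpa [mul_smul] using this
  rw [h]
  exact intervalIntegral.integral_hasDerivAt_right (hc.intervalIntegrable _ _)
    hc.stronglyMeasurable.stronglyMeasurableAtFilter hc.continuousAt

theorem hasDerivAt_exp_smul (A : 𝔤 →L[ℝ] 𝔤) (r : ℝ) :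
    HasDerivAt (fun r : ℝ => exp (r • A)) (A * exp (r • A)) r :=
  hasDerivAt_exp_smul_const' A r

theorem mul_expDivided (A : 𝔤 →L[ℝ] 𝔤) : A * expDivided A = exp A - 1 := by
  have h1 := NormedSpace.exp_series_hasSum_exp' (𝕂 := ℝ) A
  rw [← hasSum_nat_add_iff' 1] at h1
  have h2 := (hasSum_expDivided A).mul_left A
  simp only [Finset.range_one, Finset.sum_singleton, Nat.factorial_zero, Nat.cast_one, inv_one,
    pow_zero, one_smul] at h1
  simp only [mul_smul_comm, ← pow_succ'] at h2
  exact h2.unique h1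

theorem semiconjBy_expDivided {A A' B : 𝔤 →L[ℝ] 𝔤} (h : SemiconjBy B A A') :
    SemiconjBy B (expDivided A) (expDivided A') := by
  have h2 := (hasSum_expDivided A).mul_left B
  have h3 := (hasSum_expDivided A').mul_right B
  refine h2.unique ?_
  convert h3 using 2 with n
  simp [(h.pow_right n).eq]

theorem exp_neg_mul_exp (A : 𝔤 →L[ℝ] 𝔤) : exp (-A) * exp A = 1 := by
  rw [← NormedSpace.exp_add_of_commute ((Commute.refl A).neg_left)]
  simp

theorem expDivided_zero : expDivided (0 : 𝔤 →L[ℝ] 𝔤) = 1 := by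
  rw [expDivided_eq_integral]
  simp

theorem expDivided_apply_of_apply_eq_zero {A : 𝔤 →L[ℝ] 𝔤} {v : 𝔤} (h : A v = 0) :
    expDivided A v = v := by
  have h2 := (hasSum_expDivided A).mapL (ContinuousLinearMap.apply ℝ 𝔤 v)
  refine h2.unique ?_
  convert hasSum_ite_eq 0 v using 2 with n
  cases n with
  | zero => simp
  | succ n => simp [pow_succ, h]

theorem exp_apply_of_apply_eq_zero {A : 𝔤 →L[ℝ] 𝔤} {v : 𝔤} (h : A v = 0) : exp A v = v := by
  have h1 := congrArg (fun B : 𝔤 →L[ℝ] 𝔤 => B v) (mul_expDivided A)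
  simp only [mul_apply_eq_comp, expDivided_apply_of_apply_eq_zero h, h, sub_apply,
    one_apply_eq_self] at h1
  exact (sub_eq_zero.1 h1.symm)

theorem expDivided_ad_self (x : 𝔤) : expDivided (ad x) x = x :=
  expDivided_apply_of_apply_eq_zero (by simp [ad_apply])

/-- The substitution $r\mapsto1-r$ in the integral form. -/
theorem exp_mul_expDivided_neg (A : 𝔤 →L[ℝ] 𝔤) : exp A * expDivided (-A) = expDivided A := by
  rw [expDivided_eq_integral, expDivided_eq_integral]
  have hc : Continuous fun r : ℝ => exp (r • -A) :=
    NormedSpace.exp_continuous.comp (by fun_prop)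
  have h1 := ((ContinuousLinearMap.mul ℝ (𝔤 →L[ℝ] 𝔤) (exp A))).intervalIntegral_comp_comm
    (hc.intervalIntegrable (μ := MeasureTheory.volume) 0 1)
  simp only [ContinuousLinearMap.mul_apply'] at h1
  rw [← h1]
  have h2 := intervalIntegral.integral_comp_sub_left (a := 0) (b := 1)
    (fun r : ℝ => exp (r • A)) 1
  simp only [sub_self, sub_zero] at h2
  rw [← h2]
  refine intervalIntegral.integral_congr fun r _ => ?_
  have : Commute A (r • -A) := ((Commute.refl A).neg_right).smul_right r
  rw [← NormedSpace.exp_add_of_commute this]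
  congr 1
  module

/-! ### Differential identities for the exponential of the adjoint representation -/

/-- `exp (ad x)` is an automorphism of the Lie algebra. -/
theorem exp_ad_mul_ad (x y : 𝔤) : exp (ad x) * ad y = ad (exp (ad x) y) * exp (ad x) := by
  -- The difference of the two sides, with `s • ad x` in place of `ad x`, vanishes at $s=0$ and
  -- solves $f'=\mathrm{ad}x\cdot f$.
  have key := eq_zero_of_linear_ode
    (L := fun _ => ContinuousLinearMap.mul ℝ (𝔤 →L[ℝ] 𝔤) (ad x))
    (f := fun s : ℝ => exp (s • ad x) * ad y - adL (exp (s • ad x) y) * exp (s • ad x))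
    continuousOn_const (fun s _ => ?_) (by simp [adL_apply]) 1 (by simp)
  · simpa [sub_eq_zero, adL_apply] using key
  · have h1 := hasDerivAt_exp_smul (ad x) s
    have h2 := (adL : 𝔤 →L[ℝ] (𝔤 →L[ℝ] 𝔤)).hasFDerivAt.comp_hasDerivAt s
      (h1.clm_apply (hasDerivAt_const s y))
    refine ((h1.mul_const (ad y)).sub (h2.mul h1)).congr_deriv ?_
    simp only [Function.comp, adL_apply, map_zero, add_zero, ContinuousLinearMap.mul_apply',
      mul_apply_eq_comp, ad_apply x, ad_lie]
    noncomm_ring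

theorem exp_ad_lie (x y z : 𝔤) :
    exp (ad x) ⁅y, z⁆ = ⁅exp (ad x) y, exp (ad x) z⁆ :=
  congrArg (fun A : 𝔤 →L[ℝ] 𝔤 => A z) (exp_ad_mul_ad x y)

theorem ad_exp_ad (x y : 𝔤) : ad (exp (ad x) y) = exp (ad x) * ad y * exp (-ad x) := by
  rw [exp_ad_mul_ad, mul_assoc, ← NormedSpace.exp_add_of_commute
    (Commute.neg_right (Commute.refl _))]
  simp

theorem exp_sub_one_apply (x u : 𝔤) (r : ℝ) :
    exp (r • ad x) u = u + ⁅x, (r • expDivided (r • ad x)) u⁆ := by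
  have h := mul_expDivided (r • ad x)
  have h2 := congrArg (fun A : 𝔤 →L[ℝ] 𝔤 => A u) h
  simp only [mul_apply_eq_comp, smul_apply, ad_apply,
    sub_apply, one_apply_eq_self] at h2
  rw [smul_apply, lie_smul, h2]
  abel

/-- The derivative of `x ↦ exp (ad x)`. -/
theorem fderiv_exp_ad (x u : 𝔤) :
    fderiv ℝ (fun x : 𝔤 => exp (ad x)) x u = ad (expDivided (ad x) u) * exp (ad x) := by
  have hsm : ContDiff ℝ ∞ (fun q : ℝ × 𝔤 => exp (q.1 • ad q.2)) :=
    contDiff_exp.comp (contDiff_fst.smul (contDiff_ad.comp contDiff_snd))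
  -- Both sides are deformed by $s$ and vanish at $s=0$. Exchanging $\partial_s$ with the derivative
  -- in $x$, and writing $e^{s\,\mathrm{ad}x}u=u+[x,a(s)]$ with $a(s)=s\Phi(s\,\mathrm{ad}x)u$,
  -- shows that their difference solves $f'=\mathrm{ad}x\cdot f$.
  have key := eq_zero_of_linear_ode
    (L := fun _ => ContinuousLinearMap.mul ℝ (𝔤 →L[ℝ] 𝔤) (ad x))
    (f := fun s : ℝ => fderiv ℝ (fun x : 𝔤 => exp (s • ad x)) x u -
      adL ((s • expDivided (s • ad x)) u) * exp (s • ad x))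
    continuousOn_const (fun s _ => ?_) (by simp [adL_apply, ad_zero]) 1 (by simp)
  · simpa [sub_eq_zero, adL_apply] using key
  · have h1 := hasDerivAt_exp_smul (ad x) s
    have h2 := (adL : 𝔤 →L[ℝ] (𝔤 →L[ℝ] 𝔤)).hasFDerivAt.comp_hasDerivAt s
      ((hasDerivAt_smul_expDivided (ad x) s).clm_apply (hasDerivAt_const s u))
    have h3 := (hasDerivAt_fderiv_of_contDiffAt (r := s) (x := x) (u := u)
      (hsm.contDiffAt.of_le (WithTop.coe_le_coe.2 le_top))
      (Filter.Eventually.of_forall fun y => hasDerivAt_exp_smul (ad y) s)).2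
    have h4 : DifferentiableAt ℝ (fun y : 𝔤 => exp (s • ad y)) x :=
      ((hsm.comp (contDiff_prodMk_right s)).differentiable (by simp)).differentiableAt
    have h5 : HasFDerivAt (fun y : 𝔤 => ad y * exp (s • ad y)) _ x :=
      (adL : 𝔤 →L[ℝ] (𝔤 →L[ℝ] 𝔤)).hasFDerivAt.mul' h4.hasFDerivAt
    refine (h3.sub (h2.mul h1)).congr_deriv ?_
    rw [h5.fderiv]
    simp only [Function.comp, map_zero, add_zero, exp_sub_one_apply x u s]
    simp only [adL_apply, ad_add, ad_lie, add_apply, ContinuousLinearMap.mul_apply', smul_apply,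
      smul_eq_mul, MulOpposite.smul_eq_mul_unop, MulOpposite.unop_op]
    noncomm_ring

theorem contDiff_expDivided_ad : ContDiff ℝ ∞ (fun x : 𝔤 => expDivided (ad x)) :=
  contDiff_expDivided.comp contDiff_ad

/-- The Maurer–Cartan equation for the form `u ↦ expDivided (ad x) u`. -/
theorem fderiv_expDivided_ad (x u v : 𝔤) :
    fderiv ℝ (fun x : 𝔤 => expDivided (ad x)) x u v -
      fderiv ℝ (fun x : 𝔤 => expDivided (ad x)) x v u =
      ⁅expDivided (ad x) u, expDivided (ad x) v⁆ := by
  have hsm : ContDiff ℝ ∞ (fun q : ℝ × 𝔤 => q.1 • expDivided (q.1 • ad q.2)) :=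
    contDiff_fst.smul
      (contDiff_expDivided.comp (contDiff_fst.smul (contDiff_ad.comp contDiff_snd)))
  have hD (s : ℝ) (u : 𝔤) : HasDerivAt
      (fun s : ℝ => fderiv ℝ (fun x : 𝔤 => s • expDivided (s • ad x)) x u)
      (ad u * (s • expDivided (s • ad x)) +
        ad x * fderiv ℝ (fun x : 𝔤 => s • expDivided (s • ad x)) x u) s := by
    have h3 := (hasDerivAt_fderiv_of_contDiffAt (r := s) (x := x) (u := u)
      (hsm.contDiffAt.of_le (WithTop.coe_le_coe.2 le_top))
      (Filter.Eventually.of_forall fun y => hasDerivAt_smul_expDivided (ad y) s)).2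
    have h4 : DifferentiableAt ℝ (fun y : 𝔤 => s • expDivided (s • ad y)) x :=
      ((hsm.comp (contDiff_prodMk_right s)).differentiable (by simp)).differentiableAt
    have h5 : HasFDerivAt (fun y : 𝔤 => 1 + ad y * (s • expDivided (s • ad y))) _ x :=
      ((adL : 𝔤 →L[ℝ] (𝔤 →L[ℝ] 𝔤)).hasFDerivAt.mul' h4.hasFDerivAt).const_add 1
    -- With the exponential written through `expDivided`, the equation for the derivative of `s •
    -- expDivided (s • ad x)` involves only that derivative itself.
    have h6 : (fun y : 𝔤 => exp (s • ad y)) = fun y => 1 + ad y * (s • expDivided (s • ad y)) := by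
      funext y
      ext v
      exact exp_sub_one_apply y v s
    rw [h6, h5.fderiv] at h3
    refine h3.congr_deriv ?_
    simp [adL_apply, add_comm]
  -- The defect in the Maurer–Cartan identity, deformed by $s$, solves $f'=[x,f]$ and starts at
  -- zero.
  have key := eq_zero_of_linear_ode (L := fun _ => ad x)
    (f := fun s : ℝ => fderiv ℝ (fun x : 𝔤 => s • expDivided (s • ad x)) x u v -
      fderiv ℝ (fun x : 𝔤 => s • expDivided (s • ad x)) x v u -
      adL ((s • expDivided (s • ad x)) u) ((s • expDivided (s • ad x)) v))
    continuousOn_const (fun s _ => ?_) (by simp [adL_apply, ad_zero]) 1 (by simp)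
  · simpa [sub_eq_zero, adL_apply, ad_apply] using key
  · have ha (w : 𝔤) := (hasDerivAt_smul_expDivided (ad x) s).clm_apply (hasDerivAt_const s w)
    have h2 := (adL : 𝔤 →L[ℝ] (𝔤 →L[ℝ] 𝔤)).hasFDerivAt.comp_hasDerivAt s (ha u)
    refine ((((hD s u).clm_apply (hasDerivAt_const s v)).sub
      ((hD s v).clm_apply (hasDerivAt_const s u))).sub (h2.clm_apply (ha v))).congr_deriv ?_
    simp only [Function.comp, map_zero, add_zero, exp_sub_one_apply x _ s, adL_apply, ad_apply,
      add_apply, mul_apply_eq_comp, lie_add, add_lie, lie_sub]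
    set a := (s • expDivided (s • ad x)) u
    set b := (s • expDivided (s • ad x)) v
    -- The Jacobi identity cancels the quadratic terms.
    rw [leibniz_lie x a b, ← lie_skew v a]
    abel

end ExpAd

/-! ## Logarithms in Banach algebras -/

section Logarithm

open NormedSpace (exp)

/-- The inverse function theorem at $0$, where the derivative of `exp` is the identity. -/
theorem exists_local_log (𝔸 : Type*) [NormedRing 𝔸] [NormedAlgebra ℝ 𝔸] [CompleteSpace 𝔸] :
    ∃ L : 𝔸 → 𝔸, L 1 = 0 ∧ (∀ᶠ T in 𝓝 (1 : 𝔸), ContDiffAt ℝ ∞ L T) ∧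
      (∀ᶠ T in 𝓝 (1 : 𝔸), exp (L T) = T) ∧ ∀ᶠ A in 𝓝 (0 : 𝔸), L (exp A) = A := by
  have hexp : ContDiffAt ℝ ω (exp : 𝔸 → 𝔸) 0 := contDiff_exp.contDiffAt
  have hd : HasFDerivAt (exp : 𝔸 → 𝔸) ((ContinuousLinearEquiv.refl ℝ 𝔸 : 𝔸 ≃L[ℝ] 𝔸) : 𝔸 →L[ℝ] 𝔸) 0 :=
    hasFDerivAt_exp_zero
  have hs : HasStrictFDerivAt (exp : 𝔸 → 𝔸)
      ((ContinuousLinearEquiv.refl ℝ 𝔸 : 𝔸 ≃L[ℝ] 𝔸) : 𝔸 →L[ℝ] 𝔸) 0 := hasStrictFDerivAt_exp_zero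
  refine ⟨hexp.localInverse hd (by simp), ?_, ?_, ?_, ?_⟩
  · have := hexp.localInverse_apply_image hd (by simp)
    simpa using this
  · have := hexp.to_localInverse hd (by simp)
    rw [NormedSpace.exp_zero] at this
    filter_upwards [this.eventually (by simp)] with T hT
    exact hT.of_le le_top
  · have := hs.eventually_right_inverse
    rw [NormedSpace.exp_zero] at this
    exact this
  · exact hs.eventually_left_inverse

theorem hasDerivAt_pow_of_commute {𝔸 : Type*} [NormedRing 𝔸] [NormedAlgebra ℝ 𝔸]
    {f : ℝ → 𝔸} {f' : 𝔸} {t : ℝ} (hf : HasDerivAt f f' t)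
    (hc : Commute (f t) f') (n : ℕ) :
    HasDerivAt (fun t => f t ^ (n + 1)) ((n + 1 : ℝ) • (f t ^ n * f')) t := by
  induction n with
  | zero => simpa using hf
  | succ n ih =>
    refine ((ih.mul hf).congr_of_eventuallyEq
      (Filter.Eventually.of_forall fun s => pow_succ (f s) (n + 1))).congr_deriv ?_
    rw [smul_mul_assoc, mul_assoc, ← hc.eq, ← mul_assoc, ← pow_succ]
    push_cast
    module

attribute [local instance] normedAlgebraRat

/-- The logarithm series inverts `exp` near `0`. -/
theorem hasSum_log_exp (𝔸 : Type*) [NormedRing 𝔸] [NormedAlgebra ℝ 𝔸] [CompleteSpace 𝔸] :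
    ∀ᶠ M in 𝓝 (0 : 𝔸), HasSum (fun k : ℕ => ((-1 : ℝ) ^ k / (k + 1)) • (exp M - 1) ^ (k + 1)) M := by
  have h1 : ∀ᶠ M in 𝓝 (0 : 𝔸), ‖1 - exp M‖ < 1 / 2 := by
    have h : ContinuousAt (fun M : 𝔸 => ‖1 - exp M‖) 0 :=
      (continuous_const.sub NormedSpace.exp_continuous).norm.continuousAt
    refine h.eventually_lt continuousAt_const ?_
    simp
  obtain ⟨ε, hε, hball⟩ := Metric.eventually_nhds_iff_ball.1 h1
  filter_upwards [Metric.ball_mem_nhds (0 : 𝔸) hε] with M hM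
  have hE : ∀ t ∈ Set.Icc (0 : ℝ) 1, ‖1 - exp (t • M)‖ < 1 / 2 := by
    intro t ht
    refine hball _ ?_
    rw [mem_ball_zero_iff] at hM ⊢
    rw [norm_smul, Real.norm_of_nonneg ht.1]
    exact lt_of_le_of_lt (mul_le_of_le_one_left (norm_nonneg _) ht.2) hM
  have hcE : Continuous fun t : ℝ => exp (t • M) := NormedSpace.exp_continuous.comp (by fun_prop)
  -- The function `f k` is the $t$-derivative of the $k$-th term of $\log e^{tM}$. With $E=e^{tM}$
  -- the geometric series gives $\sum_k(1-E)^kEM=M$ for every $t$, and integration over $[0,1]$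
  -- gives the logarithm series.
  let f : ℕ → C(ℝ, 𝔸) := fun k => ⟨fun t => (1 - exp (t • M)) ^ k * (exp (t • M) * M), by fun_prop⟩
  obtain ⟨B, hB⟩ := isCompact_Icc.exists_bound_of_continuousOn
    (f := fun t : ℝ => exp (t • M) * M) (s := Set.Icc (0 : ℝ) 1)
    (hcE.mul continuous_const).continuousOn
  have hB0 : 0 ≤ B := (norm_nonneg _).trans (hB 0 (by simp))
  have hf : Summable fun k => ‖(f k).restrict (⟨Set.uIcc (0 : ℝ) 1, isCompact_uIcc⟩ :
      TopologicalSpace.Compacts ℝ)‖ := by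
    refine Summable.of_nonneg_of_le (fun n => by positivity) (fun k => ?_)
      ((summable_geometric_of_lt_one (r := 1 / 2) (by norm_num) (by norm_num)).mul_left
        ((1 + ‖(1 : 𝔸)‖) * B))
    rw [ContinuousMap.norm_le _ (by positivity)]
    rintro ⟨t, ht⟩
    have ht : t ∈ Set.uIcc (0 : ℝ) 1 := ht
    rw [Set.uIcc_of_le zero_le_one] at ht
    -- The factor `1 + ‖1‖` covers $k=0$, since the norm of the unit is not assumed to be $1$.
    have hp : ‖(1 - exp (t • M)) ^ k‖ ≤ (1 + ‖(1 : 𝔸)‖) * (1 / 2) ^ k := by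
      cases k with
      | zero => simp
      | succ k =>
        refine (norm_pow_le' _ k.succ_pos).trans ?_
        refine (pow_le_pow_left₀ (norm_nonneg _) (hE t ht).le _).trans ?_
        exact le_mul_of_one_le_left (by positivity) (by simp)
    simp only [f, ContinuousMap.restrict_apply, ContinuousMap.coe_mk]
    refine (norm_mul_le _ _).trans ?_
    calc _ ≤ (1 + ‖(1 : 𝔸)‖) * (1 / 2) ^ k * B := by
          exact mul_le_mul hp (hB t ht) (norm_nonneg _) (by positivity)
      _ = _ := by ring
  have h2 := intervalIntegral.hasSum_intervalIntegral_of_summable_norm (a := 0) (b := 1) hf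
  have hcomm (t : ℝ) : Commute (exp (t • M)) M := ((Commute.refl M).smul_left t).exp_left
  have h3 (k : ℕ) : ∫ t in (0 : ℝ)..1, f k t =
      ((-1 : ℝ) ^ k / (k + 1)) • (exp M - 1) ^ (k + 1) := by
    have hd (t : ℝ) : HasDerivAt
        (fun t : ℝ => ((-1 : ℝ) ^ k / (k + 1)) • (exp (t • M) - 1) ^ (k + 1)) (f k t) t := by
      have e1 : HasDerivAt (fun t : ℝ => exp (t • M) - 1) (exp (t • M) * M) t :=
        (hasDerivAt_exp_smul_const M t).sub_const 1
      have e2 : Commute (exp (t • M) - 1) (exp (t • M) * M) :=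
        (((Commute.refl _).mul_right (hcomm t))).sub_left (Commute.one_left _)
      refine ((hasDerivAt_pow_of_commute e1 e2 k).const_smul ((-1 : ℝ) ^ k / (k + 1))).congr_deriv ?_
      simp only [f, ContinuousMap.coe_mk]
      rw [smul_smul, div_mul_cancel₀ _ (by positivity), ← smul_mul_assoc]
      congr 1
      rw [← neg_sub (exp (t • M)) 1, ← neg_one_smul ℝ (exp (t • M) - 1), smul_pow]
    rw [intervalIntegral.integral_eq_sub_of_hasDerivAt (fun t _ => hd t)
      ((f k).continuous.intervalIntegrable _ _)]
    simp
  simp only [h3] at h2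
  have h4 : ∀ t ∈ Set.uIcc (0 : ℝ) 1, ∑' k, f k t = M := by
    intro t ht
    rw [Set.uIcc_of_le zero_le_one] at ht
    have hlt : ‖1 - exp (t • M)‖ < 1 := (hE t ht).trans (by norm_num)
    have h5 := (summable_geometric_of_norm_lt_one hlt).tsum_mul_right
      (exp (t • M) * M)
    have h6 := geom_series_mul_neg _ hlt
    simp only [f, ContinuousMap.coe_mk]
    rw [h5, ← mul_assoc]
    rw [sub_sub_cancel] at h6
    rw [h6, one_mul]
  rw [intervalIntegral.integral_congr h4] at h2
  simpa using h2

end Logarithm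

/-! ## Evaluation of power series over the free associative algebra -/

section Evaluation

open NormedSpace (exp)

variable {𝔸 : Type*} [NormedRing 𝔸] [NormedAlgebra ℝ 𝔸]

/-- The series `∑ sⁿ ρ(fₙ)` converges absolutely to `A`, with sum of norms at most `M`. -/
def EvalsTo (ρ : Ass →ₐ[ℝ] 𝔸) (s : ℝ) (f : PowerSeries Ass) (A : 𝔸) (M : ℝ) : Prop :=
  (Summable fun n => ‖s ^ n • ρ (PowerSeries.coeff n f)‖) ∧
    ∑' n, ‖s ^ n • ρ (PowerSeries.coeff n f)‖ ≤ M ∧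
    HasSum (fun n => s ^ n • ρ (PowerSeries.coeff n f)) A

variable {ρ : Ass →ₐ[ℝ] 𝔸} {s : ℝ}

/-- The Cauchy product of absolutely convergent series. The bounds on the sums of norms multiply,
and later serve to majorise the whole logarithm series. -/
theorem EvalsTo.mul [CompleteSpace 𝔸] {f g : PowerSeries Ass} {A B : 𝔸} {M N : ℝ} (hf : EvalsTo ρ s f A M)
    (hg : EvalsTo ρ s g B N) : EvalsTo ρ s (f * g) (A * B) (M * N) := by
  have e : ∀ n, s ^ n • ρ (PowerSeries.coeff n (f * g)) =
      ∑ kl ∈ Finset.HasAntidiagonal.antidiagonal n, (s ^ kl.1 • ρ (PowerSeries.coeff kl.1 f)) *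
        (s ^ kl.2 • ρ (PowerSeries.coeff kl.2 g)) := by
    intro n
    rw [PowerSeries.coeff_mul, map_sum, Finset.smul_sum]
    refine Finset.sum_congr rfl fun kl hkl => ?_
    rw [map_mul, smul_mul_smul_comm, ← pow_add, Finset.HasAntidiagonal.mem_antidiagonal.1 hkl]
  have h1 := summable_norm_sum_mul_antidiagonal_of_summable_norm hf.1 hg.1
  have h2 := tsum_mul_tsum_eq_tsum_sum_antidiagonal_of_summable_norm hf.1 hg.1
  have hf1 : Summable fun n => ‖‖s ^ n • ρ (PowerSeries.coeff n f)‖‖ := by simpa using hf.1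
  have hg1 : Summable fun n => ‖‖s ^ n • ρ (PowerSeries.coeff n g)‖‖ := by simpa using hg.1
  have h3 := tsum_mul_tsum_eq_tsum_sum_antidiagonal_of_summable_norm hf1 hg1
  have h4 := summable_norm_sum_mul_antidiagonal_of_summable_norm hf1 hg1
  simp only [← e] at h1 h2
  refine ⟨h1, ?_, ?_⟩
  · calc ∑' n, ‖s ^ n • ρ (PowerSeries.coeff n (f * g))‖
        ≤ ∑' n, ∑ kl ∈ Finset.HasAntidiagonal.antidiagonal n, ‖s ^ kl.1 • ρ (PowerSeries.coeff kl.1 f)‖ *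
            ‖s ^ kl.2 • ρ (PowerSeries.coeff kl.2 g)‖ := by
          refine h1.tsum_le_tsum (fun n => ?_) h4.of_norm
          rw [e]
          exact (norm_sum_le _ _).trans (Finset.sum_le_sum fun _ _ => norm_mul_le _ _)
      _ ≤ M * N := by
          rw [← h3]
          exact mul_le_mul hf.2.1 hg.2.1 (tsum_nonneg fun _ => norm_nonneg _)
            ((tsum_nonneg fun _ => norm_nonneg _).trans hf.2.1)
  · rw [← hf.2.2.tsum_eq, ← hg.2.2.tsum_eq, h2]
    exact h1.of_norm.hasSum

theorem EvalsTo.one [NormOneClass 𝔸] : EvalsTo ρ s 1 1 1 := by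
  have e : (fun n => s ^ n • ρ (PowerSeries.coeff n (1 : PowerSeries Ass))) =
      fun n => if n = 0 then (1 : 𝔸) else 0 := by
    funext n
    rw [PowerSeries.coeff_one]
    split_ifs with h <;> simp [h]
  have e' : (fun n => ‖s ^ n • ρ (PowerSeries.coeff n (1 : PowerSeries Ass))‖) =
      fun n => if n = 0 then (1 : ℝ) else 0 := by
    funext n
    rw [congrFun e n]
    split_ifs <;> simp
  have h := hasSum_ite_eq (0 : ℕ) (1 : ℝ)
  rw [EvalsTo, e', e]
  exact ⟨h.summable, h.tsum_eq.le, hasSum_ite_eq _ _⟩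

theorem EvalsTo.pow [CompleteSpace 𝔸] [NormOneClass 𝔸] {f : PowerSeries Ass} {A : 𝔸} {M : ℝ}
    (hf : EvalsTo ρ s f A M) (k : ℕ) :
    EvalsTo ρ s (f ^ k) (A ^ k) (M ^ k) := by
  induction k with
  | zero => simpa using EvalsTo.one
  | succ k ih => simpa only [pow_succ] using ih.mul hf

/-- Deleting a constant term equal to $1$ lowers the sum of norms by exactly $1$. This yields the
majorant $e^me^m-1$, which is less than $1$ for small $m$. -/
theorem EvalsTo.sub_one [NormOneClass 𝔸] {f : PowerSeries Ass} {A : 𝔸} {M : ℝ} (hf : EvalsTo ρ s f A M)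
    (h0 : PowerSeries.coeff 0 f = 1) : EvalsTo ρ s (f - 1) (A - 1) (M - 1) := by
  have e : (fun n => s ^ n • ρ (PowerSeries.coeff n (f - 1))) =
      fun n => s ^ n • ρ (PowerSeries.coeff n f) - if n = 0 then (1 : 𝔸) else 0 := by
    funext n
    rw [map_sub, PowerSeries.coeff_one]
    split_ifs with h <;> simp [h]
  have e' : (fun n => ‖s ^ n • ρ (PowerSeries.coeff n (f - 1))‖) =
      fun n => ‖s ^ n • ρ (PowerSeries.coeff n f)‖ - if n = 0 then (1 : ℝ) else 0 := by
    funext n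
    rw [congrFun e n]
    split_ifs with h
    · simp [h, h0]
    · simp
  have h := hf.1.hasSum.sub (hasSum_ite_eq (0 : ℕ) (1 : ℝ))
  rw [EvalsTo, e', e]
  exact ⟨h.summable, h.tsum_eq.le.trans (sub_le_sub_right hf.2.1 1),
    hf.2.2.sub (hasSum_ite_eq _ _)⟩

theorem evalsTo_expT [CompleteSpace 𝔸] [NormOneClass 𝔸] {a : Ass} {m : ℝ}
    (hs : s ∈ Set.Icc (0 : ℝ) 1) (ha : ‖ρ a‖ ≤ m) :
    EvalsTo ρ s (expT a) (exp (s • ρ a)) (Real.exp m) := by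
  have e : (fun n => s ^ n • ρ (PowerSeries.coeff n (expT a))) =
      fun n => (n.factorial : ℝ)⁻¹ • (s • ρ a) ^ n := by
    funext n
    simp only [expT, PowerSeries.coeff_mk, map_smul, map_pow, smul_pow]
    rw [smul_comm]
  have hm : 0 ≤ m := (norm_nonneg _).trans ha
  have hR : HasSum (fun n : ℕ => (n.factorial : ℝ)⁻¹ • m ^ n) (Real.exp m) := by
    rw [Real.exp_eq_exp_ℝ]
    exact NormedSpace.exp_series_hasSum_exp' (𝕂 := ℝ) m
  have hle (n : ℕ) : ‖(n.factorial : ℝ)⁻¹ • (s • ρ a) ^ n‖ ≤ (n.factorial : ℝ)⁻¹ • m ^ n := by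
    rw [norm_smul, smul_eq_mul, norm_inv, RCLike.norm_natCast]
    refine mul_le_mul_of_nonneg_left ((norm_pow_le _ n).trans ?_) (by positivity)
    refine pow_le_pow_left₀ (norm_nonneg _) ?_ n
    rw [norm_smul, Real.norm_of_nonneg hs.1]
    exact (mul_le_of_le_one_left (norm_nonneg _) hs.2).trans ha
  have h1 := NormedSpace.norm_expSeries_summable' (𝕂 := ℝ) (s • ρ a)
  simp only [EvalsTo, congrFun e]
  exact ⟨h1, (h1.tsum_le_tsum hle hR.summable).trans hR.tsum_eq.le,
    NormedSpace.exp_series_hasSum_exp' (𝕂 := ℝ) (s • ρ a)⟩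

/-- Fubini for an absolutely summable double array. It is used to pass from powers of $e^xe^y-1$
(rows) to homogeneous components (columns). -/
theorem hasSum_tsum_of_hasSum_rows {𝔸 : Type*} [NormedAddCommGroup 𝔸] [CompleteSpace 𝔸]
    {u : ℕ × ℕ → 𝔸} (hu : Summable fun p => ‖u p‖) {r c : ℕ → 𝔸}
    (hrow : ∀ k, HasSum (fun n => u (k, n)) (r k)) (hcol : ∀ n, HasSum (fun k => u (k, n)) (c n)) :
    (Summable fun n => ‖c n‖) ∧ HasSum c (∑' k, r k) := by
  have hsw : HasSum (fun p : ℕ × ℕ => u p.swap) (∑' p, u p) :=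
    (Equiv.prodComm ℕ ℕ).hasSum_iff.2 hu.of_norm.hasSum
  have h3 : Summable fun p : ℕ × ℕ => ‖u p.swap‖ := (Equiv.prodComm ℕ ℕ).summable_iff.2 hu
  refine ⟨Summable.of_nonneg_of_le (fun _ => norm_nonneg _) (fun n => ?_) h3.prod, ?_⟩
  · rw [← (hcol n).tsum_eq]
    exact norm_tsum_le_tsum_norm (h3.prod_factor n)
  · have h4 := hsw.prod_fiberwise (fun n => hcol n)
    rwa [(hu.of_norm.hasSum.prod_fiberwise hrow).tsum_eq]

/-- The series `log (e^x e^y)` may be evaluated in a Banach algebra at small elements. -/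
theorem hasSum_logExpExp [CompleteSpace 𝔸] [NormOneClass 𝔸] {m : ℝ} (hs : s ∈ Set.Icc (0 : ℝ) 1)
    (hx : ‖ρ (FreeAlgebra.ι ℝ 0)‖ ≤ m) (hy : ‖ρ (FreeAlgebra.ι ℝ 1)‖ ≤ m)
    (hm : Real.exp m * Real.exp m - 1 < 1) :
    (Summable fun n => ‖s ^ n • ρ (logExpExp n)‖) ∧
    HasSum (fun n => s ^ n • ρ (logExpExp n)) (∑' k : ℕ, ((-1 : ℝ) ^ k / (k + 1)) •
      (exp (s • ρ (FreeAlgebra.ι ℝ 0)) * exp (s • ρ (FreeAlgebra.ι ℝ 1)) - 1) ^ (k + 1)) := by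
  set f : PowerSeries Ass := expT (FreeAlgebra.ι ℝ 0) * expT (FreeAlgebra.ι ℝ 1) - 1 with hf
  set A : 𝔸 := exp (s • ρ (FreeAlgebra.ι ℝ 0)) * exp (s • ρ (FreeAlgebra.ι ℝ 1)) - 1
  set M : ℝ := Real.exp m * Real.exp m - 1
  have hE : EvalsTo ρ s f A M :=
    ((evalsTo_expT hs hx).mul (evalsTo_expT hs hy)).sub_one (by
      rw [PowerSeries.coeff_mul]; simp [expT])
  have hM0 : 0 ≤ M := (tsum_nonneg fun _ => norm_nonneg _).trans hE.2.1
  have h0 : PowerSeries.constantCoeff f = 0 := by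
    rw [← PowerSeries.coeff_zero_eq_constantCoeff_apply, hf, map_sub, PowerSeries.coeff_mul]
    simp [expT]
  -- Without constant term, the $k$-th power of `f` starts in degree $k$. Hence the finite sum
  -- defining `logExpExp n` is the full sum of the column `n`.
  have hdvd (n k : ℕ) (h : n < k) : PowerSeries.coeff n (f ^ k) = 0 :=
    PowerSeries.coeff_of_lt_order n (lt_of_lt_of_le (by exact_mod_cast h)
      (PowerSeries.le_order_pow_of_constantCoeff_eq_zero k h0))
  let u : ℕ × ℕ → 𝔸 := fun p =>
    ((-1 : ℝ) ^ p.1 / (p.1 + 1)) • s ^ p.2 • ρ (PowerSeries.coeff p.2 (f ^ (p.1 + 1)))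
  have hc (k : ℕ) : ‖(-1 : ℝ) ^ k / (k + 1)‖ ≤ 1 := by
    rw [norm_div, norm_pow, norm_neg, norm_one, one_pow]
    have : (1 : ℝ) ≤ ‖(k + 1 : ℝ)‖ := by
      rw [Real.norm_of_nonneg (by positivity)]; simp
    exact div_le_one_of_le₀ this (norm_nonneg _)
  have hu : Summable fun p => ‖u p‖ := by
    rw [summable_prod_of_nonneg fun _ => norm_nonneg _]
    have hk (k : ℕ) := hE.pow (k + 1)
    have h1 (k n : ℕ) : ‖u (k, n)‖ ≤ ‖s ^ n • ρ (PowerSeries.coeff n (f ^ (k + 1)))‖ := by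
      simp only [u]
      rw [norm_smul]
      exact mul_le_of_le_one_left (norm_nonneg _) (hc k)
    have h2 (k : ℕ) : Summable fun n => ‖u (k, n)‖ :=
      Summable.of_nonneg_of_le (fun _ => norm_nonneg _) (h1 k) (hk k).1
    refine ⟨h2, Summable.of_nonneg_of_le (fun k => tsum_nonneg fun _ => norm_nonneg _)
      (fun k => ((h2 k).tsum_le_tsum (h1 k) (hk k).1).trans (hk k).2.1) ?_⟩
    exact (summable_nat_add_iff 1).2 (summable_geometric_of_lt_one hM0 hm)
  have hrow (k : ℕ) : HasSum (fun n => u (k, n)) (((-1 : ℝ) ^ k / (k + 1)) • A ^ (k + 1)) :=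
    (hE.pow (k + 1)).2.2.const_smul _
  have hcol (n : ℕ) : HasSum (fun k => u (k, n)) (s ^ n • ρ (logExpExp n)) := by
    have h1 : s ^ n • ρ (logExpExp n) = ∑ k ∈ Finset.range n, u (k, n) := by
      have h2 : logExpExp n = ∑ k ∈ Finset.range n,
          ((-1 : ℝ) ^ k / (k + 1)) • PowerSeries.coeff n (f ^ (k + 1)) := by
        rw [logExpExp, Finset.range_eq_Ico, ← Finset.Ico_add_one_right_eq_Icc,
          ← Finset.sum_Ico_add' _ 0 n 1]
        refine Finset.sum_congr rfl fun k _ => ?_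
        simp [hf]
      rw [h2, map_sum, Finset.smul_sum]
      refine Finset.sum_congr rfl fun k _ => ?_
      rw [map_smul, smul_comm]
    rw [h1]
    refine hasSum_sum_of_ne_finset_zero fun k hk => ?_
    simp only [u]
    rw [hdvd n (k + 1) (by simp at hk; lia)]
    simp
  exact hasSum_tsum_of_hasSum_rows hu hrow hcol

end Evaluation

/-! ## The Campbell–Hausdorff series near the origin -/

section CampbellHausdorff

universe u

variable {𝔤 : Type u} [NormedLieRing 𝔤] [NormedLieAlgebra 𝔤] [FiniteDimensional ℝ 𝔤]

attribute [local instance] completeSpace_of_normedLieAlgebra normedAlgebraRat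

open NormedSpace (exp)

/-- The endomorphism `(x, c) ↦ (A x + c v, 0)` of `𝔤 × ℝ`. -/
def affineEnd : (𝔤 →L[ℝ] 𝔤) × 𝔤 →L[ℝ] (𝔤 × ℝ →L[ℝ] 𝔤 × ℝ) :=
  LinearMap.toContinuousLinearMap
    { toFun := fun p => (p.1 ∘L ContinuousLinearMap.fst ℝ 𝔤 ℝ +
        (ContinuousLinearMap.toSpanSingleton ℝ p.2) ∘L ContinuousLinearMap.snd ℝ 𝔤 ℝ).prod 0
      map_add' := fun p q => by ext <;> simp
      map_smul' := fun c p => by ext <;> simp }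

theorem affineEnd_apply (A : 𝔤 →L[ℝ] 𝔤) (v x : 𝔤) (c : ℝ) :
    affineEnd (A, v) (x, c) = (A x + c • v, 0) := by
  simp [affineEnd]

theorem affineEnd_pow_succ_apply (A : 𝔤 →L[ℝ] 𝔤) (v x : 𝔤) (c : ℝ) (n : ℕ) :
    (affineEnd (A, v) ^ (n + 1)) (x, c) = ((A ^ (n + 1)) x + c • (A ^ n) v, 0) := by
  induction n with
  | zero => simp [affineEnd_apply]
  | succ n ih =>
    rw [pow_succ', mul_apply_eq_comp, ih, affineEnd_apply, pow_succ' A (n + 1),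
      mul_apply_eq_comp, map_add, map_smul, pow_succ' A n, mul_apply_eq_comp]
    simp

/-- In `affineEnd (A, v) ^ (n + 1)` the vector `v` meets only `A ^ n`, so the exponential series
applied to `v` is shifted by one and sums to `expDivided A v`. -/
theorem exp_affineEnd_apply (A : 𝔤 →L[ℝ] 𝔤) (v x : 𝔤) (c : ℝ) :
    exp (affineEnd (A, v)) (x, c) = (exp A x + c • expDivided A v, c) := by
  have h1 := (NormedSpace.exp_series_hasSum_exp' (𝕂 := ℝ) (affineEnd (A, v))).mapL
    (ContinuousLinearMap.apply ℝ (𝔤 × ℝ) (x, c))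
  rw [← hasSum_nat_add_iff' 1] at h1
  have h2 := (NormedSpace.exp_series_hasSum_exp' (𝕂 := ℝ) A).mapL
    (ContinuousLinearMap.apply ℝ 𝔤 x)
  rw [← hasSum_nat_add_iff' 1] at h2
  have h3 := ((hasSum_expDivided A).mapL (ContinuousLinearMap.apply ℝ 𝔤 v)).const_smul c
  have h4 := (h2.add h3).prodMk (hasSum_zero (α := ℝ) (β := ℕ))
  have e : (fun n : ℕ => ContinuousLinearMap.apply ℝ (𝔤 × ℝ) (x, c)
      (((n + 1).factorial : ℝ)⁻¹ • affineEnd (A, v) ^ (n + 1))) = fun n : ℕ =>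
        (ContinuousLinearMap.apply ℝ 𝔤 x (((n + 1).factorial : ℝ)⁻¹ • A ^ (n + 1)) +
          c • ContinuousLinearMap.apply ℝ 𝔤 v (((n + 1).factorial : ℝ)⁻¹ • A ^ n), 0) := by
    funext n
    simp only [ContinuousLinearMap.apply_apply, smul_apply, affineEnd_pow_succ_apply]
    rw [Prod.smul_mk, smul_zero, smul_add, smul_comm c]
  rw [e] at h1
  have h5 := h1.unique h4
  rw [sub_eq_iff_eq_add] at h5
  rw [ContinuousLinearMap.apply_apply] at h5
  rw [h5]
  simp
  abel

/-- `log (e^{ad X} e^{ad Y})`, for a local logarithm. -/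
def logAd (q : 𝔤 × 𝔤) : 𝔤 →L[ℝ] 𝔤 :=
  Classical.choose (exists_local_log (𝔤 →L[ℝ] 𝔤)) (exp (ad q.1) * exp (ad q.2))

/-- The derivative `d/ds Z(s q)` is `bchField (s q) q`. -/
def bchField (q : 𝔤 × 𝔤) : 𝔤 × 𝔤 →L[ℝ] 𝔤 :=
  Ring.inverse (expDivided (logAd q)) ∘L
    (ContinuousLinearMap.fst ℝ 𝔤 𝔤 + exp (ad q.1) ∘L ContinuousLinearMap.snd ℝ 𝔤 𝔤)

theorem contDiff_exp_ad_mul_exp_ad :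
    ContDiff ℝ ∞ fun q : 𝔤 × 𝔤 => exp (ad q.1) * exp (ad q.2) :=
  (contDiff_exp.comp (contDiff_ad.comp contDiff_fst)).mul
    (contDiff_exp.comp (contDiff_ad.comp contDiff_snd))

theorem tendsto_exp_ad_mul_exp_ad :
    Filter.Tendsto (fun q : 𝔤 × 𝔤 => exp (ad q.1) * exp (ad q.2)) (𝓝 0) (𝓝 1) := by
  have := (contDiff_exp_ad_mul_exp_ad (𝔤 := 𝔤)).continuous.tendsto 0
  simpa [ad_zero] using this

theorem logAd_zero : logAd (0 : 𝔤 × 𝔤) = 0 := by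
  have := (Classical.choose_spec (exists_local_log (𝔤 →L[ℝ] 𝔤))).1
  simpa [logAd, ad_zero] using this

theorem eventually_contDiffAt_logAd : ∀ᶠ q in 𝓝 (0 : 𝔤 × 𝔤), ContDiffAt ℝ ∞ logAd q := by
  filter_upwards [tendsto_exp_ad_mul_exp_ad.eventually
    (Classical.choose_spec (exists_local_log (𝔤 →L[ℝ] 𝔤))).2.1] with q hq
  exact hq.comp q contDiff_exp_ad_mul_exp_ad.contDiffAt

theorem eventually_exp_logAd :
    ∀ᶠ q in 𝓝 (0 : 𝔤 × 𝔤), exp (logAd q) = exp (ad q.1) * exp (ad q.2) :=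
  tendsto_exp_ad_mul_exp_ad.eventually
    (Classical.choose_spec (exists_local_log (𝔤 →L[ℝ] 𝔤))).2.2.1

theorem tendsto_logAd : Filter.Tendsto logAd (𝓝 (0 : 𝔤 × 𝔤)) (𝓝 0) := by
  have := (eventually_contDiffAt_logAd (𝔤 := 𝔤)).self_of_nhds.continuousAt.tendsto
  rwa [logAd_zero] at this

theorem eventually_isUnit_expDivided :
    ∀ᶠ A in 𝓝 (0 : 𝔤 →L[ℝ] 𝔤), IsUnit (expDivided A) := by
  have h : Filter.Tendsto (expDivided : (𝔤 →L[ℝ] 𝔤) → _) (𝓝 0) (𝓝 1) := by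
    have := (contDiff_expDivided (𝔤 := 𝔤)).continuous.tendsto 0
    rwa [expDivided_zero] at this
  exact h.eventually (Units.isOpen.mem_nhds isUnit_one)

theorem eventually_contDiffAt_bchField : ∀ᶠ q in 𝓝 (0 : 𝔤 × 𝔤), ContDiffAt ℝ ∞ bchField q := by
  filter_upwards [eventually_contDiffAt_logAd,
    tendsto_logAd.eventually eventually_isUnit_expDivided] with q hq hu
  obtain ⟨w, hw⟩ := hu
  have h1 : ContDiffAt ℝ ∞ (fun q : 𝔤 × 𝔤 => Ring.inverse (expDivided (logAd q))) q := by
    have := contDiffAt_ringInverse ℝ w (n := ∞)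
    rw [hw] at this
    exact this.comp q (contDiff_expDivided.contDiffAt.comp q hq)
  refine h1.clm_comp (contDiffAt_const.add (ContDiffAt.clm_comp ?_ contDiffAt_const))
  exact contDiff_exp.contDiffAt.comp q (contDiff_ad.contDiffAt.comp q contDiffAt_fst)

theorem expDivided_bchField_apply {q : 𝔤 × 𝔤} (h : IsUnit (expDivided (logAd q))) (p : 𝔤 × 𝔤) :
    expDivided (logAd q) (bchField q p) = p.1 + exp (ad q.1) p.2 := by
  have h1 : expDivided (logAd q) * Ring.inverse (expDivided (logAd q)) = 1 :=
    Ring.mul_inverse_cancel _ h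
  have h2 := congrArg (fun A : 𝔤 →L[ℝ] 𝔤 => A (p.1 + exp (ad q.1) p.2)) h1
  simpa [bchField] using h2

/-! ### Evaluation of Dynkin's series by affine operators -/

/-- The evaluation of the free algebra at the operators `letterAct`. -/
def letterEval (q : 𝔤 × 𝔤) : Ass →ₐ[ℝ] (𝔤 × ℝ →L[ℝ] 𝔤 × ℝ) :=
  FreeAlgebra.lift ℝ fun i : Fin 2 => affineEnd (ad (![q.1, q.2] i), ![q.1, q.2] i)

/-- This places the Dynkin map inside a Banach algebra, where the logarithm series can be summed
before it is applied to the vector `(0, 1)`. -/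
theorem dynkinMap_eq_letterEval (q : 𝔤 × 𝔤) (a : Ass) :
    dynkinMap q.1 q.2 a = (letterEval q a (0, 1)).1 := by
  obtain ⟨c, hc⟩ : ∃ c : (𝔤 × ℝ →L[ℝ] 𝔤 × ℝ) →ₐ[ℝ] Module.End ℝ (𝔤 × ℝ), ∀ A p, c A p = A p :=
    ⟨AlgHom.ofLinearMap (ContinuousLinearMap.coeLM ℝ) rfl fun _ _ => rfl, fun _ _ => rfl⟩
  have h : (FreeAlgebra.lift ℝ fun i : Fin 2 => letterAct (![q.1, q.2] i)) =
      c.comp (letterEval q) := by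
    ext i p
    all_goals simp [hc, letterEval, letterAct, affineEnd, ad]
  simp [dynkinMap, h, hc]

theorem letterEval_zero (q : 𝔤 × 𝔤) : letterEval q (FreeAlgebra.ι ℝ 0) = affineEnd (ad q.1, q.1) := by
  simp [letterEval]

theorem letterEval_one (q : 𝔤 × 𝔤) : letterEval q (FreeAlgebra.ι ℝ 1) = affineEnd (ad q.2, q.2) := by
  simp [letterEval]

/-- For $q=(X,Y)$ and $s=1$, the product of the two exponentials has linear part
$e^{\mathrm{ad}X}e^{\mathrm{ad}Y}$ and affine part $X+e^{\mathrm{ad}X}Y$. The field `bchField` is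
defined as the solution of $\Phi(\log(e^{\mathrm{ad}X}e^{\mathrm{ad}Y}))v=X+e^{\mathrm{ad}X}Y$, so a
single exponential has the same two parts. -/
theorem exp_letters {q : 𝔤 × 𝔤} {s : ℝ}
    (h1 : exp (logAd (s • q)) = exp (ad (s • q.1)) * exp (ad (s • q.2)))
    (h2 : IsUnit (expDivided (logAd (s • q)))) :
    exp (s • affineEnd (ad q.1, q.1)) * exp (s • affineEnd (ad q.2, q.2)) =
      exp (affineEnd (logAd (s • q), bchField (s • q) (s • q))) := by
  have e (x : 𝔤) : s • affineEnd (ad x, x) = affineEnd (ad (s • x), s • x) := by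
    rw [← map_smul, ad_smul]; rfl
  rw [e, e]
  refine ContinuousLinearMap.ext fun p => ?_
  obtain ⟨x, c⟩ := p
  rw [mul_apply_eq_comp, exp_affineEnd_apply, exp_affineEnd_apply, exp_affineEnd_apply,
    expDivided_ad_self, expDivided_ad_self, expDivided_bchField_apply h2, h1]
  simp only [mul_apply_eq_comp, map_add, map_smul, Prod.smul_fst, Prod.smul_snd, smul_add]
  congr 1
  abel

/-- Conditions on `q` that ensure the convergence of the series at `q`. -/
def BCHGood (q : 𝔤 × 𝔤) : Prop :=
  ContDiffAt ℝ ∞ bchField q ∧ exp (logAd q) = exp (ad q.1) * exp (ad q.2) ∧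
  IsUnit (expDivided (logAd q)) ∧
  HasSum (fun k : ℕ => ((-1 : ℝ) ^ k / (k + 1)) •
    (exp (affineEnd (𝔤 := 𝔤) (logAd q, bchField q q)) - 1) ^ (k + 1))
    (affineEnd (𝔤 := 𝔤) (logAd q, bchField q q)) ∧
  ∃ m : ℝ, ‖affineEnd (𝔤 := 𝔤) (ad q.1, q.1)‖ ≤ m ∧ ‖affineEnd (𝔤 := 𝔤) (ad q.2, q.2)‖ ≤ m ∧
    Real.exp m * Real.exp m - 1 < 1

theorem eventually_bchGood : ∀ᶠ q in 𝓝 (0 : 𝔤 × 𝔤), BCHGood q := by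
  have h1 : Filter.Tendsto (fun q : 𝔤 × 𝔤 => affineEnd (𝔤 := 𝔤) (logAd q, bchField q q)) (𝓝 0) (𝓝 0) := by
    have hc : ContinuousAt (fun q : 𝔤 × 𝔤 => affineEnd (𝔤 := 𝔤) (logAd q, bchField q q)) 0 :=
      (affineEnd (𝔤 := 𝔤)).continuous.continuousAt.comp (f := fun q => (logAd q, bchField q q))
        ((eventually_contDiffAt_logAd (𝔤 := 𝔤)).self_of_nhds.continuousAt.prodMk
          ((eventually_contDiffAt_bchField (𝔤 := 𝔤)).self_of_nhds.continuousAt.clm_apply continuousAt_id))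
    have := hc.tendsto
    simpa [logAd_zero, Prod.mk_zero_zero, -Prod.mk_eq_zero] using this
  have h2 : ∀ᶠ q in 𝓝 (0 : 𝔤 × 𝔤),
      Real.exp (max ‖affineEnd (𝔤 := 𝔤) (ad q.1, q.1)‖ ‖affineEnd (𝔤 := 𝔤) (ad q.2, q.2)‖) *
        Real.exp (max ‖affineEnd (𝔤 := 𝔤) (ad q.1, q.1)‖ ‖affineEnd (𝔤 := 𝔤) (ad q.2, q.2)‖) - 1 < 1 := by
    have hc : Continuous fun q : 𝔤 × 𝔤 =>
        Real.exp (max ‖affineEnd (𝔤 := 𝔤) (ad q.1, q.1)‖ ‖affineEnd (𝔤 := 𝔤) (ad q.2, q.2)‖) *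
        Real.exp (max ‖affineEnd (𝔤 := 𝔤) (ad q.1, q.1)‖ ‖affineEnd (𝔤 := 𝔤) (ad q.2, q.2)‖) - 1 := by
      have := (contDiff_ad (𝔤 := 𝔤)).continuous
      fun_prop
    refine hc.continuousAt.eventually_lt continuousAt_const ?_
    simp [ad_zero, Prod.mk_zero_zero, -Prod.mk_eq_zero]
  filter_upwards [eventually_contDiffAt_bchField, eventually_exp_logAd,
    tendsto_logAd.eventually eventually_isUnit_expDivided,
    h1.eventually (hasSum_log_exp (𝔤 × ℝ →L[ℝ] 𝔤 × ℝ)), h2] with q a b c d e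
  exact ⟨a, b, c, d, _, le_max_left _ _, le_max_right _ _, e⟩

/-- The series $\log(e^{sx}e^{sy})$ evaluated at the letters is the logarithm of the product in
`exp_letters`, hence one affine operator; its value at `(0, 1)` is its affine part. Dynkin's factors
$1/n$ are still absent here. -/
theorem hasSum_pow_smul_dynkinMap {q : 𝔤 × 𝔤} (hq : BCHGood q) {s : ℝ}
    (hs : s ∈ Set.Icc (0 : ℝ) 1) (hsq : BCHGood (s • q)) :
    (Summable fun n => ‖s ^ n • dynkinMap q.1 q.2 (logExpExp n)‖) ∧
      HasSum (fun n => s ^ n • dynkinMap q.1 q.2 (logExpExp n)) (s • bchField (s • q) q) := by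
  obtain ⟨-, -, -, -, m, hx, hy, hm⟩ := hq
  obtain ⟨-, h1, h2, h3, -⟩ := hsq
  have h4 := hasSum_logExpExp (ρ := letterEval q) hs (by rwa [letterEval_zero])
    (by rwa [letterEval_one]) hm
  rw [letterEval_zero, letterEval_one, exp_letters h1 h2, h3.tsum_eq] at h4
  let ev : (𝔤 × ℝ →L[ℝ] 𝔤 × ℝ) →L[ℝ] 𝔤 :=
    ContinuousLinearMap.fst ℝ 𝔤 ℝ ∘L ContinuousLinearMap.apply ℝ (𝔤 × ℝ) ((0 : 𝔤), (1 : ℝ))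
  have e (n : ℕ) : s ^ n • dynkinMap q.1 q.2 (logExpExp n) =
      ev (s ^ n • letterEval q (logExpExp n)) := by
    rw [dynkinMap_eq_letterEval]
    simp [ev]
  simp only [e]
  refine ⟨Summable.of_nonneg_of_le (fun _ => norm_nonneg _) (fun n => ev.le_opNorm _)
    (h4.1.mul_left ‖ev‖), ?_⟩
  convert h4.2.mapL ev using 1
  simp [ev, affineEnd_apply]

/-- The integral of $s^n$ supplies the factor $1/(n+1)$ of Dynkin's formula. -/
theorem bchTerm_eq_integral (q : 𝔤 × 𝔤) (n : ℕ) :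
    ∫ s in (0 : ℝ)..1, s ^ n • dynkinMap q.1 q.2 (logExpExp (n + 1)) = bchTerm (n + 1) q.1 q.2 := by
  rw [intervalIntegral.integral_smul_const, integral_pow, bchTerm]
  simp

theorem summable_norm_bchTerm {q : 𝔤 × 𝔤} (hq : BCHGood q) :
    Summable fun n => ‖bchTerm n q.1 q.2‖ := by
  have h := (hasSum_pow_smul_dynkinMap hq (s := 1) (by simp) (by rwa [one_smul])).1
  refine Summable.of_nonneg_of_le (fun _ => norm_nonneg _) (fun n => ?_) h
  rw [bchTerm, norm_smul, one_pow, one_smul]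
  refine mul_le_of_le_one_left (norm_nonneg _) ?_
  rw [norm_inv, RCLike.norm_natCast]
  exact Nat.cast_inv_le_one n

/-- Termwise integration of the previous sum divided by $s$. This determines the derivative of
$s\mapsto Z(sX,sY)$ without using that the homogeneous components are Lie polynomials. -/
theorem Z_eq_integral {q : 𝔤 × 𝔤} (hq : ∀ s ∈ Set.Icc (0 : ℝ) 1, BCHGood (s • q)) :
    Z q.1 q.2 = ∫ s in (0 : ℝ)..1, bchField (s • q) q := by
  have hq1 : BCHGood q := by simpa using hq 1 (by simp)
  let f : ℕ → C(ℝ, 𝔤) := fun n =>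
    ⟨fun s => s ^ n • dynkinMap q.1 q.2 (logExpExp (n + 1)), by fun_prop⟩
  have h := (hasSum_pow_smul_dynkinMap hq1 (s := 1) (by simp) (by rwa [one_smul])).1
  simp only [one_pow, one_smul] at h
  have hf : Summable fun n => ‖(f n).restrict (⟨Set.uIcc (0 : ℝ) 1, isCompact_uIcc⟩ :
      TopologicalSpace.Compacts ℝ)‖ := by
    refine Summable.of_nonneg_of_le (fun n => by positivity) (fun n => ?_)
      ((summable_nat_add_iff 1).2 h)
    rw [ContinuousMap.norm_le _ (norm_nonneg _)]
    rintro ⟨r, hr⟩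
    have hr : r ∈ Set.uIcc (0 : ℝ) 1 := hr
    rw [Set.uIcc_of_le zero_le_one] at hr
    simp only [f, ContinuousMap.restrict_apply, ContinuousMap.coe_mk, norm_smul]
    refine mul_le_of_le_one_left (norm_nonneg _) ?_
    rw [norm_pow, Real.norm_of_nonneg hr.1]
    exact pow_le_one₀ hr.1 hr.2
  have h1 := intervalIntegral.hasSum_intervalIntegral_of_summable_norm (a := 0) (b := 1) hf
  have h2 (n : ℕ) : ∫ s in (0 : ℝ)..1, f n s = bchTerm (n + 1) q.1 q.2 := bchTerm_eq_integral q n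
  simp only [h2] at h1
  have h0 : bchTerm 0 q.1 q.2 = 0 := by simp [bchTerm]
  rw [Z, (summable_norm_bchTerm hq1).of_norm.tsum_eq_zero_add, h0, zero_add, h1.tsum_eq]
  -- The integrands are compared after division by $s$, so the comparison is made on $(0,1]$ only.
  refine intervalIntegral.integral_congr_ae (Filter.Eventually.of_forall fun s hs => ?_)
  rw [Set.uIoc_of_le zero_le_one] at hs
  have hsI : s ∈ Set.Icc (0 : ℝ) 1 := ⟨hs.1.le, hs.2⟩
  have h3 := (hasSum_pow_smul_dynkinMap hq1 hsI (hq s hsI)).2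
  rw [← hasSum_nat_add_iff' 1] at h3
  have h4 : dynkinMap q.1 q.2 (logExpExp 0) = 0 := by simp [logExpExp]
  simp only [Finset.range_one, Finset.sum_singleton, h4, smul_zero, sub_zero] at h3
  have h5 := h3.const_smul s⁻¹
  simp only [smul_smul, pow_succ', inv_mul_cancel_left₀ hs.1.ne', inv_mul_cancel₀ hs.1.ne',
    one_smul] at h5
  exact h5.tsum_eq

end CampbellHausdorff

section GroupLaw

universe u

variable {𝔤 : Type u} [NormedLieRing 𝔤] [NormedLieAlgebra 𝔤] [FiniteDimensional ℝ 𝔤]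

attribute [local instance] completeSpace_of_normedLieAlgebra normedAlgebraRat

open NormedSpace (exp)

/-! ## Smoothness of the Campbell–Hausdorff series -/

theorem smul_mem_ball_of_mem_Icc {E : Type*} [NormedAddCommGroup E] [NormedSpace ℝ E] {q : E}
    {ρ s : ℝ} (hq : q ∈ Metric.ball (0 : E) ρ) (hs : s ∈ Set.Icc (0 : ℝ) 1) :
    s • q ∈ Metric.ball (0 : E) ρ := by
  rw [mem_ball_zero_iff] at hq ⊢
  rw [norm_smul, Real.norm_of_nonneg hs.1]
  exact lt_of_le_of_lt (mul_le_of_le_one_left (norm_nonneg _) hs.2) hq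

/-- All points of the ball of radius `ρ` satisfy the convergence conditions. -/
def IsBCHRadius (𝔤 : Type*) [NormedLieRing 𝔤] [NormedLieAlgebra 𝔤] [FiniteDimensional ℝ 𝔤]
    (ρ : ℝ) : Prop :=
  0 < ρ ∧ ∀ q ∈ Metric.ball (0 : 𝔤 × 𝔤) ρ, BCHGood q

theorem bchField_zero_apply (p : 𝔤 × 𝔤) : bchField 0 p = p.1 + p.2 := by
  have h := expDivided_bchField_apply (q := (0 : 𝔤 × 𝔤))
    (by rw [logAd_zero, expDivided_zero]; exact isUnit_one) p
  simpa [logAd_zero, expDivided_zero, ad_zero] using h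

variable {ρ : ℝ}

/-- The rescaled integral has no singularity at $t=0$, where it equals $X+Y$. Joint smoothness of
$Z_t$ in $(t,p)$ across $t=0$ follows from it. -/
theorem Zt_eq_integral (hρ : IsBCHRadius 𝔤 ρ) {t : ℝ} {p : 𝔤 × 𝔤}
    (h : t • p ∈ Metric.ball (0 : 𝔤 × 𝔤) ρ) :
    Zt t p = ∫ r in (0 : ℝ)..1, bchField ((r * t) • p) p := by
  by_cases ht : t = 0
  · subst ht
    simp [Zt, bchField_zero_apply]
  · have h1 := Z_eq_integral (q := t • p) fun s hs => hρ.2 _ (smul_mem_ball_of_mem_Icc h hs)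
    simp only [Prod.smul_fst, Prod.smul_snd, map_smul, intervalIntegral.integral_smul] at h1
    rw [Zt, if_neg ht, h1, inv_smul_smul₀ ht]
    simp only [smul_smul]

theorem contDiffOn_bchField (hρ : IsBCHRadius 𝔤 ρ) :
    ContDiffOn ℝ ∞ bchField (Metric.ball (0 : 𝔤 × 𝔤) ρ) :=
  fun q hq => (hρ.2 q hq).1.contDiffWithinAt

theorem contDiffOn_Zt (hρ : IsBCHRadius 𝔤 ρ) :
    ContDiffOn ℝ ∞ (fun z : ℝ × (𝔤 × 𝔤) => Zt z.1 z.2)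
      {z | z.1 • z.2 ∈ Metric.ball (0 : 𝔤 × 𝔤) ρ} := by
  have hg : ContDiff ℝ ∞ fun w : (ℝ × (𝔤 × 𝔤)) × ℝ => (w.2 * w.1.1) • w.1.2 := by fun_prop
  refine (contDiffOn_integral (E := ℝ × (𝔤 × 𝔤)) (F := 𝔤)
    (f := fun w => bchField ((w.2 * w.1.1) • w.1.2) w.1.2)
    (W := (fun w : (ℝ × (𝔤 × 𝔤)) × ℝ => (w.2 * w.1.1) • w.1.2) ⁻¹' Metric.ball 0 ρ)
    (Metric.isOpen_ball.preimage (by fun_prop)) (Metric.isOpen_ball.preimage hg.continuous)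
    ?_ ?_).congr fun z hz => Zt_eq_integral hρ hz
  · rintro ⟨z, r⟩ ⟨hz, hr⟩
    have := smul_mem_ball_of_mem_Icc hz hr
    rwa [smul_smul] at this
  · exact ((contDiffOn_bchField hρ).comp hg.contDiffOn fun _ h => h).clm_apply
      (ContDiff.contDiffOn (by fun_prop))

theorem contDiffOn_Z (hρ : IsBCHRadius 𝔤 ρ) :
    ContDiffOn ℝ ∞ (fun q : 𝔤 × 𝔤 => Z q.1 q.2) (Metric.ball (0 : 𝔤 × 𝔤) ρ) := by
  have h := (contDiffOn_Zt hρ).comp (t := {z | z.1 • z.2 ∈ Metric.ball (0 : 𝔤 × 𝔤) ρ})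
    (f := fun q : 𝔤 × 𝔤 => ((1 : ℝ), q)) (s := Metric.ball (0 : 𝔤 × 𝔤) ρ)
    (ContDiff.contDiffOn (by fun_prop)) (fun q hq => by simpa using hq)
  exact h.congr fun q _ => by simp [Zt]

theorem Z_zero : Z (0 : 𝔤) 0 = 0 := by
  obtain ⟨ρ, hρ⟩ := Metric.eventually_nhds_iff_ball.1 (eventually_bchGood (𝔤 := 𝔤))
  have := Z_eq_integral (q := (0 : 𝔤 × 𝔤)) (fun s _ => by
    rw [smul_zero]; exact hρ.2 _ (Metric.mem_ball_self hρ.1))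
  simpa using this

theorem Z_smul_eq_integral (hρ : IsBCHRadius 𝔤 ρ) {t : ℝ} {p : 𝔤 × 𝔤}
    (h : t • p ∈ Metric.ball (0 : 𝔤 × 𝔤) ρ) :
    Z (t • p.1) (t • p.2) = ∫ r in (0 : ℝ)..t, bchField (r • p) p := by
  have h1 : Z (t • p.1) (t • p.2) = t • Zt t p := by
    by_cases ht : t = 0
    · simp [ht, Z_zero]
    · rw [Zt, if_neg ht, smul_inv_smul₀ ht]
  rw [h1, Zt_eq_integral hρ h, intervalIntegral.smul_integral_comp_mul_right
    (fun r => bchField (r • p) p)]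
  simp

theorem hasDerivAt_Z_smul (hρ : IsBCHRadius 𝔤 ρ) {s : ℝ} {q : 𝔤 × 𝔤}
    (h : s • q ∈ Metric.ball (0 : 𝔤 × 𝔤) ρ) :
    HasDerivAt (fun s : ℝ => Z (s • q.1) (s • q.2)) (bchField (s • q) q) s := by
  have ho : IsOpen {s : ℝ | s • q ∈ Metric.ball (0 : 𝔤 × 𝔤) ρ} :=
    Metric.isOpen_ball.preimage (by fun_prop)
  have hc : ContinuousOn (fun r : ℝ => bchField (r • q) q)
      {s : ℝ | s • q ∈ Metric.ball (0 : 𝔤 × 𝔤) ρ} :=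
    ((contDiffOn_bchField hρ).continuousOn.comp (f := fun r : ℝ => r • q)
      (Continuous.continuousOn (by fun_prop)) fun _ h => h).clm_apply continuousOn_const
  have hsub : Set.uIcc 0 s ⊆ {s : ℝ | s • q ∈ Metric.ball (0 : 𝔤 × 𝔤) ρ} := by
    intro r hr
    have : ‖r‖ ≤ ‖s‖ := by
      have := Set.abs_sub_left_of_mem_uIcc hr
      simpa using this
    simp only [Set.mem_ofPred_eq, mem_ball_zero_iff, norm_smul] at h ⊢
    exact lt_of_le_of_lt (mul_le_mul_of_nonneg_right this (norm_nonneg _)) h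
  refine (intervalIntegral.integral_hasDerivAt_right (hc.mono hsub).intervalIntegrable
    (hc.stronglyMeasurableAtFilter ho s h) (hc.continuousAt (ho.mem_nhds h))).congr_of_eventuallyEq ?_
  filter_upwards [ho.mem_nhds h] with r hr using Z_smul_eq_integral hρ hr

theorem tendsto_Z : Filter.Tendsto (fun q : 𝔤 × 𝔤 => Z q.1 q.2) (𝓝 0) (𝓝 0) := by
  obtain ⟨ρ, hρ⟩ := Metric.eventually_nhds_iff_ball.1 (eventually_bchGood (𝔤 := 𝔤))
  have h := ((contDiffOn_Z hρ).contDiffAt (Metric.ball_mem_nhds _ hρ.1)).continuousAt.tendsto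
  simpa [Z_zero] using h

theorem tendsto_exp_ad {E : Type*} [TopologicalSpace E] {f : E → 𝔤} {l : Filter E}
    (hf : Filter.Tendsto f l (𝓝 0)) : Filter.Tendsto (fun x => exp (ad (f x))) l (𝓝 1) := by
  have h : Continuous fun x : 𝔤 => exp (ad x) :=
    NormedSpace.exp_continuous.comp contDiff_ad.continuous
  have h0 := h.tendsto 0
  rw [ad_zero, NormedSpace.exp_zero] at h0
  exact h0.comp hf

/-! ## The group law in the adjoint representation -/

/-- Near `0`, `ad Z(X, Y)` is the logarithm of `e^{ad X} e^{ad Y}`. -/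
theorem eventually_logAd_eq : ∀ᶠ q in 𝓝 (0 : 𝔤 × 𝔤), logAd q = ad (Z q.1 q.2) := by
  obtain ⟨ρ, hρ⟩ : ∃ ρ, IsBCHRadius 𝔤 ρ :=
    Metric.eventually_nhds_iff_ball.1 (eventually_bchGood (𝔤 := 𝔤))
  have hL := Classical.choose_spec (exists_local_log (𝔤 →L[ℝ] 𝔤))
  have hlog (q : 𝔤 × 𝔤) : logAd q = Classical.choose (exists_local_log (𝔤 →L[ℝ] 𝔤))
    (exp (ad q.1) * exp (ad q.2)) := rfl
  set L := Classical.choose (exists_local_log (𝔤 →L[ℝ] 𝔤)) with hLdef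
  obtain ⟨hL0, hLs, -, hLe⟩ := hL
  -- For $q=(X,Y)$, both $e^{\mathrm{ad}Z(sq)}$ and $e^{s\,\mathrm{ad}X}e^{s\,\mathrm{ad}Y}$ start
  -- at $1$ and solve $R'=v(\mathtt{bchField}(sq)\,q,R)$: the first by the derivative of `exp (ad
  -- x)`, the second by the equation defining `bchField`. Since `v` is Lipschitz near $(0,1)$, they
  -- agree for small `q`, and the local logarithm `L` gives the claim.
  let v : 𝔤 × (𝔤 →L[ℝ] 𝔤) → (𝔤 →L[ℝ] 𝔤) := fun z => ad (expDivided (L z.2) z.1) * z.2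
  have hv : ContDiffAt ℝ 1 v ((0 : 𝔤), (1 : 𝔤 →L[ℝ] 𝔤)) := by
    have h1 : ContDiffAt ℝ 1 (fun z : 𝔤 × (𝔤 →L[ℝ] 𝔤) => L z.2) (0, 1) :=
      ContDiffAt.comp (0, 1) (g := L) (hLs.self_of_nhds.of_le (by exact_mod_cast le_top))
        contDiffAt_snd
    have h2 : ContDiffAt ℝ 1 (fun z : 𝔤 × (𝔤 →L[ℝ] 𝔤) => expDivided (L z.2)) (0, 1) :=
      (contDiff_expDivided.contDiffAt.of_le (by exact_mod_cast le_top)).comp (0, 1) h1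
    exact ((adL : 𝔤 →L[ℝ] (𝔤 →L[ℝ] 𝔤)).contDiff.contDiffAt.comp (0, 1)
      (h2.clm_apply contDiffAt_fst)).mul contDiffAt_snd
  obtain ⟨K, T, hT, hK⟩ := hv.exists_lipschitzOnWith
  rw [nhds_prod_eq, Filter.mem_prod_iff] at hT
  obtain ⟨B₁, hB₁, B₂, hB₂, hBT⟩ := hT
  have hfield : ∀ᶠ z in 𝓝 (0 : (𝔤 × 𝔤) × (𝔤 × 𝔤)), bchField z.1 z.2 ∈ B₁ := by
    have h1 : ContinuousAt (fun z : (𝔤 × 𝔤) × (𝔤 × 𝔤) => bchField z.1 z.2) 0 := by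
      refine ContinuousAt.clm_apply (ContinuousAt.comp (g := bchField) ?_ continuousAt_fst)
        continuousAt_snd
      exact (eventually_contDiffAt_bchField (𝔤 := 𝔤)).self_of_nhds.continuousAt
    have h2 := h1.tendsto
    simp only [Prod.snd_zero, map_zero] at h2
    exact h2.eventually hB₁
  have hR := tendsto_exp_ad (tendsto_Z (𝔤 := 𝔤))
  have hZad : Filter.Tendsto (fun q : 𝔤 × 𝔤 => ad (Z q.1 q.2)) (𝓝 0) (𝓝 0) := by
    have := ((contDiff_ad (𝔤 := 𝔤)).continuous.tendsto 0).comp tendsto_Z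
    rwa [ad_zero] at this
  have hcond : ∀ᶠ q in 𝓝 (0 : 𝔤 × 𝔤), exp (ad (Z q.1 q.2)) ∈ B₂ ∧
      L (exp (ad (Z q.1 q.2))) = ad (Z q.1 q.2) ∧ exp (ad q.1) * exp (ad q.2) ∈ B₂ :=
    (hR.eventually hB₂).and
      ((hZad.eventually hLe).and (tendsto_exp_ad_mul_exp_ad.eventually hB₂))
  obtain ⟨δ₁, hδ₁, hfield⟩ := Metric.eventually_nhds_iff_ball.1 hfield
  obtain ⟨δ₂, hδ₂, hcond⟩ := Metric.eventually_nhds_iff_ball.1 hcond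
  filter_upwards [Metric.ball_mem_nhds (0 : 𝔤 × 𝔤) (lt_min hρ.1 (lt_min hδ₁ hδ₂))] with q hq
  have hs (s : ℝ) (hs : s ∈ Set.Icc (0 : ℝ) 1) := smul_mem_ball_of_mem_Icc hq hs
  have hsρ (s : ℝ) (h : s ∈ Set.Icc (0 : ℝ) 1) : s • q ∈ Metric.ball (0 : 𝔤 × 𝔤) ρ :=
    Metric.ball_subset_ball (min_le_left _ _) (hs s h)
  have hsδ₁ (s : ℝ) (h : s ∈ Set.Icc (0 : ℝ) 1) : s • q ∈ Metric.ball (0 : 𝔤 × 𝔤) δ₁ :=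
    Metric.ball_subset_ball ((min_le_right _ _).trans (min_le_left _ _)) (hs s h)
  have hsδ₂ (s : ℝ) (h : s ∈ Set.Icc (0 : ℝ) 1) : s • q ∈ Metric.ball (0 : 𝔤 × 𝔤) δ₂ :=
    Metric.ball_subset_ball ((min_le_right _ _).trans (min_le_right _ _)) (hs s h)
  have hB (s : ℝ) (h : s ∈ Set.Icc (0 : ℝ) 1) : bchField (s • q) q ∈ B₁ := by
    refine hfield (s • q, q) ?_
    have h1 := hsδ₁ s h
    have h2 := hsδ₁ 1 (by simp)
    rw [mem_ball_zero_iff] at h1 h2 ⊢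
    rw [one_smul] at h2
    exact max_lt h1 h2
  have hf (s : ℝ) (h : s ∈ Set.Icc (0 : ℝ) 1) :
      HasDerivAt (fun s : ℝ => exp (ad (Z (s • q.1) (s • q.2))))
        (v (bchField (s • q) q, exp (ad (Z (s • q.1) (s • q.2))))) s := by
    have h1 : DifferentiableAt ℝ (fun x : 𝔤 => exp (ad x)) (Z (s • q.1) (s • q.2)) :=
      (contDiff_exp.comp (n := ∞) contDiff_ad).differentiable (by simp) _
    have h2 := h1.hasFDerivAt.comp_hasDerivAt s (hasDerivAt_Z_smul hρ (hsρ s h))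
    refine h2.congr_deriv ?_
    rw [fderiv_exp_ad]
    have h3 := (hcond _ (hsδ₂ s h)).2.1
    simp only [Prod.smul_fst, Prod.smul_snd] at h3
    simp only [v, h3]
  have hg (s : ℝ) (h : s ∈ Set.Icc (0 : ℝ) 1) :
      HasDerivAt (fun s : ℝ => exp (s • ad q.1) * exp (s • ad q.2))
        (v (bchField (s • q) q, exp (s • ad q.1) * exp (s • ad q.2))) s := by
    refine ((hasDerivAt_exp_smul (ad q.1) s).mul (hasDerivAt_exp_smul (ad q.2) s)).congr_deriv ?_
    have h3 := expDivided_bchField_apply (hρ.2 _ (hsρ s h)).2.2.1 q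
    rw [hlog] at h3
    simp only [Prod.smul_fst, Prod.smul_snd, ad_smul] at h3
    simp only [v, h3]
    have h4 := exp_ad_mul_ad (s • q.1) q.2
    rw [ad_smul] at h4
    rw [← mul_assoc, h4, ad_add, add_mul, mul_assoc, mul_assoc]
  have key := ODE_solution_unique_of_mem_Icc_right (v := fun s R => v (bchField (s • q) q, R))
    (s := fun _ => B₂) (K := K) (a := 0) (b := 1)
    (f := fun s : ℝ => exp (ad (Z (s • q.1) (s • q.2))))
    (g := fun s : ℝ => exp (s • ad q.1) * exp (s • ad q.2)) ?_
    (fun s h => (hf s h).continuousAt.continuousWithinAt)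
    (fun s h => (hf s ⟨h.1, h.2.le⟩).hasDerivWithinAt)
    (fun s h => (hcond _ (hsδ₂ s ⟨h.1, h.2.le⟩)).1)
    (fun s h => (hg s h).continuousAt.continuousWithinAt)
    (fun s h => (hg s ⟨h.1, h.2.le⟩).hasDerivWithinAt) ?_ ?_
  · have h1 := key (Set.right_mem_Icc.2 zero_le_one)
    simp only [one_smul] at h1
    have h2 := hsδ₂ 1 (by simp)
    rw [one_smul] at h2
    rw [hlog, ← h1, (hcond q h2).2.1]
  · intro s h R hR R' hR'
    have := hK (hBT (Set.mk_mem_prod (hB s ⟨h.1, h.2.le⟩) hR))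
      (hBT (Set.mk_mem_prod (hB s ⟨h.1, h.2.le⟩) hR'))
    simpa [Prod.edist_eq] using this
  · intro s h
    have := (hcond _ (hsδ₂ s ⟨h.1, h.2.le⟩)).2.2
    simpa [ad_smul] using this
  · simp [Z_zero, ad_zero]

/-- Near `0`, `ad (e^{-ad X} Z(X, Y))` is the logarithm of `e^{ad Y} e^{ad X}`. -/
theorem eventually_logAd_swap_eq :
    ∀ᶠ q in 𝓝 (0 : 𝔤 × 𝔤), logAd q.swap = ad (exp (-ad q.1) (Z q.1 q.2)) := by
  have hL := (Classical.choose_spec (exists_local_log (𝔤 →L[ℝ] 𝔤))).2.2.2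
  have h1 : Filter.Tendsto (fun q : 𝔤 × 𝔤 => ad (exp (-ad q.1) (Z q.1 q.2))) (𝓝 0) (𝓝 0) := by
    have hc : Filter.Tendsto (fun q : 𝔤 × 𝔤 => exp (-ad q.1)) (𝓝 0) (𝓝 1) := by
      have hc : Continuous fun q : 𝔤 × 𝔤 => exp (-ad q.1) :=
        NormedSpace.exp_continuous.comp ((contDiff_ad.continuous.comp continuous_fst).neg)
      simpa [ad_zero] using hc.tendsto 0
    have := ((contDiff_ad (𝔤 := 𝔤)).continuous.tendsto 0).comp (f := fun q : 𝔤 × 𝔤 =>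
      exp (-ad q.1) (Z q.1 q.2)) (by
        have h0 := (isBoundedBilinearMap_apply (𝕜 := ℝ) (E := 𝔤) (F := 𝔤)).continuous.tendsto (1, 0)
        simpa [Function.comp_def] using h0.comp (hc.prodMk_nhds tendsto_Z))
    rwa [ad_zero] at this
  filter_upwards [eventually_exp_logAd, eventually_logAd_eq, h1.eventually hL] with q h2 h3 h4
  rw [← h4]
  have h5 := ad_exp_ad (-q.1) (Z q.1 q.2)
  have h6 : ad (-q.1) = -ad q.1 := map_neg adL q.1
  rw [h6, neg_neg] at h5
  have hinv := exp_neg_mul_exp (ad q.1)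
  have hinv' := exp_neg_mul_exp (-ad q.1)
  rw [neg_neg] at hinv'
  -- Conjugation by $e^{-\mathrm{ad}X}$ takes $e^{\mathrm{ad}X}e^{\mathrm{ad}Y}$ to
  -- $e^{\mathrm{ad}Y}e^{\mathrm{ad}X}$, and commutes with `exp`.
  let w : (𝔤 →L[ℝ] 𝔤)ˣ := ⟨exp (-ad q.1), exp (ad q.1), hinv, hinv'⟩
  have h7 := NormedSpace.exp_units_conj w (ad (Z q.1 q.2))
  have h8 : exp (ad (exp (-ad q.1) (Z q.1 q.2))) = exp (ad q.2) * exp (ad q.1) := by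
    rw [h5]
    refine h7.trans ?_
    rw [← h3, h2]
    change exp (-ad q.1) * (exp (ad q.1) * exp (ad q.2)) * exp (ad q.1) = _
    rw [← mul_assoc, hinv, one_mul]
  rw [h8]
  rfl

/-- Conditions that give the group law at `q`. -/
def IsGroupRadius (𝔤 : Type*) [NormedLieRing 𝔤] [NormedLieAlgebra 𝔤] [FiniteDimensional ℝ 𝔤]
    (ρ : ℝ) : Prop :=
  IsBCHRadius 𝔤 ρ ∧ ∀ q ∈ Metric.ball (0 : 𝔤 × 𝔤) ρ, logAd q = ad (Z q.1 q.2) ∧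
    logAd q.swap = ad (exp (-ad q.1) (Z q.1 q.2))

theorem expDivided_ad_Z_bchField (hρ : IsGroupRadius 𝔤 ρ) {q : 𝔤 × 𝔤}
    (hq : q ∈ Metric.ball (0 : 𝔤 × 𝔤) ρ) (p : 𝔤 × 𝔤) :
    expDivided (ad (Z q.1 q.2)) (bchField q p) = p.1 + exp (ad q.1) p.2 := by
  rw [← (hρ.2 q hq).1]
  exact expDivided_bchField_apply (hρ.1.2 q hq).2.2.1 p

theorem swap_mem_ball {𝔤 : Type*} [NormedAddCommGroup 𝔤] {q : 𝔤 × 𝔤} (hq : q ∈ Metric.ball (0 : 𝔤 × 𝔤) ρ) :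
    q.swap ∈ Metric.ball (0 : 𝔤 × 𝔤) ρ := by
  rw [mem_ball_zero_iff] at hq ⊢
  rwa [Prod.norm_def, max_comm] at hq

/-- `Z(Y, X) = e^{-ad X} Z(X, Y)`. -/
theorem Z_swap (hρ : IsGroupRadius 𝔤 ρ) {q : 𝔤 × 𝔤} (hq : q ∈ Metric.ball (0 : 𝔤 × 𝔤) ρ) :
    Z q.2 q.1 = exp (-ad q.1) (Z q.1 q.2) := by
  -- The zero field means that the difference of the two sides along the ray has derivative zero.
  have key := eq_zero_of_linear_ode (L := fun _ => (0 : 𝔤 →L[ℝ] 𝔤))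
    (f := fun s : ℝ => Z (s • q.2) (s • q.1) - exp (s • -ad q.1) (Z (s • q.1) (s • q.2)))
    continuousOn_const (fun s hs => ?_) (by simp [Z_zero]) 1 (by simp)
  · simpa [sub_eq_zero] using key
  · have hm := smul_mem_ball_of_mem_Icc hq hs
    have h1 := hasDerivAt_Z_smul hρ.1 hm
    have h2 := hasDerivAt_Z_smul hρ.1 (q := q.swap) (s := s) (swap_mem_ball hm)
    refine (h2.sub ((hasDerivAt_exp_smul (-ad q.1) s).clm_apply h1)).congr_deriv ?_
    have hu := (hρ.1.2 _ (swap_mem_ball hm)).2.2.1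
    have hlog := (hρ.2 _ hm).2
    have hlog1 : logAd (s • q).swap = logAd (s • q.swap) := rfl
    have e1 := expDivided_bchField_apply hu q.swap
    set y := exp (s • -ad q.1) (Z (s • q.1) (s • q.2)) with hy
    have hlog2 : logAd (s • q).swap = ad y := by
      rw [hlog, hy]
      simp only [Prod.smul_fst, Prod.smul_snd, ad_smul, smul_neg]
    -- The two derivatives are compared after applying $\Phi(\mathrm{ad}y)$, with
    -- $e^{\mathrm{ad}y}=e^{s\,\mathrm{ad}Y}e^{s\,\mathrm{ad}X}$. The term $[y,X]$ contributes
    -- $e^{s\,\mathrm{ad}Y}X-X$ and the other term $X+Y$; their sum is what the field at $(Y,X)$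
    -- gives.
    have hinj : Function.Injective (expDivided (logAd (s • q).swap)) := by
      obtain ⟨w, hw⟩ := hu
      rw [← hw]
      intro a b hab
      have := congrArg (fun x => (↑w⁻¹ : 𝔤 →L[ℝ] 𝔤) x) hab
      simpa [← mul_apply_eq_comp] using this
    rw [zero_apply, sub_eq_zero]
    apply hinj
    have e3 : expDivided (logAd (s • q).swap) (bchField (s • q.swap) q.swap) = _ := e1
    rw [e3, hlog2]
    have e4 : (-ad q.1 * exp (s • -ad q.1)) (Z (s • q.1) (s • q.2)) = ad y q.1 := by
      rw [mul_apply_eq_comp, ← hy, neg_apply, ad_apply, ad_apply, lie_skew]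
    have e5 : expDivided (ad y) (ad y q.1) = exp (s • ad q.2) q.1 - q.1 := by
      have h5 : expDivided (ad y) * ad y = exp (ad y) - 1 := by
        rw [← mul_expDivided, (semiconjBy_expDivided (Commute.refl (ad y))).eq]
      have h6 := (hρ.1.2 _ (swap_mem_ball hm)).2.1
      rw [hlog2] at h6
      simp only [Prod.fst_swap, Prod.snd_swap, Prod.smul_fst, Prod.smul_snd, ad_smul] at h6
      rw [← mul_apply_eq_comp, h5, h6, sub_apply, mul_apply_eq_comp,
        exp_apply_of_apply_eq_zero (A := s • ad q.1) (by simp [ad_apply]), one_apply_eq_self]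
    have e6 : expDivided (ad y) (exp (s • -ad q.1) (bchField (s • q) q)) = q.1 + q.2 := by
      have h5 := exp_ad_mul_ad (-(s • q.1)) (Z (s • q.1) (s • q.2))
      have h6 : ad (-(s • q.1)) = s • -ad q.1 := by
        rw [← adL_apply, map_neg, map_smul, smul_neg, adL_apply]
      rw [h6] at h5
      have h7 : SemiconjBy (exp (s • -ad q.1)) (ad (Z (s • q.1) (s • q.2))) (ad y) := h5
      have h8 := expDivided_ad_Z_bchField hρ hm q
      simp only [Prod.smul_fst, Prod.smul_snd, ad_smul] at h8
      rw [← mul_apply_eq_comp, ← (semiconjBy_expDivided h7).eq, mul_apply_eq_comp, h8, map_add,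
        exp_apply_of_apply_eq_zero (A := s • -ad q.1) (by simp [ad_apply]), ← mul_apply_eq_comp,
        smul_neg, exp_neg_mul_exp, one_apply_eq_self]
    rw [e4, map_add, e5, e6]
    simp only [Prod.fst_swap, Prod.snd_swap, Prod.smul_snd, ad_smul]
    abel

/-- The differential of the Campbell–Hausdorff series. -/
theorem expDivided_ad_Z_fderiv (hρ : IsGroupRadius 𝔤 ρ) {q : 𝔤 × 𝔤}
    (hq : q ∈ Metric.ball (0 : 𝔤 × 𝔤) ρ) (v : 𝔤 × 𝔤) :
    expDivided (ad (Z q.1 q.2)) (fderiv ℝ (fun p : 𝔤 × 𝔤 => Z p.1 p.2) q v) =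
      expDivided (ad q.1) v.1 + exp (ad q.1) (expDivided (ad q.2) v.2) := by
  set Φ : 𝔤 → 𝔤 →L[ℝ] 𝔤 := fun x => expDivided (ad x) with hΦ
  have hΦd (x : 𝔤) : HasFDerivAt Φ (fderiv ℝ Φ x) x :=
    ((contDiff_expDivided_ad (𝔤 := 𝔤)).differentiable (by simp) x).hasFDerivAt
  have hZsm := contDiffOn_Z hρ.1
  -- Along the ray, both sides of the claim vanish at $s=0$ and solve one inhomogeneous equation
  -- $\eta'=c(s)+[w(s),\eta]$; their difference therefore solves the homogeneous one.
  set a : ℝ → 𝔤 := fun s => (s • expDivided (s • ad q.1)) v.1 with ha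
  set b : ℝ → 𝔤 := fun s => (s • expDivided (s • ad q.2)) v.2 with hb
  set w : ℝ → 𝔤 := fun s => q.1 + exp (s • ad q.1) q.2 with hw
  set D : ℝ → 𝔤 := fun s => fderiv ℝ (fun p : 𝔤 × 𝔤 => Z (s • p.1) (s • p.2)) q v with hD
  have hDs (s : ℝ) (hs : s ∈ Set.Icc (0 : ℝ) 1) :
      HasDerivAt (fun s => Φ (Z (s • q.1) (s • q.2)) (D s))
        (v.1 + (⁅a s, exp (s • ad q.1) q.2⁆ + exp (s • ad q.1) v.2) +
          ⁅w s, Φ (Z (s • q.1) (s • q.2)) (D s)⁆) s := by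
    have hm := smul_mem_ball_of_mem_Icc hq hs
    have ho : IsOpen {p : 𝔤 × 𝔤 | s • p ∈ Metric.ball (0 : 𝔤 × 𝔤) ρ} :=
      Metric.isOpen_ball.preimage (by fun_prop)
    have hnear : ∀ᶠ p in 𝓝 q, s • p ∈ Metric.ball (0 : 𝔤 × 𝔤) ρ := ho.mem_nhds hm
    have hsm : ContDiffAt ℝ 2 (fun z : ℝ × (𝔤 × 𝔤) => Z (z.1 • z.2.1) (z.1 • z.2.2)) (s, q) := by
      have h1 : ContDiffAt ℝ ∞ (fun z : ℝ × (𝔤 × 𝔤) => z.1 • z.2) (s, q) :=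
        ContDiff.contDiffAt (by fun_prop)
      exact ((hZsm.contDiffAt (Metric.isOpen_ball.mem_nhds hm)).comp (s, q) h1).of_le
        (WithTop.coe_le_coe.2 le_top)
    obtain ⟨hfd, hD'⟩ := hasDerivAt_fderiv_of_contDiffAt (u := v) hsm
      (hnear.mono fun p hp => hasDerivAt_Z_smul hρ.1 hp)
    have hz := hasDerivAt_Z_smul hρ.1 hm
    have hη := ((hΦd _).comp_hasDerivAt s hz).clm_apply hD'
    refine hη.congr_deriv ?_
    have hzp : HasFDerivAt (fun p : 𝔤 × 𝔤 => Z (s • p.1) (s • p.2)) _ q :=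
      (((hsm.comp q (contDiff_prodMk_right s).contDiffAt).differentiableAt
        (by simp)).hasFDerivAt)
    have hw1 : HasFDerivAt (fun p : 𝔤 × 𝔤 => Φ (Z (s • p.1) (s • p.2)) (bchField (s • p) p)) _ q :=
      ((hΦd _).comp q hzp).clm_apply hfd.hasFDerivAt
    have he : HasFDerivAt (fun x : 𝔤 => exp (ad x)) _ (s • q.1) :=
      ((contDiff_exp.comp (n := ∞) contDiff_ad).differentiable (by simp) (s • q.1)).hasFDerivAt
    have hw2 : HasFDerivAt (fun p : 𝔤 × 𝔤 => p.1 + exp (ad (s • p.1)) p.2) _ q :=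
      hasFDerivAt_fst.add
        ((he.comp (f := fun p : 𝔤 × 𝔤 => s • p.1) q (hasFDerivAt_fst.const_smul s)).clm_apply
          hasFDerivAt_snd)
    have hw3 := (hw1.congr_of_eventuallyEq (hnear.mono fun p hp => by
      exact (expDivided_ad_Z_bchField hρ hp p).symm)).unique hw2
    have hw4 := congrArg (fun A : 𝔤 × 𝔤 →L[ℝ] 𝔤 => A v) hw3
    -- The derivative of $\Phi(\mathrm{ad}Z)$ appears with its two arguments in the wrong order.
    -- Maurer–Cartan exchanges them at the cost of $[w,\eta]$, because $\Phi(\mathrm{ad}Z)$ maps the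
    -- radial derivative of $Z$ to $w$.
    have hmc := fderiv_expDivided_ad (Z (s • q.1) (s • q.2)) (bchField (s • q) q) (D s)
    have hwz := expDivided_ad_Z_bchField hρ hm q
    simp only [Prod.smul_fst, Prod.smul_snd] at hwz
    rw [hwz] at hmc
    simp only [ContinuousLinearMap.comp_apply, add_apply, ContinuousLinearMap.flip_apply,
      Function.comp_apply (g := fun p : 𝔤 × 𝔤 => s • p.1),
      ContinuousLinearMap.coe_fst', ContinuousLinearMap.coe_snd', smul_apply, map_smul] at hw4
    have e7 : s • (fderiv ℝ (exp ∘ ad) (s • q.1) v.1) q.2 = ⁅a s, exp (s • ad q.1) q.2⁆ := by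
      have h7 : fderiv ℝ (exp ∘ ad) (s • q.1) v.1 = _ := fderiv_exp_ad (s • q.1) v.1
      rw [h7]
      simp [ha, ad_apply, ad_smul]
    rw [ad_smul] at hw4 hmc
    change Φ (Z (s • q.1) (s • q.2)) (fderiv ℝ (fun p => bchField (s • p) p) q v) +
      fderiv ℝ Φ (Z (s • q.1) (s • q.2)) (D s) (bchField (s • q) q) =
        v.1 + (exp (s • ad q.1) v.2 + s • (fderiv ℝ (exp ∘ ad) (s • q.1) v.1) q.2) at hw4
    rw [e7] at hw4
    change fderiv ℝ Φ (Z (s • q.1) (s • q.2)) (bchField (s • q) q) (D s) -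
      fderiv ℝ Φ (Z (s • q.1) (s • q.2)) (D s) (bchField (s • q) q) =
        ⁅w s, Φ (Z (s • q.1) (s • q.2)) (D s)⁆ at hmc
    change fderiv ℝ Φ (Z (s • q.1) (s • q.2)) (bchField (s • q) q) (D s) +
      Φ (Z (s • q.1) (s • q.2)) (fderiv ℝ (fun p => bchField (s • p) p) q v) = _
    rw [eq_add_of_sub_eq hmc, add_assoc, add_comm (fderiv ℝ Φ _ _ _), hw4]
    abel
  have hθ (s : ℝ) : HasDerivAt (fun s => a s + exp (s • ad q.1) (b s))
      (v.1 + (⁅a s, exp (s • ad q.1) q.2⁆ + exp (s • ad q.1) v.2) +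
          ⁅w s, a s + exp (s • ad q.1) (b s)⁆) s := by
    have h1 := (hasDerivAt_smul_expDivided (ad q.1) s).clm_apply (hasDerivAt_const s v.1)
    have h2 := (hasDerivAt_smul_expDivided (ad q.2) s).clm_apply (hasDerivAt_const s v.2)
    refine (h1.add ((hasDerivAt_exp_smul (ad q.1) s).clm_apply h2)).congr_deriv ?_
    simp only [map_zero, add_zero, exp_sub_one_apply q.1 v.1, exp_sub_one_apply q.2 v.2, map_add,
      mul_apply_eq_comp, ad_apply q.1]
    have h3 := exp_ad_lie (s • q.1) q.2 (b s)
    rw [ad_smul] at h3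
    change v.1 + ⁅q.1, a s⁆ + (⁅q.1, exp (s • ad q.1) (b s)⁆ +
      (exp (s • ad q.1) v.2 + exp (s • ad q.1) ⁅q.2, b s⁆)) = _
    rw [h3, hw]
    simp only [add_lie, lie_add]
    rw [← lie_skew (a s)]
    abel
  have key := eq_zero_of_linear_ode (L := fun s => ad (w s))
    (f := fun s => Φ (Z (s • q.1) (s • q.2)) (D s) - (a s + exp (s • ad q.1) (b s)))
    (Continuous.continuousOn ?_) (fun s hs => ((hDs s hs).sub (hθ s)).congr_deriv ?_) ?_ 1 (by simp)
  · simpa [sub_eq_zero, hΦ, hD, ha, hb] using key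
  · refine contDiff_ad.continuous.comp (continuous_const.add (Continuous.clm_apply ?_
      continuous_const))
    exact NormedSpace.exp_continuous.comp (by fun_prop)
  · rw [ad_apply, lie_sub]
    abel
  · simp [hD, ha, hb]

end GroupLaw

section Density

universe u

variable {𝔤 : Type u} [NormedLieRing 𝔤] [NormedLieAlgebra 𝔤] [FiniteDimensional ℝ 𝔤]

attribute [local instance] completeSpace_of_normedLieAlgebra normedAlgebraRat

open NormedSpace (exp)

/-! ## Determinants and the function `j` -/

theorem contDiff_matrix_det {n : Type*} [Fintype n] [DecidableEq n] {E : Type*}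
    [NormedAddCommGroup E] [NormedSpace ℝ E] {M : E → Matrix n n ℝ}
    (hM : ∀ i k, ContDiff ℝ ∞ fun x => M x i k) : ContDiff ℝ ∞ fun x => (M x).det := by
  simp only [Matrix.det_apply]
  exact ContDiff.sum fun σ _ => (contDiff_prod fun i _ => hM _ _).const_smul _

theorem det_eq_det_toMatrix (A : 𝔤 →L[ℝ] 𝔤) : A.det =
    (LinearMap.toMatrix (Module.finBasis ℝ 𝔤) (Module.finBasis ℝ 𝔤) A.toLinearMap).det :=
  (LinearMap.det_toMatrix _ _).symm

theorem contDiff_det : ContDiff ℝ ∞ fun A : 𝔤 →L[ℝ] 𝔤 => A.det := by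
  simp only [det_eq_det_toMatrix]
  refine contDiff_matrix_det fun i k => ?_
  let l : (𝔤 →L[ℝ] 𝔤) →ₗ[ℝ] ℝ := (Matrix.entryLinearMap ℝ ℝ i k).comp
    ((LinearMap.toMatrix (Module.finBasis ℝ 𝔤) (Module.finBasis ℝ 𝔤)).toLinearMap.comp
      (ContinuousLinearMap.coeLM ℝ))
  exact (LinearMap.toContinuousLinearMap l).contDiff

theorem det_mul (A B : 𝔤 →L[ℝ] 𝔤) : (A * B).det = A.det * B.det :=
  LinearMap.det_comp A.toLinearMap B.toLinearMap

theorem isUnit_iff_det_ne_zero (A : 𝔤 →L[ℝ] 𝔤) : IsUnit A ↔ A.det ≠ 0 := by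
  rw [ContinuousLinearMap.isUnit_iff_isUnit_toLinearMap, LinearMap.isUnit_iff_isUnit_det,
    isUnit_iff_ne_zero]

/-- The polynomial $\det(1+rM)$ has linear coefficient $\mathrm{tr}M$. -/
theorem fderiv_det_one (B : 𝔤 →L[ℝ] 𝔤) :
    fderiv ℝ (fun A : 𝔤 →L[ℝ] 𝔤 => A.det) 1 B = tr B := by
  have h1 : HasDerivAt (fun r : ℝ => 1 + r • B) B 0 := by
    simpa using ((hasDerivAt_id (0 : ℝ)).smul_const B).const_add 1
  have hd : HasFDerivAt (fun A : 𝔤 →L[ℝ] 𝔤 => A.det) _ (1 + (0 : ℝ) • B) :=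
    (contDiff_det.differentiable (by simp) _).hasFDerivAt
  have h2 := hd.comp_hasDerivAt 0 h1
  set b := Module.finBasis ℝ 𝔤
  set M := LinearMap.toMatrix b b B.toLinearMap with hM
  have h3 : (fun r : ℝ => (1 + r • B).det) = fun r : ℝ =>
      (Matrix.det (1 + (Polynomial.X : Polynomial ℝ) • M.map Polynomial.C)).eval r := by
    funext r
    rw [det_eq_det_toMatrix]
    have : LinearMap.toMatrix b b (1 + r • B : 𝔤 →L[ℝ] 𝔤).toLinearMap = 1 + r • M := by
      rw [hM, ← map_smul, ← LinearMap.toMatrix_one b, ← map_add]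
      rfl
    rw [this]
    simp [eval_det, ← Matrix.smul_eq_mul_diagonal]
  have h4 := (Matrix.det (1 + (Polynomial.X : Polynomial ℝ) • M.map Polynomial.C)).hasDerivAt 0
  rw [← h3, Matrix.derivative_det_one_add_X_smul] at h4
  have h5 := h2.unique h4
  rw [zero_smul, add_zero] at h5
  rw [h5, tr, hM, LinearMap.trace_eq_matrix_trace ℝ b]

/-- Jacobi's formula. -/
theorem hasDerivAt_det {M : ℝ → 𝔤 →L[ℝ] 𝔤} {M' : 𝔤 →L[ℝ] 𝔤} {r : ℝ} (hM : HasDerivAt M M' r)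
    (hu : IsUnit (M r)) :
    HasDerivAt (fun r => (M r).det) ((M r).det * tr (Ring.inverse (M r) * M')) r := by
  -- Factoring out the invertible value $M(r)$ reduces the claim to the derivative of the
  -- determinant at $1$.
  have h1 : HasDerivAt (fun s => Ring.inverse (M r) * M s) (Ring.inverse (M r) * M') r :=
    hM.const_mul _
  have hd : HasFDerivAt (fun A : 𝔤 →L[ℝ] 𝔤 => A.det) _ (Ring.inverse (M r) * M r) :=
    (contDiff_det.differentiable (by simp) _).hasFDerivAt
  have h2 := (hd.comp_hasDerivAt r h1).const_mul (M r).det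
  rw [Ring.inverse_mul_cancel _ hu, fderiv_det_one] at h2
  refine h2.congr_of_eventuallyEq (Filter.Eventually.of_forall fun s => ?_)
  simp only [Function.comp]
  rw [← det_mul, ← mul_assoc, Ring.mul_inverse_cancel _ hu, one_mul]

theorem contDiff_j : ContDiff ℝ ∞ (j : 𝔤 → ℝ) :=
  contDiff_det.comp (contDiff_expDivided.comp contDiff_ad.neg)

theorem j_zero : j (0 : 𝔤) = 1 := by
  rw [j, ad_zero, neg_zero, expDivided_zero]
  exact LinearMap.det_id

theorem isUnit_expDivided_neg_ad {X : 𝔤} (hX : 0 < j X) : IsUnit (expDivided (-ad X)) :=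
  (isUnit_iff_det_ne_zero _).2 hX.ne'

theorem hasDerivAt_smul_self {E : Type*} [NormedAddCommGroup E] [NormedSpace ℝ E] (x : E) (r : ℝ) :
    HasDerivAt (fun r : ℝ => r • x) x r := by
  simpa using (hasDerivAt_id r).smul_const x

/-- The radial derivative of `j`. -/
theorem fderiv_j_self {X : 𝔤} (hX : 0 < j X) :
    fderiv ℝ j X X = j X * tr (todd (ad X) - 1) := by
  set A : 𝔤 →L[ℝ] 𝔤 := -ad X with hA
  have hu : IsUnit (expDivided A) := isUnit_expDivided_neg_ad hX
  have h1 : HasDerivAt (fun r : ℝ => expDivided (r • A)) (exp A - expDivided A) 1 := by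
    have hd : DifferentiableAt ℝ (fun r : ℝ => expDivided (r • A)) 1 :=
      ((contDiff_expDivided.comp (n := ∞) (contDiff_id.smul contDiff_const)).differentiable
        (by simp)) 1
    have h2 := (hasDerivAt_id (1 : ℝ)).smul hd.hasDerivAt
    have h3 := h2.unique (hasDerivAt_smul_expDivided A 1)
    simp only [id, one_smul] at h3
    refine hd.hasDerivAt.congr_deriv ?_
    rw [← h3]
    abel
  have h2 := hasDerivAt_det (M := fun r : ℝ => expDivided (r • A)) h1 (by simpa using hu)
  have h3 : HasFDerivAt (j : 𝔤 → ℝ) _ ((1 : ℝ) • X) :=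
    (contDiff_j.differentiable (by simp) _).hasFDerivAt
  have h4 := h3.comp_hasDerivAt (1 : ℝ) (hasDerivAt_smul_self X 1)
  have h5 : (j ∘ fun r : ℝ => r • X) = fun r : ℝ => (expDivided (r • A)).det := by
    funext r
    simp only [Function.comp, j, hA, ad_smul, smul_neg]
  rw [h5] at h4
  have h6 := h4.unique h2
  simp only [one_smul] at h6
  -- Here $\Phi(-A)^{-1}e^{-A}=(e^A\Phi(-A))^{-1}=\Phi(A)^{-1}$ for $A=\mathrm{ad}X$, which is `todd
  -- (ad X)`.
  rw [h6, mul_sub, Ring.inverse_mul_cancel _ hu, todd, ← exp_mul_expDivided_neg (ad X), ← hA,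
    Ring.mul_inverse_rev', Ring.inverse_exp]
  · rfl
  · have h7 : Commute (exp (ad X)) (ad X) := (Commute.refl (ad X)).exp_left
    exact semiconjBy_expDivided h7.neg_right

/-- The automorphism $e^{\mathrm{ad}F}$ conjugates $\mathrm{ad}X$ to
$\mathrm{ad}(e^{\mathrm{ad}F}X)$, and determinants are invariant under conjugation. -/
theorem j_exp_ad (F X : 𝔤) : j (exp (ad F) X) = j X := by
  have h1 : SemiconjBy (exp (ad F)) (-ad X) (-ad (exp (ad F) X)) :=
    SemiconjBy.neg_right (exp_ad_mul_ad F X)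
  have h2 := congrArg ContinuousLinearMap.det (semiconjBy_expDivided h1).eq
  rw [det_mul, det_mul, mul_comm] at h2
  exact (mul_right_cancel₀ ((isUnit_iff_det_ne_zero _).1 (NormedSpace.isUnit_exp _)) h2).symm

/-- The function `j` is invariant under the adjoint action. -/
theorem fderiv_j_lie (X F : 𝔤) : fderiv ℝ j X ⁅X, F⁆ = 0 := by
  have h1 := (hasDerivAt_exp_smul (ad F) 0).clm_apply (hasDerivAt_const (0 : ℝ) X)
  have h3 : HasFDerivAt (j : 𝔤 → ℝ) _ (exp ((0 : ℝ) • ad F) X) :=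
    (contDiff_j.differentiable (by simp) _).hasFDerivAt
  have h4 := h3.comp_hasDerivAt (0 : ℝ) h1
  have h5 : (j ∘ fun r : ℝ => exp (r • ad F) X) = fun _ : ℝ => j X := by
    funext r
    simp only [Function.comp, ← ad_smul, j_exp_ad]
  rw [h5] at h4
  have h6 := h4.unique (hasDerivAt_const (0 : ℝ) (j X))
  simp only [zero_smul, NormedSpace.exp_zero, mul_one, map_zero, add_zero, one_apply_eq_self,
    ad_apply] at h6
  rw [← lie_skew, map_neg, h6, neg_zero]

theorem tr_sub (A B : 𝔤 →L[ℝ] 𝔤) : tr (A - B) = tr A - tr B := by simp [tr]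

theorem tr_add (A B : 𝔤 →L[ℝ] 𝔤) : tr (A + B) = tr A + tr B := by simp [tr]

/-! ## The Kashiwara–Vergne equations in terms of derivatives of `Z` and `D` -/

/-- All the conditions that are imposed on the points of a small neighbourhood. -/
def IsKVRadius (𝔤 : Type*) [NormedLieRing 𝔤] [NormedLieAlgebra 𝔤] [FiniteDimensional ℝ 𝔤]
    (ρ : ℝ) : Prop :=
  IsGroupRadius 𝔤 ρ ∧ ∀ q ∈ Metric.ball (0 : 𝔤 × 𝔤) ρ, 0 < j q.1 ∧ 0 < j q.2 ∧ 0 < j (Z q.1 q.2)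

theorem exists_isKVRadius (𝔤 : Type u) [NormedLieRing 𝔤] [NormedLieAlgebra 𝔤]
    [FiniteDimensional ℝ 𝔤] : ∃ ρ, IsKVRadius 𝔤 ρ := by
  have hj : ∀ᶠ X in 𝓝 (0 : 𝔤), 0 < j X :=
    contDiff_j.continuous.continuousAt.eventually_const_lt (by rw [j_zero]; exact one_pos)
  have h1 : Filter.Tendsto (fun q : 𝔤 × 𝔤 => q.1) (𝓝 0) (𝓝 0) := continuous_fst.tendsto 0
  have h2 : Filter.Tendsto (fun q : 𝔤 × 𝔤 => q.2) (𝓝 0) (𝓝 0) := continuous_snd.tendsto 0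
  obtain ⟨ρ, hρ, h⟩ := Metric.eventually_nhds_iff_ball.1 (eventually_bchGood.and
    ((eventually_logAd_eq.and eventually_logAd_swap_eq).and
      ((h1.eventually hj).and ((h2.eventually hj).and (tendsto_Z.eventually hj)))))
  exact ⟨ρ, ⟨⟨hρ, fun q hq => (h q hq).1⟩, fun q hq => (h q hq).2.1⟩, fun q hq => (h q hq).2.2⟩

variable {ρ : ℝ}

theorem contDiffOn_D (hρ : IsKVRadius 𝔤 ρ) :
    ContDiffOn ℝ ∞ (fun q : 𝔤 × 𝔤 => D q.1 q.2) (Metric.ball (0 : 𝔤 × 𝔤) ρ) := by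
  refine ContDiffOn.div (ContDiffOn.mul ?_ ?_) ?_ fun q hq =>
    (Real.sqrt_pos.2 (hρ.2 q hq).2.2).ne'
  · exact ContDiffOn.sqrt (contDiff_j.comp contDiff_fst).contDiffOn fun q hq => (hρ.2 q hq).1.ne'
  · exact ContDiffOn.sqrt (contDiff_j.comp contDiff_snd).contDiffOn fun q hq => (hρ.2 q hq).2.1.ne'
  · exact ContDiffOn.sqrt (contDiff_j.comp_contDiffOn (contDiffOn_Z hρ.1.1))
      fun q hq => (hρ.2 q hq).2.2.ne'

theorem D_pos (hρ : IsKVRadius 𝔤 ρ) {q : 𝔤 × 𝔤} (hq : q ∈ Metric.ball (0 : 𝔤 × 𝔤) ρ) :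
    0 < D q.1 q.2 :=
  div_pos (mul_pos (Real.sqrt_pos.2 (hρ.2 q hq).1) (Real.sqrt_pos.2 (hρ.2 q hq).2.1))
    (Real.sqrt_pos.2 (hρ.2 q hq).2.2)

theorem fderiv_D (hρ : IsKVRadius 𝔤 ρ) {q : 𝔤 × 𝔤} (hq : q ∈ Metric.ball (0 : 𝔤 × 𝔤) ρ)
    (v : 𝔤 × 𝔤) : fderiv ℝ (fun q : 𝔤 × 𝔤 => D q.1 q.2) q v =
      D q.1 q.2 * (1 / 2 * (fderiv ℝ j q.1 v.1 / j q.1 + fderiv ℝ j q.2 v.2 / j q.2 -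
        fderiv ℝ j (Z q.1 q.2) (fderiv ℝ (fun q : 𝔤 × 𝔤 => Z q.1 q.2) q v) / j (Z q.1 q.2))) := by
  obtain ⟨p1, p2, p3⟩ := hρ.2 q hq
  have hj (X : 𝔤) : HasFDerivAt (j : 𝔤 → ℝ) (fderiv ℝ j X) X :=
    (contDiff_j.differentiable (by simp) X).hasFDerivAt
  have hZ : HasFDerivAt (fun q : 𝔤 × 𝔤 => Z q.1 q.2) _ q :=
    (((contDiffOn_Z hρ.1.1).contDiffAt (Metric.isOpen_ball.mem_nhds hq)).differentiableAt
      (by simp)).hasFDerivAt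
  have c1 : HasFDerivAt (fun q : 𝔤 × 𝔤 => j q.1) _ q :=
    HasFDerivAt.comp (g := j) q (hj q.1) hasFDerivAt_fst
  have c2 : HasFDerivAt (fun q : 𝔤 × 𝔤 => j q.2) _ q :=
    HasFDerivAt.comp (g := j) q (hj q.2) hasFDerivAt_snd
  have c3 : HasFDerivAt (fun q : 𝔤 × 𝔤 => j (Z q.1 q.2)) _ q :=
    HasFDerivAt.comp (g := j) q (hj (Z q.1 q.2)) hZ
  have h := ((c1.sqrt p1.ne').mul (c2.sqrt p2.ne')).mul
    ((hasDerivAt_inv (Real.sqrt_pos.2 p3).ne').comp_hasFDerivAt q (c3.sqrt p3.ne'))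
  have h' : HasFDerivAt (fun q : 𝔤 × 𝔤 => D q.1 q.2) _ q := h
  rw [h'.fderiv]
  have r1 := Real.sq_sqrt p1.le
  have r2 := Real.sq_sqrt p2.le
  have r3 := Real.sq_sqrt p3.le
  have n1 := (Real.sqrt_pos.2 p1).ne'
  have n2 := (Real.sqrt_pos.2 p2).ne'
  have n3 := (Real.sqrt_pos.2 p3).ne'
  simp only [D, add_apply, smul_apply, ContinuousLinearMap.comp_apply, Function.comp_apply,
    ContinuousLinearMap.coe_fst', ContinuousLinearMap.coe_snd', smul_eq_mul, Pi.mul_apply]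
  generalize fderiv ℝ j q.1 v.1 = a1
  generalize fderiv ℝ j q.2 v.2 = a2
  generalize fderiv ℝ j (Z q.1 q.2) (fderiv ℝ (fun q : 𝔤 × 𝔤 => Z q.1 q.2) q v) = a3
  rw [← r1, ← r2, ← r3]
  simp only [Real.sqrt_sq (Real.sqrt_nonneg _)]
  generalize √(j q.1) = b1 at *
  generalize √(j q.2) = b2 at *
  generalize √(j (Z q.1 q.2)) = b3 at *
  field_simp
  ring

/-- The trace in the left-hand side of the second Kashiwara–Vergne equation. -/
def kvTrace (β : 𝔤 × 𝔤 → 𝔤 × 𝔤) (q : 𝔤 × 𝔤) : ℝ :=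
  tr (ad q.1 ∘L fderiv ℝ (fun X' => (β (X', q.2)).1) q.1 +
    ad q.2 ∘L fderiv ℝ (fun Y' => (β (q.1, Y')).2) q.2)

theorem adField_apply (v p : 𝔤 × 𝔤) : adField v p = (⁅p.1, v.1⁆, ⁅p.2, v.2⁆) := rfl

theorem isUnit_expDivided_ad_Z (hρ : IsGroupRadius 𝔤 ρ) {q : 𝔤 × 𝔤}
    (hq : q ∈ Metric.ball (0 : 𝔤 × 𝔤) ρ) : IsUnit (expDivided (ad (Z q.1 q.2))) := by
  rw [← (hρ.2 q hq).1]
  exact (hρ.1.2 q hq).2.2.1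

theorem injective_of_isUnit {A : 𝔤 →L[ℝ] 𝔤} (hA : IsUnit A) : Function.Injective A := by
  obtain ⟨w, rfl⟩ := hA
  intro a b hab
  have := congrArg (fun x => (↑w⁻¹ : 𝔤 →L[ℝ] 𝔤) x) hab
  simpa [← mul_apply_eq_comp] using this

theorem expDivided_ad_lie (X F : 𝔤) : expDivided (ad X) ⁅X, F⁆ = exp (ad X) F - F := by
  have h5 : expDivided (ad X) * ad X = exp (ad X) - 1 := by
    rw [← mul_expDivided, (semiconjBy_expDivided (Commute.refl (ad X))).eq]
  have h6 := congrArg (fun A : 𝔤 →L[ℝ] 𝔤 => A F) h5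
  simpa [ad_apply] using h6

/-- Apply the invertible operators $\Phi(\mathrm{ad}Z)$ and then $e^{-\mathrm{ad}X}$ to
$dZ_q(q-[q,\beta])=Z$. Since $\Phi(\mathrm{ad}X)X=X$ and
$\Phi(\mathrm{ad}X)[X,F]=(e^{\mathrm{ad}X}-1)F$, and likewise for $Y$ and $G$, the left side becomes
$X+Y-(1-e^{-\mathrm{ad}X})F-(e^{\mathrm{ad}Y}-1)G$ and the right side $Z(Y,X)$. -/
theorem kvFirst_iff (hρ : IsGroupRadius 𝔤 ρ) {q : 𝔤 × 𝔤} (hq : q ∈ Metric.ball (0 : 𝔤 × 𝔤) ρ)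
    (β : 𝔤 × 𝔤 → 𝔤 × 𝔤) : KVFirst β q.1 q.2 ↔
      fderiv ℝ (fun q : 𝔤 × 𝔤 => Z q.1 q.2) q (q - adField (β q) q) = Z q.1 q.2 := by
  have h1 := expDivided_ad_Z_fderiv hρ hq (q - adField (β q) q)
  have h2 : fderiv ℝ (fun q : 𝔤 × 𝔤 => Z q.1 q.2) q (q - adField (β q) q) = Z q.1 q.2 ↔
      exp (-ad q.1) (expDivided (ad q.1) (q - adField (β q) q).1 +
        exp (ad q.1) (expDivided (ad q.2) (q - adField (β q) q).2)) = Z q.2 q.1 := by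
    rw [Z_swap hρ hq, ← h1]
    constructor
    · intro h
      rw [h, expDivided_ad_self]
    · intro h
      apply injective_of_isUnit (isUnit_expDivided_ad_Z hρ hq)
      rw [injective_of_isUnit (NormedSpace.isUnit_exp (-ad q.1)) h, expDivided_ad_self]
  have hinv (x : 𝔤) : exp (-ad q.1) (exp (ad q.1) x) = x := by
    rw [← mul_apply_eq_comp, exp_neg_mul_exp, one_apply_eq_self]
  have h3 : exp (-ad q.1) q.1 = q.1 := exp_apply_of_apply_eq_zero (by simp [ad_apply])
  rw [h2, KVFirst, adField_apply]
  simp only [Prod.fst_sub, Prod.snd_sub, map_sub, expDivided_ad_self, expDivided_ad_lie, map_add,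
    hinv, h3, sub_apply, one_apply_eq_self]
  generalize exp (-ad q.1) (β q).1 = a
  rw [← sub_eq_zero, ← sub_eq_zero (b := Z q.2 q.1)]
  refine Eq.congr_left ?_
  abel

/-- The two Kashiwara–Vergne equations as derivatives of `Z` and `D`. -/
theorem kv_iff (hρ : IsKVRadius 𝔤 ρ) {q : 𝔤 × 𝔤} (hq : q ∈ Metric.ball (0 : 𝔤 × 𝔤) ρ)
    (β : 𝔤 × 𝔤 → 𝔤 × 𝔤) : (KVFirst β q.1 q.2 ∧ KVTrace β q.1 q.2) ↔
      (fderiv ℝ (fun q : 𝔤 × 𝔤 => Z q.1 q.2) q (q - adField (β q) q) = Z q.1 q.2 ∧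
        fderiv ℝ (fun q : 𝔤 × 𝔤 => D q.1 q.2) q (q - adField (β q) q) =
          D q.1 q.2 * kvTrace β q) := by
  rw [kvFirst_iff hρ.1 hq]
  refine and_congr_right fun hZ => ?_
  obtain ⟨p1, p2, p3⟩ := hρ.2 q hq
  -- The first equation makes the direction at $Z$ radial. The three radial derivatives carry
  -- constants $-1$, $-1$ and $+1$, which leave the single $-1$ of the trace equation.
  rw [fderiv_D hρ hq, hZ, mul_right_inj' (D_pos hρ hq).ne']
  rw [adField_apply, Prod.fst_sub, Prod.snd_sub, map_sub, map_sub, fderiv_j_lie, fderiv_j_lie,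
    fderiv_j_self p1, fderiv_j_self p2, fderiv_j_self p3, sub_zero, sub_zero,
    mul_div_cancel_left₀ _ p1.ne', mul_div_cancel_left₀ _ p2.ne', mul_div_cancel_left₀ _ p3.ne']
  rw [KVTrace, ← kvTrace, eq_comm]
  simp only [tr_sub, tr_add]
  constructor <;> intro h <;> linarith

end Density

section WeakDerivative

universe u

open TopologicalSpace (Opens)

/-! ## Hadamard's lemma to second order -/

/-- The values are embedded into `E × ℝ →L[ℝ] ℝ`, which lies in the universe of `E` as the
vector-valued version demands, and are recovered by evaluation at `(0, 1)`. -/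
theorem exists_hadamard_quotient_real {E : Type u} [NormedAddCommGroup E] [NormedSpace ℝ E]
    {h : ℝ × E → ℝ} {W : Set (ℝ × E)} (hW : IsOpen W) (t : ℝ)
    (hconv : ∀ s p, (t, p) ∈ W → (s, p) ∈ W → ∀ r ∈ Set.Icc (0 : ℝ) 1, (t + r * (s - t), p) ∈ W)
    (hh : ContDiffOn ℝ ∞ h W) :
    ∃ R : ℝ × E → ℝ, ContDiffOn ℝ ∞ R {q | q ∈ W ∧ (t, q.2) ∈ W} ∧
      ∀ s p, (t, p) ∈ W → (s, p) ∈ W → h (s, p) = h (t, p) + (s - t) • R (s, p) := by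
  obtain ⟨R, hR, hRe⟩ := exists_hadamard_quotient (F := E × ℝ →L[ℝ] ℝ)
    (h := fun q => h q • ContinuousLinearMap.snd ℝ E ℝ) hW hconv (hh.smul contDiffOn_const)
  refine ⟨fun q => R q (0, 1), hR.clm_apply contDiffOn_const, fun s p ht hs => ?_⟩
  simpa using congrArg (fun A : E × ℝ →L[ℝ] ℝ => A (0, 1)) (hRe s p ht hs)

/-- Hadamard's lemma applied twice. The remainder is smooth jointly in $(s,p)$, so its seminorms on
compact sets stay bounded as $s\to t$. -/
theorem exists_taylor_two {E : Type u} [NormedAddCommGroup E] [NormedSpace ℝ E]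
    {h : ℝ × E → ℝ} {W : Set (ℝ × E)} (hW : IsOpen W) (t : ℝ)
    (hconv : ∀ s p, (t, p) ∈ W → (s, p) ∈ W → ∀ r ∈ Set.Icc (0 : ℝ) 1, (t + r * (s - t), p) ∈ W)
    (hh : ContDiffOn ℝ ∞ h W) :
    ∃ (a : E → ℝ) (R : ℝ × E → ℝ), ContDiffOn ℝ ∞ R {q | q ∈ W ∧ (t, q.2) ∈ W} ∧
      ∀ s p, (t, p) ∈ W → (s, p) ∈ W →
        h (s, p) = h (t, p) + (s - t) * a p + (s - t) ^ 2 * R (s, p) := by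
  obtain ⟨Q, hQ, hQe⟩ := exists_hadamard_quotient_real hW t hconv hh
  have hW' : IsOpen {q | q ∈ W ∧ (t, q.2) ∈ W} :=
    hW.inter (hW.preimage (f := fun q : ℝ × E => (t, q.2)) (by fun_prop))
  obtain ⟨R, hR, hRe⟩ := exists_hadamard_quotient_real hW' t
    (fun s p ht hs r hr => ⟨hconv s p ht.1 hs.1 r hr, ht.1⟩) hQ
  refine ⟨fun p => Q (t, p), R, hR.mono fun q hq => ⟨hq, hq.2, hq.2⟩, fun s p ht hs => ?_⟩
  rw [hQe s p ht hs, hRe s p ⟨ht, ht⟩ ⟨hs, ht⟩]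
  simp only [smul_eq_mul]
  ring

/-! ## Distributions applied to smooth families of functions -/

variable {E : Type u} [NormedAddCommGroup E] [NormedSpace ℝ E] {Ω : Opens E}

/-- The difference vanishes near the compact set that controls `u`, so all the relevant seminorms
are zero. -/
theorem CompDistribution.congr (u : CompDistribution Ω) {φ ψ : SmoothFn Ω}
    (h : Set.EqOn φ.1 ψ.1 Ω) : u.1 φ = u.1 ψ := by
  obtain ⟨K, hK, -, N, C, hb⟩ := u.2
  have h1 := hb (φ - ψ) 0 ⟨le_rfl, fun k _ x hx => ?_⟩
  · rw [mul_zero, map_sub] at h1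
    exact sub_eq_zero.1 (abs_nonpos_iff.1 h1)
  · have h2 : (φ - ψ).1 =ᶠ[𝓝 x] fun _ => (0 : ℝ) := by
      filter_upwards [Ω.isOpen.mem_nhds (hK hx)] with y hy
      change φ.1 y - ψ.1 y = 0
      rw [h hy, sub_self]
    rw [(h2.iteratedFDeriv ℝ k).eq_of_nhds]
    have h3 : iteratedFDeriv ℝ k (fun _ : E => (0 : ℝ)) = 0 := iteratedFDeriv_fun_zero
    simp [h3]

theorem norm_iteratedFDeriv_prodMk_right_le {F : Type*} [NormedAddCommGroup F] [NormedSpace ℝ F]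
    (s : F) (x : E) {i : ℕ} (hi : 1 ≤ i) :
    ‖iteratedFDeriv ℝ i (fun p : E => (s, p)) x‖ ≤ 1 := by
  obtain ⟨i, rfl⟩ := Nat.exists_eq_add_of_le' hi
  have h : fderiv ℝ (fun p : E => (s, p)) = fun _ => ContinuousLinearMap.inr ℝ F E :=
    funext fun p => (hasFDerivAt_prodMk_right s p).fderiv
  rw [← norm_iteratedFDeriv_fderiv, h]
  rcases Nat.eq_zero_or_pos i with rfl | hi
  · rw [norm_iteratedFDeriv_zero]
    exact ContinuousLinearMap.norm_inr_le_one ℝ F E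
  · rw [iteratedFDeriv_const_of_ne hi.ne']
    simp

/-- The slices of a smooth function of `(s, p)` are uniformly bounded, with their derivatives, on
compact sets. -/
theorem exists_derivBound_slice {R : ℝ × E → ℝ} {W : Set (ℝ × E)} (hW : IsOpen W)
    (hR : ContDiffOn ℝ ∞ R W) {t : ℝ} {K : Set E} (hK : IsCompact K)
    (htK : ∀ p ∈ K, (t, p) ∈ W) (N : ℕ) :
    ∃ M, ∀ᶠ s in 𝓝 t, DerivBound (fun p => R (s, p)) K N M := by
  obtain ⟨δ, hδ, hδW⟩ : ∃ δ > 0, Metric.closedBall t δ ×ˢ K ⊆ W := by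
    obtain ⟨v, w, hv, -, htv, hKw, hvw⟩ := generalized_tube_lemma (isCompact_singleton (x := t))
      hK hW (by rintro ⟨s, p⟩ ⟨hs, hp⟩; obtain rfl : s = t := hs; exact htK p hp)
    obtain ⟨δ, hδ, hb⟩ := Metric.nhds_basis_closedBall.mem_iff.1 (hv.mem_nhds (htv rfl))
    exact ⟨δ, hδ, (Set.prod_mono hb hKw).trans hvw⟩
  obtain ⟨B, hB1, hB⟩ := exists_deriv_bound (Ω := ⟨W, hW⟩) hR hδW
    ((isCompact_closedBall t δ).prod hK) N
  refine ⟨N.factorial * B, ?_⟩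
  filter_upwards [Metric.closedBall_mem_nhds t hδ] with s hs
  refine ⟨by positivity, fun k hk x hx => ?_⟩
  have hm : (s, x) ∈ W := hδW ⟨hs, hx⟩
  have hO : IsOpen {p : E | (s, p) ∈ W} := hW.preimage (by fun_prop)
  rw [← iteratedFDerivWithin_of_isOpen (𝕜 := ℝ) k hO hm]
  have h1 := norm_iteratedFDerivWithin_comp_le (n := k) (C := B) (D := 1) (N := ∞) hR
    (f := fun p : E => (s, p)) (s := {p : E | (s, p) ∈ W}) (x := x)
    (contDiff_prodMk_right s).contDiffOn (by exact_mod_cast le_top) hW.uniqueDiffOn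
    hO.uniqueDiffOn (fun _ h => h) hm
    (fun i hi => hB i (hi.trans hk) (s, x) ⟨hs, hx⟩)
    (fun i hi1 _ => by
      rw [iteratedFDerivWithin_of_isOpen (𝕜 := ℝ) i hO hm, one_pow]
      exact norm_iteratedFDeriv_prodMk_right_le s x hi1)
  refine h1.trans ?_
  rw [one_pow, mul_one]
  gcongr

/-- The function `s ↦ ⟨u, h(s, ·)⟩` may be differentiated under the distribution `u`. -/
theorem hasDerivWithinAt_compDistribution {h : ℝ × E → ℝ} {W : Set (ℝ × E)} (hW : IsOpen W)
    {t : ℝ} {S : Set ℝ} (ht : t ∈ S)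
    (hconv : ∀ s p, (t, p) ∈ W → (s, p) ∈ W → ∀ r ∈ Set.Icc (0 : ℝ) 1, (t + r * (s - t), p) ∈ W)
    (hh : ContDiffOn ℝ ∞ h W) (u : CompDistribution Ω) {g : ℝ → ℝ}
    (hg : ∀ᶠ s in 𝓝[S] t, (∀ p ∈ Ω, (s, p) ∈ W) ∧
      ∃ φ : SmoothFn Ω, (∀ p ∈ Ω, φ.1 p = h (s, p)) ∧ g s = u.1 φ)
    (ψ : SmoothFn Ω) (hψ : ∀ p ∈ Ω, HasDerivAt (fun s => h (s, p)) (ψ.1 p) t) :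
    HasDerivWithinAt g (u.1 ψ) S t := by
  obtain ⟨a, R, hR, hTaylor⟩ := exists_taylor_two hW t hconv hh
  have hgt := hg.self_of_nhdsWithin ht
  obtain ⟨htW, φt, hφt, hgφt⟩ := hgt
  have hW' : IsOpen {q : ℝ × E | q ∈ W ∧ (t, q.2) ∈ W} :=
    hW.inter (hW.preimage (f := fun q : ℝ × E => (t, q.2)) (by fun_prop))
  have ha (p : E) (hp : p ∈ Ω) : a p = ψ.1 p := by
    refine HasDerivAt.unique ?_ (hψ p hp)
    have hc : ContinuousAt (fun s => R (s, p)) t :=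
      (hR.contDiffAt (hW'.mem_nhds ⟨htW p hp, htW p hp⟩)).continuousAt.comp
        (f := fun s => (s, p)) (by fun_prop)
    have hd : HasDerivAt (fun s => h (t, p) + (s - t) * a p + (s - t) * ((s - t) * R (s, p)))
        (a p) t := by
      rw [hasDerivAt_iff_tendsto_slope]
      have h1 : Filter.Tendsto (fun s => a p + (s - t) * R (s, p)) (𝓝[≠] t) (𝓝 (a p)) := by
        have h2 : ContinuousAt (fun s => a p + (s - t) * R (s, p)) t :=
          continuousAt_const.add ((continuousAt_id.sub continuousAt_const).mul hc)
        have h3 := h2.tendsto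
        simp only [sub_self, zero_mul, add_zero] at h3
        exact h3.mono_left nhdsWithin_le_nhds
      refine h1.congr' ?_
      filter_upwards [self_mem_nhdsWithin] with s hs
      have hs' : s - t ≠ 0 := sub_ne_zero.2 hs
      rw [slope_def_field]
      field_simp
      ring
    refine hd.congr_of_eventuallyEq ?_
    have ho : IsOpen {s : ℝ | (s, p) ∈ W} := hW.preimage (by fun_prop)
    filter_upwards [ho.mem_nhds (htW p hp)] with s hs
    rw [hTaylor s p (htW p hp) hs]
    ring
  obtain ⟨K, hK, hKc, N, C, hu⟩ := u.2
  obtain ⟨M, hM⟩ := exists_derivBound_slice hW' hR hKc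
    (fun p hp => ⟨htW p (hK hp), htW p (hK hp)⟩) N
  rw [hasDerivWithinAt_iff_isLittleO]
  refine Asymptotics.IsBigO.trans_isLittleO (g := fun s => ‖s - t‖ ^ 2) ?_
    ((Asymptotics.isLittleO_pow_sub_sub t one_lt_two).mono nhdsWithin_le_nhds)
  refine Asymptotics.IsBigO.of_bound (C * M) ?_
  filter_upwards [hg, nhdsWithin_le_nhds hM] with s ⟨hsW, φ, hφ, hgφ⟩ hMs
  let Rs : SmoothFn Ω := ⟨fun p => R (s, p), hR.comp (contDiff_prodMk_right s).contDiffOn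
    fun p hp => ⟨hsW p hp, htW p hp⟩⟩
  -- The error of the linear approximation is $(s-t)^2\langle u,R_s\rangle$, bounded by $CM|s-t|^2$
  -- through the continuity estimate of `u`.
  have h1 : u.1 (φ - φt - (s - t) • ψ) = u.1 ((s - t) ^ 2 • Rs) := by
    refine CompDistribution.congr u fun p hp => ?_
    change φ.1 p - φt.1 p - (s - t) * ψ.1 p = (s - t) ^ 2 * R (s, p)
    rw [hφ p hp, hφt p hp, hTaylor s p (htW p hp) (hsW p hp), ha p hp]
    ring
  simp only [map_sub, map_smul, smul_eq_mul] at h1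
  rw [hgφ, hgφt, smul_eq_mul, h1, norm_mul, mul_comm (C * M), norm_pow, norm_pow, norm_norm]
  exact mul_le_mul_of_nonneg_left (hu Rs M hMs) (by positivity)

/-- The Dirac distribution. -/
def dirac (p : E) (hp : p ∈ Ω) : CompDistribution Ω :=
  ⟨{ toFun := fun φ => φ.1 p, map_add' := fun _ _ => rfl, map_smul' := fun _ _ => rfl },
    {p}, Set.singleton_subset_iff.2 hp, isCompact_singleton, 0, 1, fun φ M hM => by
      simpa using hM.2 0 le_rfl p rfl⟩

theorem dirac_apply (p : E) (hp : p ∈ Ω) (φ : SmoothFn Ω) : (dirac p hp).1 φ = φ.1 p := rfl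

end WeakDerivative

section Transport

universe u

open TopologicalSpace (Opens)

variable {𝔤 : Type u} [NormedLieRing 𝔤] [NormedLieAlgebra 𝔤] [FiniteDimensional ℝ 𝔤]

attribute [local instance] completeSpace_of_normedLieAlgebra normedAlgebraRat

/-! ## The operators `m_t` and `V` on test functions -/

theorem exists_m_apply {Ω : Opens (𝔤 × 𝔤)} {t : ℝ} (hZ : ContDiffOn ℝ ∞ (Zt t) (Ω : Set (𝔤 × 𝔤)))
    (hD : ContDiffOn ℝ ∞ (Dt t) (Ω : Set (𝔤 × 𝔤))) (f : SmoothFn (⊤ : Opens 𝔤)) :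
    ∃ φ : SmoothFn Ω, (∀ p, φ.1 p = Dt t p * f.1 (Zt t p)) ∧
      ∀ u : CompDistribution Ω, (m Ω t u).1 f = u.1 φ := by
  refine ⟨mulFn Ω (Dt t) hD (compFn Ω (Zt t) hZ f), fun p => rfl, fun u => ?_⟩
  rw [m, pushDist, mulDist, dif_pos hZ, dif_pos hD]
  rfl

/-- Transposition reverses the order: on test functions the multiplication by $\beta^i$ comes first,
so the derivative falls on the product $\beta^i\varphi$. This is the source of the trace term. -/
theorem exists_V_apply {n : ℕ} (e : Module.Basis (Fin n) ℝ 𝔤) {Ω : Opens (𝔤 × 𝔤)}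
    {β : 𝔤 × 𝔤 → 𝔤 × 𝔤} (hβ : ContDiffOn ℝ ∞ β Ω) (φ : SmoothFn Ω) :
    ∃ ψ : SmoothFn Ω, (∀ p ∈ Ω, ψ.1 p = ∑ i, fderiv ℝ
        (fun q => (e.prod e).repr (β q) i * φ.1 q) p (adField (e.prod e i) p)) ∧
      ∀ u : CompDistribution Ω, (V e Ω β u).1 φ = -u.1 ψ := by
  have hc (i : Fin n ⊕ Fin n) : ContDiffOn ℝ ∞ (fun q => (e.prod e).repr (β q) i) Ω :=
    (LinearMap.toContinuousLinearMap ((e.prod e).coord i)).contDiff.comp_contDiffOn hβ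
  refine ⟨∑ i, vectorFieldFn Ω (adField (e.prod e i)) (adField_contDiff _).contDiffOn
    (mulFn Ω _ (hc i) φ), fun p hp => ?_, fun u => ?_⟩
  · rw [Submodule.coe_sum, Finset.sum_apply]
    exact Finset.sum_congr rfl fun i _ => Set.indicator_of_mem (s := (Ω : Set (𝔤 × 𝔤)))
      (f := fun x => fderiv ℝ (fun q => (e.prod e).repr (β q) i * φ.1 q) x (adField (e.prod e i) x))
      hp
  · rw [V, map_sum, ← Finset.sum_neg_distrib, LinearMap.sum_apply, Submodule.coe_sum,
      LinearMap.sum_apply]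
    refine Finset.sum_congr rfl fun i _ => ?_
    rw [mulDist, dif_pos (hc i), lieDist]
    change (-1 : ℝ) * u.1 _ = _
    rw [neg_one_mul]

/-! ## Divergences -/

theorem fderiv_partial_fst {β : 𝔤 × 𝔤 → 𝔤 × 𝔤} {p : 𝔤 × 𝔤} (hβ : DifferentiableAt ℝ β p) :
    fderiv ℝ (fun X => (β (X, p.2)).1) p.1 =
      ContinuousLinearMap.fst ℝ 𝔤 𝔤 ∘L fderiv ℝ β p ∘L ContinuousLinearMap.inl ℝ 𝔤 𝔤 :=
  (((ContinuousLinearMap.fst ℝ 𝔤 𝔤).hasFDerivAt).comp p.1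
    (HasFDerivAt.comp (g := β) p.1 (f := fun X => (X, p.2)) hβ.hasFDerivAt
      (hasFDerivAt_prodMk_left p.1 p.2))).fderiv

theorem fderiv_partial_snd {β : 𝔤 × 𝔤 → 𝔤 × 𝔤} {p : 𝔤 × 𝔤} (hβ : DifferentiableAt ℝ β p) :
    fderiv ℝ (fun Y => (β (p.1, Y)).2) p.2 =
      ContinuousLinearMap.snd ℝ 𝔤 𝔤 ∘L fderiv ℝ β p ∘L ContinuousLinearMap.inr ℝ 𝔤 𝔤 :=
  (((ContinuousLinearMap.snd ℝ 𝔤 𝔤).hasFDerivAt).comp p.2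
    (HasFDerivAt.comp (g := β) p.2 (f := fun Y => (p.1, Y)) hβ.hasFDerivAt
      (hasFDerivAt_prodMk_right p.1 p.2))).fderiv

/-- The trace of `B ∘ (ad X, ad Y)` over `𝔤 × 𝔤`, by diagonal blocks. -/
def blockTrace (p : 𝔤 × 𝔤) (B : 𝔤 × 𝔤 →L[ℝ] 𝔤 × 𝔤) : ℝ :=
  tr (ad p.1 ∘L ContinuousLinearMap.fst ℝ 𝔤 𝔤 ∘L B ∘L ContinuousLinearMap.inl ℝ 𝔤 𝔤) +
    tr (ad p.2 ∘L ContinuousLinearMap.snd ℝ 𝔤 𝔤 ∘L B ∘L ContinuousLinearMap.inr ℝ 𝔤 𝔤)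

theorem kvTrace_eq_blockTrace {β : 𝔤 × 𝔤 → 𝔤 × 𝔤} {p : 𝔤 × 𝔤} (hβ : DifferentiableAt ℝ β p) :
    kvTrace β p = blockTrace p (fderiv ℝ β p) := by
  rw [kvTrace, fderiv_partial_fst hβ, fderiv_partial_snd hβ, tr_add, blockTrace]

theorem continuous_tr : Continuous (tr : (𝔤 →L[ℝ] 𝔤) → ℝ) :=
  (LinearMap.toContinuousLinearMap
    ((LinearMap.trace ℝ 𝔤).comp (ContinuousLinearMap.coeLM ℝ : (𝔤 →L[ℝ] 𝔤) →ₗ[ℝ] _))).continuous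

theorem continuous_blockTrace (p : 𝔤 × 𝔤) : Continuous (blockTrace p) :=
  (continuous_tr.comp (by fun_prop)).add (continuous_tr.comp (by fun_prop))

theorem tr_smul (c : ℝ) (A : 𝔤 →L[ℝ] 𝔤) : tr (c • A) = c * tr A := by simp [tr]

theorem blockTrace_smul (c : ℝ) (p : 𝔤 × 𝔤) (B : 𝔤 × 𝔤 →L[ℝ] 𝔤 × 𝔤) :
    blockTrace (c • p) B = c * blockTrace p B := by
  simp only [blockTrace, Prod.smul_fst, Prod.smul_snd, ad_smul, ContinuousLinearMap.smul_comp,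
    tr_smul, mul_add]

theorem tr_comp_comm (A B : 𝔤 →L[ℝ] 𝔤) : tr (A ∘L B) = tr (B ∘L A) :=
  LinearMap.trace_mul_comm ℝ A.toLinearMap B.toLinearMap

theorem tr_eq_sum {n : ℕ} (e : Module.Basis (Fin n) ℝ 𝔤) (A : 𝔤 →L[ℝ] 𝔤) :
    tr A = ∑ i, e.repr (A (e i)) i := by
  rw [tr, LinearMap.trace_eq_matrix_trace ℝ e, Matrix.trace]
  simp [LinearMap.toMatrix_apply]

/-- The bracket of the product algebra is block diagonal, so only the diagonal blocks of `B`
contribute. -/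
theorem sum_repr_adField {n : ℕ} (e : Module.Basis (Fin n) ℝ 𝔤) (p : 𝔤 × 𝔤)
    (B : 𝔤 × 𝔤 →L[ℝ] 𝔤 × 𝔤) :
    ∑ i, (e.prod e).repr (B (adField (e.prod e i) p)) i = blockTrace p B := by
  rw [Fintype.sum_sum_type, blockTrace, tr_comp_comm (ad p.1), tr_comp_comm (ad p.2), tr_eq_sum e,
    tr_eq_sum e]
  simp [adField_apply, ad_apply]

theorem sum_repr_smul_adField {n : ℕ} (e : Module.Basis (Fin n) ℝ 𝔤) (v p : 𝔤 × 𝔤) :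
    ∑ i, (e.prod e).repr v i • adField (e.prod e i) p = adField v p := by
  conv_rhs => rw [← (e.prod e).sum_repr v]
  simp only [adField, lie_sum, lie_smul]

/-- Leibniz: the derivatives of the coefficients add up to a trace, and those of $\varphi$ recombine
into the derivative along $[p,\beta(p)]$. -/
theorem sum_fderiv_repr_mul {n : ℕ} (e : Module.Basis (Fin n) ℝ 𝔤) {β : 𝔤 × 𝔤 → 𝔤 × 𝔤}
    {φ : 𝔤 × 𝔤 → ℝ} {p : 𝔤 × 𝔤} (hβ : DifferentiableAt ℝ β p) (hφ : DifferentiableAt ℝ φ p) :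
    ∑ i, fderiv ℝ (fun q => (e.prod e).repr (β q) i * φ q) p (adField (e.prod e i) p) =
      φ p * kvTrace β p + fderiv ℝ φ p (adField (β p) p) := by
  have hc (i : Fin n ⊕ Fin n) (v : 𝔤 × 𝔤) :
      fderiv ℝ (fun q => (e.prod e).repr (β q) i * φ q) p v =
        φ p * (e.prod e).repr (fderiv ℝ β p v) i + (e.prod e).repr (β p) i * fderiv ℝ φ p v := by
    have h1 : HasFDerivAt (fun q => (e.prod e).repr (β q) i) _ p :=
      ((LinearMap.toContinuousLinearMap ((e.prod e).coord i)).hasFDerivAt).comp p hβ.hasFDerivAt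
    have h2 : HasFDerivAt (fun q => (e.prod e).repr (β q) i * φ q) _ p := h1.mul hφ.hasFDerivAt
    rw [h2.fderiv]
    simp [add_comm]
  simp only [hc, Finset.sum_add_distrib]
  rw [← Finset.mul_sum, sum_repr_adField, kvTrace_eq_blockTrace hβ,
    ← sum_repr_smul_adField e (β p) p, map_sum]
  simp

/-! ## The pointwise transport equations -/

/-- The transport equations of `Z_t` and `D_t` at the time `t` and the point `p`. -/
def PointTransport (β : 𝔤 × 𝔤 → 𝔤 × 𝔤) (t : ℝ) (p : 𝔤 × 𝔤) : Prop :=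
  HasDerivAt (fun s => Zt s p) (fderiv ℝ (Zt t) p (adField (dil β t p) p)) t ∧
    HasDerivAt (fun s => Dt s p)
      (fderiv ℝ (Dt t) p (adField (dil β t p) p) + Dt t p * kvTrace (dil β t) p) t

variable {ρ : ℝ}

theorem isOpen_smul_mem_ball : IsOpen {z : ℝ × (𝔤 × 𝔤) | z.1 • z.2 ∈ Metric.ball (0 : 𝔤 × 𝔤) ρ} :=
  Metric.isOpen_ball.preimage (by fun_prop)

theorem contDiffOn_Dt (hρ : IsKVRadius 𝔤 ρ) :
    ContDiffOn ℝ ∞ (fun z : ℝ × (𝔤 × 𝔤) => Dt z.1 z.2)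
      {z | z.1 • z.2 ∈ Metric.ball (0 : 𝔤 × 𝔤) ρ} :=
  (contDiffOn_D hρ).comp (f := fun z : ℝ × (𝔤 × 𝔤) => z.1 • z.2)
    (ContDiff.contDiffOn (by fun_prop)) fun _ h => h

theorem differentiableAt_Z (hρ : IsKVRadius 𝔤 ρ) {q : 𝔤 × 𝔤}
    (hq : q ∈ Metric.ball (0 : 𝔤 × 𝔤) ρ) :
    DifferentiableAt ℝ (fun q : 𝔤 × 𝔤 => Z q.1 q.2) q :=
  ((contDiffOn_Z hρ.1.1).contDiffAt (Metric.isOpen_ball.mem_nhds hq)).differentiableAt (by simp)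

theorem differentiableAt_D (hρ : IsKVRadius 𝔤 ρ) {q : 𝔤 × 𝔤}
    (hq : q ∈ Metric.ball (0 : 𝔤 × 𝔤) ρ) :
    DifferentiableAt ℝ (fun q : 𝔤 × 𝔤 => D q.1 q.2) q :=
  ((contDiffOn_D hρ).contDiffAt (Metric.isOpen_ball.mem_nhds hq)).differentiableAt (by simp)

theorem adField_smul_smul (c d : ℝ) (v p : 𝔤 × 𝔤) :
    adField (c • v) (d • p) = (c * d) • adField v p := by
  rw [adField, lie_smul, smul_lie, smul_smul, adField]

theorem fderiv_comp_smul {F : Type*} [NormedAddCommGroup F] [NormedSpace ℝ F] {h : 𝔤 × 𝔤 → F}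
    {t : ℝ} {p : 𝔤 × 𝔤} (hh : DifferentiableAt ℝ h (t • p)) :
    HasFDerivAt (fun p => h (t • p)) (t • fderiv ℝ h (t • p)) p := by
  have h1 := HasFDerivAt.comp (g := h) p hh.hasFDerivAt ((hasFDerivAt_id p).const_smul t)
  refine h1.congr_fderiv ?_
  ext <;> simp

theorem fderiv_dil {β : 𝔤 × 𝔤 → 𝔤 × 𝔤} {t : ℝ} {p : 𝔤 × 𝔤}
    (hβ : DifferentiableAt ℝ β (t • p)) : HasFDerivAt (dil β t) (fderiv ℝ β (t • p)) p := by
  by_cases ht : t = 0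
  · subst ht
    have h : dil β 0 = fderiv ℝ β 0 := funext fun p => if_pos rfl
    rw [h, zero_smul]
    exact (fderiv ℝ β 0).hasFDerivAt
  · have h : dil β t = fun p => t⁻¹ • β (t • p) := funext fun p => if_neg ht
    rw [h]
    refine ((fderiv_comp_smul hβ).const_smul t⁻¹).congr_fderiv ?_
    rw [inv_smul_smul₀ ht]

/-- With $q=tp$ one has $\partial_tZ_t(p)=t^{-2}(dZ_q(q)-Z(q))$, $[p,\beta_t(p)]=t^{-2}[q,\beta(q)]$
and $d(Z_t)_p=dZ_q$. In the equation for $D_t$ every term carries $t^{-1}$. After division only the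
equations of `kv_iff` at $q$ remain. -/
theorem pointTransport_iff (hρ : IsKVRadius 𝔤 ρ) {β : 𝔤 × 𝔤 → 𝔤 × 𝔤} {t : ℝ} (ht : t ≠ 0)
    {p : 𝔤 × 𝔤} (hp : t • p ∈ Metric.ball (0 : 𝔤 × 𝔤) ρ) (hβ : DifferentiableAt ℝ β (t • p)) :
    PointTransport β t p ↔
      (KVFirst β (t • p).1 (t • p).2 ∧ KVTrace β (t • p).1 (t • p).2) := by
  obtain ⟨q, hq⟩ : ∃ q, q = t • p := ⟨_, rfl⟩
  rw [← hq] at hp hβ ⊢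
  have hpq : p = t⁻¹ • q := by rw [hq, inv_smul_smul₀ ht]
  rw [kv_iff hρ hp, map_sub, map_sub]
  have hlin : HasDerivAt (fun s : ℝ => s • p) p t := hasDerivAt_smul_self p t
  have hdil : dil β t p = t⁻¹ • β q := by rw [hq]; exact if_neg ht
  have had : adField (dil β t p) p = (t⁻¹ * t⁻¹) • adField (β q) q := by
    rw [hdil, ← adField_smul_smul, ← hpq]
  have hZq := differentiableAt_Z hρ hp
  have hDq := differentiableAt_D hρ hp
  have hβ' := hβ
  have hZq' := hZq
  have hDq' := hDq
  rw [hq] at hZq' hDq' hβ'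
  have hZs : HasDerivAt (fun s => Zt s p)
      ((t⁻¹ * t⁻¹) • (fderiv ℝ (fun q : 𝔤 × 𝔤 => Z q.1 q.2) q q - Z q.1 q.2)) t := by
    have h1 := (hasDerivAt_inv ht).smul
      (HasFDerivAt.comp_hasDerivAt (l := fun q : 𝔤 × 𝔤 => Z q.1 q.2) t hZq'.hasFDerivAt hlin)
    refine (h1.congr_of_eventuallyEq ?_).congr_deriv ?_
    · filter_upwards [isOpen_ne.mem_nhds ht] with s hs
      exact if_neg hs
    · simp only [Function.comp_apply, ← hq]
      rw [hpq, map_smul, smul_smul, smul_sub, neg_smul, ← sub_eq_add_neg, ← sq, inv_pow]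
  have hDs : HasDerivAt (fun s => Dt s p)
      (t⁻¹ * fderiv ℝ (fun q : 𝔤 × 𝔤 => D q.1 q.2) q q) t := by
    have h1 :=
      HasFDerivAt.comp_hasDerivAt (l := fun q : 𝔤 × 𝔤 => D q.1 q.2) t hDq'.hasFDerivAt hlin
    refine HasDerivAt.congr_deriv h1 ?_
    rw [← hq, hpq, map_smul, smul_eq_mul]
  have hZp : fderiv ℝ (Zt t) p = fderiv ℝ (fun q : 𝔤 × 𝔤 => Z q.1 q.2) q := by
    have h1 := (fderiv_comp_smul hZq').const_smul t⁻¹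
    have h2 : Zt t = fun p : 𝔤 × 𝔤 => t⁻¹ • Z (t • p).1 (t • p).2 := funext fun p => if_neg ht
    rw [h2]
    refine h1.fderiv.trans ?_
    rw [inv_smul_smul₀ ht, hq]
  have hDp : fderiv ℝ (Dt t) p = t • fderiv ℝ (fun q : 𝔤 × 𝔤 => D q.1 q.2) q :=
    hq ▸ (fderiv_comp_smul hDq').fderiv
  have htr : kvTrace (dil β t) p = t⁻¹ * kvTrace β q := by
    rw [kvTrace_eq_blockTrace (fderiv_dil hβ').differentiableAt, kvTrace_eq_blockTrace hβ,
      (fderiv_dil hβ').fderiv, ← hq, ← blockTrace_smul, ← hpq]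
  have hDt : Dt t p = D q.1 q.2 := by rw [hq]; rfl
  rw [PointTransport, had, hZp, hDp, htr, hDt]
  have hi : t⁻¹ ≠ 0 := inv_ne_zero ht
  refine and_congr ⟨fun h => ?_, fun h => ?_⟩ ⟨fun h => ?_, fun h => ?_⟩
  · have h1 := h.unique hZs
    rw [map_smul] at h1
    have h2 := smul_right_injective 𝔤 (mul_ne_zero hi hi) h1
    rw [h2, sub_sub_cancel]
  · refine hZs.congr_deriv ?_
    rw [map_smul, ← h, sub_sub_cancel]
  · have h1 := h.unique hDs
    rw [smul_apply, map_smul, smul_eq_mul, smul_eq_mul] at h1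
    field_simp at h1
    rw [← h1]
    ring
  · refine hDs.congr_deriv ?_
    rw [smul_apply, map_smul, smul_eq_mul, smul_eq_mul, sub_eq_iff_eq_add.1 h]
    field_simp
    ring

end Transport

section Equivalence

universe u

open TopologicalSpace (Opens)

variable {𝔤 : Type u} [NormedLieRing 𝔤] [NormedLieAlgebra 𝔤] [FiniteDimensional ℝ 𝔤]

attribute [local instance] completeSpace_of_normedLieAlgebra normedAlgebraRat

/-! ## The transport equations at time `0` -/

theorem hasDerivAt_slice {E F : Type*} [NormedAddCommGroup E] [NormedSpace ℝ E]
    [NormedAddCommGroup F] [NormedSpace ℝ F] {G : ℝ × E → F} {s : ℝ} {p : E}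
    (hG : DifferentiableAt ℝ G (s, p)) :
    HasDerivAt (fun s => G (s, p)) (fderiv ℝ G (s, p) (1, 0)) s :=
  hG.hasFDerivAt.comp_hasDerivAt (l := G) s ((hasDerivAt_id s).prodMk (hasDerivAt_const s p))

theorem hasFDerivAt_slice {E F : Type*} [NormedAddCommGroup E] [NormedSpace ℝ E]
    [NormedAddCommGroup F] [NormedSpace ℝ F] {G : ℝ × E → F} {s : ℝ} {p : E}
    (hG : DifferentiableAt ℝ G (s, p)) :
    HasFDerivAt (fun p => G (s, p)) (fderiv ℝ G (s, p) ∘L ContinuousLinearMap.inr ℝ ℝ E) p :=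
  HasFDerivAt.comp (g := G) p hG.hasFDerivAt (hasFDerivAt_prodMk_right s p)

theorem tendsto_clm_apply {ι E F : Type*} [NormedAddCommGroup E] [NormedSpace ℝ E]
    [NormedAddCommGroup F] [NormedSpace ℝ F] {l : Filter ι} {A : ι → E →L[ℝ] F} {A₀ : E →L[ℝ] F}
    {v : ι → E} {v₀ : E} (hA : Filter.Tendsto A l (𝓝 A₀)) (hv : Filter.Tendsto v l (𝓝 v₀)) :
    Filter.Tendsto (fun i => A i (v i)) l (𝓝 (A₀ v₀)) :=
  (isBoundedBilinearMap_apply.continuous.tendsto (A₀, v₀)).comp (hA.prodMk_nhds hv)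

/-- A linear transport equation that holds at all times near `t` holds at `t`. -/
theorem hasDerivAt_of_tendsto_transport {E F : Type*} [NormedAddCommGroup E] [NormedSpace ℝ E]
    [NormedAddCommGroup F] [NormedSpace ℝ F] {G : ℝ × E → F} {W : Set (ℝ × E)} (hW : IsOpen W)
    (hG : ContDiffOn ℝ ∞ G W) {t : ℝ} {p : E} (htp : (t, p) ∈ W) {v : ℝ → E} {v₀ : E} {c : ℝ → F}
    {c₀ : F} (hv : Filter.Tendsto v (𝓝[≠] t) (𝓝 v₀)) (hc : Filter.Tendsto c (𝓝[≠] t) (𝓝 c₀))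
    (h : ∀ᶠ s in 𝓝[≠] t, HasDerivAt (fun s => G (s, p))
      (fderiv ℝ (fun p => G (s, p)) p (v s) + c s) s) :
    HasDerivAt (fun s => G (s, p)) (fderiv ℝ (fun p => G (t, p)) p v₀ + c₀) t := by
  have hd (q : ℝ × E) (hq : q ∈ W) : DifferentiableAt ℝ G q :=
    (hG.contDiffAt (hW.mem_nhds hq)).differentiableAt (by simp)
  have hdc : ContinuousAt (fun s => fderiv ℝ G (s, p)) t :=
    ((hG.fderiv_of_isOpen (m := ∞) hW (by simp)).contDiffAt (hW.mem_nhds htp)).continuousAt.comp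
      (f := fun s => (s, p)) (by fun_prop)
  have hdc' := hdc.tendsto.mono_left (nhdsWithin_le_nhds (s := {t}ᶜ))
  refine (hasDerivAt_slice (hd _ htp)).congr_deriv ?_
  rw [(hasFDerivAt_slice (hd _ htp)).fderiv]
  have h1 : Filter.Tendsto (fun s => fderiv ℝ G (s, p) (1, 0)) (𝓝[≠] t)
      (𝓝 (fderiv ℝ G (t, p) (1, 0))) := tendsto_clm_apply hdc' tendsto_const_nhds
  have h2 : Filter.Tendsto (fun s => (fderiv ℝ G (s, p) ∘L ContinuousLinearMap.inr ℝ ℝ E) (v s)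
      + c s) (𝓝[≠] t) (𝓝 ((fderiv ℝ G (t, p) ∘L ContinuousLinearMap.inr ℝ ℝ E) v₀ + c₀)) :=
    (tendsto_clm_apply hdc' (((ContinuousLinearMap.inr ℝ ℝ E).continuous.tendsto _).comp hv)).add hc
  refine tendsto_nhds_unique h1 (h2.congr' ?_)
  have ho : IsOpen {s : ℝ | (s, p) ∈ W} := hW.preimage (by fun_prop)
  filter_upwards [h, nhdsWithin_le_nhds (ho.mem_nhds htp)] with s hs hsW
  rw [(hasDerivAt_slice (hd _ hsW)).unique hs, (hasFDerivAt_slice (hd _ hsW)).fderiv]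

theorem tendsto_dil {β : 𝔤 × 𝔤 → 𝔤 × 𝔤} (hβ : DifferentiableAt ℝ β 0) (hβ0 : β 0 = 0)
    (p : 𝔤 × 𝔤) : Filter.Tendsto (fun s => dil β s p) (𝓝[≠] 0) (𝓝 (dil β 0 p)) := by
  have hβ' : HasFDerivAt β (fderiv ℝ β 0) ((0 : ℝ) • p) := by
    rw [zero_smul]
    exact hβ.hasFDerivAt
  have h1 := HasFDerivAt.comp_hasDerivAt (l := β) (0 : ℝ) hβ' (hasDerivAt_smul_self p 0)
  have h2 : dil β 0 p = fderiv ℝ β 0 p := if_pos rfl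
  rw [h2]
  refine (hasDerivAt_iff_tendsto_slope.1 h1).congr' ?_
  filter_upwards [self_mem_nhdsWithin] with s hs
  have h3 : dil β s p = s⁻¹ • β (s • p) := if_neg hs
  simp [slope, hβ0, h3]

variable {ρ : ℝ}

theorem continuous_adField_left (p : 𝔤 × 𝔤) : Continuous fun v => adField v p := by
  have h : (fun v => adField v p) = fun v => (ad p.1 v.1, ad p.2 v.2) := by
    funext v
    simp [adField_apply, ad_apply]
  rw [h]
  fun_prop

/-- All terms are continuous in time, so the equations pass to the limit $s\to0$. The convergence
$\beta_s(p)\to d\beta(0)p$ is where $\beta(0)=0$ enters. -/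
theorem pointTransport_zero (hρ : IsKVRadius 𝔤 ρ) {β : 𝔤 × 𝔤 → 𝔤 × 𝔤}
    (hβ : ContDiffAt ℝ ∞ β 0) (hβ0 : β 0 = 0) {p : 𝔤 × 𝔤}
    (h : ∀ᶠ s in 𝓝[≠] (0 : ℝ), PointTransport β s p) : PointTransport β 0 p := by
  have hv : Filter.Tendsto (fun s => adField (dil β s p) p) (𝓝[≠] 0) (𝓝 (adField (dil β 0 p) p)) :=
    ((continuous_adField_left p).tendsto _).comp (tendsto_dil (hβ.differentiableAt (by simp)) hβ0 p)
  have hm : ((0 : ℝ), p) ∈ {z : ℝ × (𝔤 × 𝔤) | z.1 • z.2 ∈ Metric.ball (0 : 𝔤 × 𝔤) ρ} := by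
    simpa using hρ.1.1.1
  have hs0 : Filter.Tendsto (fun s : ℝ => s • p) (𝓝 0) (𝓝 0) := by
    have h1 : Continuous fun s : ℝ => s • p := by fun_prop
    simpa using h1.tendsto 0
  have hdβ : ∀ᶠ q in 𝓝 (0 : 𝔤 × 𝔤), DifferentiableAt ℝ β q := by
    have h1 : ContDiffAt ℝ 1 β 0 := hβ.of_le (by exact_mod_cast le_top)
    exact (h1.eventually (by simp)).mono fun q hq => hq.differentiableAt (by simp)
  have htr : ∀ᶠ s in 𝓝 (0 : ℝ), kvTrace (dil β s) p = blockTrace p (fderiv ℝ β (s • p)) := by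
    filter_upwards [hs0.eventually hdβ] with s hs
    rw [kvTrace_eq_blockTrace (fderiv_dil hs).differentiableAt, (fderiv_dil hs).fderiv]
  have htr' : Filter.Tendsto (fun s => kvTrace (dil β s) p) (𝓝 0) (𝓝 (kvTrace (dil β 0) p)) := by
    rw [htr.self_of_nhds, zero_smul]
    have h1 : ContinuousAt (fderiv ℝ β) 0 := (hβ.fderiv_right (m := 0) (by simp)).continuousAt
    exact (((continuous_blockTrace p).tendsto _).comp (h1.tendsto.comp hs0)).congr'
      (htr.mono fun s hs => hs.symm)
  have hD : Filter.Tendsto (fun s => Dt s p) (𝓝 0) (𝓝 (Dt 0 p)) :=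
    (((contDiffOn_Dt hρ).contDiffAt (isOpen_smul_mem_ball.mem_nhds hm)).continuousAt.comp
      (f := fun s : ℝ => (s, p)) (by fun_prop)).tendsto
  refine ⟨?_, ?_⟩
  · have h1 := hasDerivAt_of_tendsto_transport (G := fun z : ℝ × (𝔤 × 𝔤) => Zt z.1 z.2)
      (c := fun _ => (0 : 𝔤)) isOpen_smul_mem_ball
      (contDiffOn_Zt hρ.1.1) hm hv tendsto_const_nhds (h.mono fun s hs => by simpa using hs.1)
    rw [add_zero] at h1
    exact h1
  · exact hasDerivAt_of_tendsto_transport (G := fun z : ℝ × (𝔤 × 𝔤) => Dt z.1 z.2)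
      (c := fun s => Dt s p * kvTrace (dil β s) p) isOpen_smul_mem_ball (contDiffOn_Dt hρ) hm hv
      ((hD.mul htr').mono_left nhdsWithin_le_nhds) (h.mono fun s hs => hs.2)

/-! ## Transport of test functions -/

theorem hasFDerivAt_Dt_mul {t : ℝ} {p : 𝔤 × 𝔤} (hZ : DifferentiableAt ℝ (Zt t) p)
    (hD : DifferentiableAt ℝ (Dt t) p) {f : 𝔤 → ℝ} (hf : DifferentiableAt ℝ f (Zt t p))
    (v : 𝔤 × 𝔤) : fderiv ℝ (fun q => Dt t q * f (Zt t q)) p v =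
      Dt t p * fderiv ℝ f (Zt t p) (fderiv ℝ (Zt t) p v) + f (Zt t p) * fderiv ℝ (Dt t) p v := by
  have h : HasFDerivAt (fun q => Dt t q * f (Zt t q)) _ p := hD.hasFDerivAt.mul
    (HasFDerivAt.comp (g := f) p hf.hasFDerivAt hZ.hasFDerivAt)
  rw [h.fderiv]
  simp

theorem PointTransport.hasDerivAt {β : 𝔤 × 𝔤 → 𝔤 × 𝔤} {t : ℝ} {p : 𝔤 × 𝔤}
    (h : PointTransport β t p) (hZ : DifferentiableAt ℝ (Zt t) p)
    (hD : DifferentiableAt ℝ (Dt t) p) {f : 𝔤 → ℝ} (hf : DifferentiableAt ℝ f (Zt t p)) :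
    HasDerivAt (fun s => Dt s p * f (Zt s p))
      (Dt t p * f (Zt t p) * kvTrace (dil β t) p +
        fderiv ℝ (fun q => Dt t q * f (Zt t q)) p (adField (dil β t p) p)) t := by
  refine (h.2.mul (HasFDerivAt.comp_hasDerivAt (l := f) t hf.hasFDerivAt h.1)).congr_deriv ?_
  rw [hasFDerivAt_Dt_mul hZ hD hf, Function.comp_apply]
  ring

/-- The constant function $1$ isolates the equation for $D_t$. Subtracting it for a linear form $l$
leaves $D_t$ times $l$ of the equation for $Z_t$; since $D_t\ne0$ and linear forms separate points,
that equation follows. -/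
theorem pointTransport_of_hasDerivAt {β : 𝔤 × 𝔤 → 𝔤 × 𝔤} {t : ℝ} {p : 𝔤 × 𝔤}
    (hZ : DifferentiableAt ℝ (Zt t) p) (hD : DifferentiableAt ℝ (Dt t) p)
    (hZs : DifferentiableAt ℝ (fun s => Zt s p) t) (hDs : DifferentiableAt ℝ (fun s => Dt s p) t)
    (hne : Dt t p ≠ 0)
    (h : ∀ f : 𝔤 → ℝ, ContDiff ℝ ∞ f → deriv (fun s => Dt s p * f (Zt s p)) t =
      Dt t p * f (Zt t p) * kvTrace (dil β t) p +
        fderiv ℝ (fun q => Dt t q * f (Zt t q)) p (adField (dil β t p) p)) :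
    PointTransport β t p := by
  have h1 := h (fun _ => 1) contDiff_const
  simp only [mul_one] at h1
  have hD' : deriv (fun s => Dt s p) t =
      fderiv ℝ (Dt t) p (adField (dil β t p) p) + Dt t p * kvTrace (dil β t) p := by
    rw [h1, add_comm]
  refine ⟨hZs.hasDerivAt.congr_deriv ?_, hDs.hasDerivAt.congr_deriv hD'⟩
  refine (SeparatingDual.eq_iff_forall_dual_eq (R := ℝ)).2 fun l => ?_
  have h2 := h l l.contDiff
  have h3 : HasDerivAt (fun s => Dt s p * l (Zt s p)) _ t := hDs.hasDerivAt.mul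
    (HasFDerivAt.comp_hasDerivAt (l := l) t l.hasFDerivAt hZs.hasDerivAt)
  rw [h3.deriv, hasFDerivAt_Dt_mul hZ hD l.differentiableAt, ContinuousLinearMap.fderiv, hD'] at h2
  refine mul_left_cancel₀ hne ?_
  linarith

/-! ## The two forms of the transport equation -/

variable {𝒪 : Set 𝔤}

theorem mem_ball_of_mem_dilDom (h𝒪 : 𝒪 ⊆ Metric.ball 0 ρ) {t : ℝ} {p : 𝔤 × 𝔤}
    (hp : p ∈ dilDom 𝒪 t) : t • p ∈ Metric.ball (0 : 𝔤 × 𝔤) ρ := by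
  have h1 := h𝒪 hp.1
  have h2 := h𝒪 hp.2
  rw [mem_ball_zero_iff] at h1 h2 ⊢
  exact max_lt h1 h2

theorem contDiffOn_dil {β : 𝔤 × 𝔤 → 𝔤 × 𝔤} (hβ : ContDiffOn ℝ ∞ β (𝒪 ×ˢ 𝒪)) (t : ℝ) :
    ContDiffOn ℝ ∞ (dil β t) (dilDom 𝒪 t) := by
  by_cases ht : t = 0
  · subst ht
    have h : dil β 0 = fderiv ℝ β 0 := funext fun p => if_pos rfl
    rw [h]
    exact (fderiv ℝ β 0).contDiff.contDiffOn
  · have h : dil β t = fun p => t⁻¹ • β (t • p) := funext fun p => if_neg ht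
    rw [h]
    exact (hβ.comp (f := fun p : 𝔤 × 𝔤 => t • p) (ContDiff.contDiffOn (by fun_prop))
      fun p hp => hp).const_smul t⁻¹

/-- A family of test functions, smooth in `(s, p)`. -/
theorem contDiffOn_Dt_mul (hρ : IsKVRadius 𝔤 ρ) {f : 𝔤 → ℝ} (hf : ContDiff ℝ ∞ f) :
    ContDiffOn ℝ ∞ (fun z : ℝ × (𝔤 × 𝔤) => Dt z.1 z.2 * f (Zt z.1 z.2))
      {z | z.1 • z.2 ∈ Metric.ball (0 : 𝔤 × 𝔤) ρ} :=
  (contDiffOn_Dt hρ).mul (hf.comp_contDiffOn (contDiffOn_Zt hρ.1.1))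

theorem contDiffOn_slice {F : Type*} [NormedAddCommGroup F] [NormedSpace ℝ F]
    {G : ℝ × (𝔤 × 𝔤) → F} (hG : ContDiffOn ℝ ∞ G {z | z.1 • z.2 ∈ Metric.ball (0 : 𝔤 × 𝔤) ρ})
    {s : ℝ} {S : Set (𝔤 × 𝔤)} (hS : ∀ p ∈ S, s • p ∈ Metric.ball (0 : 𝔤 × 𝔤) ρ) :
    ContDiffOn ℝ ∞ (fun p => G (s, p)) S :=
  hG.comp (contDiff_prodMk_right s).contDiffOn hS

theorem smul_mem_ball_convex {t s r : ℝ} {p : 𝔤 × 𝔤} (ht : t • p ∈ Metric.ball (0 : 𝔤 × 𝔤) ρ)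
    (hs : s • p ∈ Metric.ball (0 : 𝔤 × 𝔤) ρ) (hr : r ∈ Set.Icc (0 : ℝ) 1) :
    (t + r * (s - t)) • p ∈ Metric.ball (0 : 𝔤 × 𝔤) ρ := by
  have h := (convex_ball (0 : 𝔤 × 𝔤) ρ).add_smul_sub_mem ht hs hr
  rwa [← sub_smul, smul_smul, ← add_smul] at h

theorem SmoothFn.contDiff {E : Type*} [NormedAddCommGroup E] [NormedSpace ℝ E]
    (f : SmoothFn (⊤ : Opens E)) : ContDiff ℝ ∞ f.1 :=
  contDiffOn_univ.1 f.2

theorem transportEq_of_pointTransport (hρ : IsKVRadius 𝔤 ρ) (h𝒪 : 𝒪 ⊆ Metric.ball 0 ρ) {n : ℕ}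
    (e : Module.Basis (Fin n) ℝ 𝔤) {β : 𝔤 × 𝔤 → 𝔤 × 𝔤} (hβ : ContDiffOn ℝ ∞ β (𝒪 ×ˢ 𝒪)) {t : ℝ}
    (ht : t ∈ Set.Icc (0 : ℝ) 1) (h : ∀ p ∈ dilDom 𝒪 t, PointTransport β t p) :
    TransportEq e 𝒪 β t := by
  intro Ω hΩ u f
  have hΩt := hΩ.self_of_nhdsWithin ht
  have hsm (s : ℝ) (hs : (Ω : Set (𝔤 × 𝔤)) ⊆ dilDom 𝒪 s) (p : 𝔤 × 𝔤) (hp : p ∈ (Ω : Set (𝔤 × 𝔤))) :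
      s • p ∈ Metric.ball (0 : 𝔤 × 𝔤) ρ := mem_ball_of_mem_dilDom h𝒪 (hs hp)
  have hφ (s : ℝ) (hs : (Ω : Set (𝔤 × 𝔤)) ⊆ dilDom 𝒪 s) :=
    exists_m_apply (Ω := Ω) (t := s) (contDiffOn_slice (contDiffOn_Zt hρ.1.1) (hsm s hs))
      (contDiffOn_slice (contDiffOn_Dt hρ) (hsm s hs)) f
  obtain ⟨φ, hφp, hφu⟩ := hφ t hΩt
  have hdil : ContDiffOn ℝ ∞ (dil β t) Ω := (contDiffOn_dil hβ t).mono hΩt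
  obtain ⟨ψ, hψp, hψu⟩ := exists_V_apply e hdil φ
  rw [hφu, hψu, neg_neg]
  refine hasDerivWithinAt_compDistribution (h := fun z => Dt z.1 z.2 * f.1 (Zt z.1 z.2))
    (W := {z | z.1 • z.2 ∈ Metric.ball (0 : 𝔤 × 𝔤) ρ}) isOpen_smul_mem_ball ht
    (fun s p h1 h2 r hr => smul_mem_ball_convex h1 h2 hr) (contDiffOn_Dt_mul hρ (SmoothFn.contDiff f)) u
    (hΩ.mono fun s hs => ⟨fun p hp => hsm s hs p hp, ?_⟩) ψ fun p hp => ?_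
  · obtain ⟨φs, hφs, hφsu⟩ := hφ s hs
    exact ⟨φs, fun p _ => hφs p, hφsu u⟩
  · have hn := Ω.isOpen.mem_nhds hp
    have hZ : DifferentiableAt ℝ (Zt t) p :=
      ((contDiffOn_slice (contDiffOn_Zt hρ.1.1) (hsm t hΩt)).contDiffAt hn).differentiableAt
        (by simp)
    have hD : DifferentiableAt ℝ (Dt t) p :=
      ((contDiffOn_slice (contDiffOn_Dt hρ) (hsm t hΩt)).contDiffAt hn).differentiableAt (by simp)
    have hf : Differentiable ℝ f.1 := (SmoothFn.contDiff f).differentiable (by simp)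
    have hφd : DifferentiableAt ℝ φ.1 p :=
      (ContDiffOn.contDiffAt φ.2 hn).differentiableAt (by simp)
    rw [hψp p hp, sum_fderiv_repr_mul e ((hdil.contDiffAt hn).differentiableAt (by simp)) hφd]
    have h1 := (h p (hΩt hp)).hasDerivAt hZ hD (hf (Zt t p))
    have h2 : φ.1 = fun q => Dt t q * f.1 (Zt t q) := funext hφp
    rw [h2]
    exact h1

theorem pointTransport_of_transportEq (hρ : IsKVRadius 𝔤 ρ) (h𝒪 : 𝒪 ⊆ Metric.ball 0 ρ)
    (ho : IsOpen 𝒪) {n : ℕ}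
    (e : Module.Basis (Fin n) ℝ 𝔤) {β : 𝔤 × 𝔤 → 𝔤 × 𝔤} (hβ : ContDiffOn ℝ ∞ β (𝒪 ×ˢ 𝒪)) {t : ℝ}
    (ht : t ∈ Set.Icc (0 : ℝ) 1) (h : TransportEq e 𝒪 β t) {p : 𝔤 × 𝔤} (hp : p ∈ dilDom 𝒪 t) :
    PointTransport β t p := by
  have hW : IsOpen {z : ℝ × (𝔤 × 𝔤) | z.2 ∈ dilDom 𝒪 z.1} :=
    (ho.preimage (f := fun z : ℝ × (𝔤 × 𝔤) => z.1 • z.2.1) (by fun_prop)).inter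
      (ho.preimage (f := fun z : ℝ × (𝔤 × 𝔤) => z.1 • z.2.2) (by fun_prop))
  -- A product neighbourhood of $(t,p)$ provides an open set that stays admissible for all times
  -- near $t$, so that the Dirac distribution at $p$ may be tested.
  obtain ⟨S, Ω₀, hS, hΩ₀, htS, hpΩ, hSΩ⟩ := isOpen_prod_iff.1 hW t p hp
  let Ω : Opens (𝔤 × 𝔤) := ⟨Ω₀, hΩ₀⟩
  have hΩ : ∀ᶠ s in 𝓝[Set.Icc 0 1] t, (Ω : Set (𝔤 × 𝔤)) ⊆ dilDom 𝒪 s := by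
    filter_upwards [nhdsWithin_le_nhds (hS.mem_nhds htS)] with s hs q hq
    exact hSΩ (Set.mk_mem_prod hs hq)
  have hΩt := hΩ.self_of_nhdsWithin ht
  have hsm (s : ℝ) (hs : (Ω : Set (𝔤 × 𝔤)) ⊆ dilDom 𝒪 s) (p : 𝔤 × 𝔤) (hp : p ∈ (Ω : Set (𝔤 × 𝔤))) :
      s • p ∈ Metric.ball (0 : 𝔤 × 𝔤) ρ := mem_ball_of_mem_dilDom h𝒪 (hs hp)
  have hn : (Ω : Set (𝔤 × 𝔤)) ∈ 𝓝 p := hΩ₀.mem_nhds hpΩ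
  have hm : (t, p) ∈ {z : ℝ × (𝔤 × 𝔤) | z.1 • z.2 ∈ Metric.ball (0 : 𝔤 × 𝔤) ρ} :=
    hsm t hΩt p hpΩ
  have hZz : DifferentiableAt ℝ (fun z : ℝ × (𝔤 × 𝔤) => Zt z.1 z.2) (t, p) :=
    ((contDiffOn_Zt hρ.1.1).contDiffAt (isOpen_smul_mem_ball.mem_nhds hm)).differentiableAt
      (by simp)
  have hDz : DifferentiableAt ℝ (fun z : ℝ × (𝔤 × 𝔤) => Dt z.1 z.2) (t, p) :=
    ((contDiffOn_Dt hρ).contDiffAt (isOpen_smul_mem_ball.mem_nhds hm)).differentiableAt (by simp)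
  refine pointTransport_of_hasDerivAt (hasFDerivAt_slice hZz).differentiableAt
    (hasFDerivAt_slice hDz).differentiableAt (hasDerivAt_slice hZz).differentiableAt
    (hasDerivAt_slice hDz).differentiableAt (D_pos hρ hm).ne' fun f hf => ?_
  let f' : SmoothFn (⊤ : Opens 𝔤) := ⟨f, hf.contDiffOn⟩
  have hφ (s : ℝ) (hs : (Ω : Set (𝔤 × 𝔤)) ⊆ dilDom 𝒪 s) :=
    exists_m_apply (Ω := Ω) (t := s) (contDiffOn_slice (contDiffOn_Zt hρ.1.1) (hsm s hs))
      (contDiffOn_slice (contDiffOn_Dt hρ) (hsm s hs)) f'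
  obtain ⟨φ, hφp, hφu⟩ := hφ t hΩt
  have hdil : ContDiffOn ℝ ∞ (dil β t) Ω := (contDiffOn_dil hβ t).mono hΩt
  obtain ⟨ψ, hψp, hψu⟩ := exists_V_apply e hdil φ
  have h1 := h Ω hΩ (dirac p hpΩ) f'
  have hφd : DifferentiableAt ℝ φ.1 p :=
    (ContDiffOn.contDiffAt φ.2 hn).differentiableAt (by simp)
  rw [hφu, hψu, neg_neg, dirac_apply, hψp p hpΩ,
    sum_fderiv_repr_mul e ((hdil.contDiffAt hn).differentiableAt (by simp)) hφd] at h1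
  have h2 : φ.1 = fun q => Dt t q * f (Zt t q) := funext hφp
  rw [h2] at h1
  have h3 : DifferentiableAt ℝ (fun s => Dt s p * f (Zt s p)) t :=
    (hasDerivAt_slice (((contDiffOn_Dt_mul hρ hf).contDiffAt
      (isOpen_smul_mem_ball.mem_nhds hm)).differentiableAt (by simp))).differentiableAt
  have h4 : HasDerivWithinAt (fun s => Dt s p * f (Zt s p)) _ (Set.Icc 0 1) t :=
    h1.congr_of_eventuallyEq_of_mem (hΩ.mono fun s hs => by
      obtain ⟨φs, hφs, hφsu⟩ := hφ s hs
      exact ((hφsu (dirac p hpΩ)).trans (hφs p)).symm) ht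
  -- The hypothesis gives a derivative within $[0,1]$, one-sided at the endpoints. The function is
  -- differentiable on both sides, so the two derivatives coincide.
  exact ((uniqueDiffOn_Icc zero_lt_one t ht).eq_deriv _ h3.hasDerivAt.hasDerivWithinAt h4)

/-! ### The small neighbourhood and the equivalence -/

theorem isSmall_ball (hρ : IsKVRadius 𝔤 ρ) : IsSmall (Metric.ball (0 : 𝔤) ρ) := by
  have hm {X Y : 𝔤} (hX : X ∈ Metric.ball (0 : 𝔤) ρ) (hY : Y ∈ Metric.ball (0 : 𝔤) ρ) :
      (X, Y) ∈ Metric.ball (0 : 𝔤 × 𝔤) ρ := by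
    rw [mem_ball_zero_iff] at hX hY ⊢
    exact max_lt hX hY
  exact
    { isOpen := Metric.isOpen_ball
      zero_mem := Metric.mem_ball_self hρ.1.1.1
      summable := fun X hX Y hY => summable_norm_bchTerm (q := (X, Y)) (hρ.1.1.2 _ (hm hX hY))
      contDiffOn := (contDiffOn_Z hρ.1.1).mono fun q hq => hm hq.1 hq.2
      j_pos := fun X hX => (hρ.2 (X, X) (hm hX hX)).1
      j_pos_Z := fun X hX Y hY => (hρ.2 (X, Y) (hm hX hY)).2.2 }

theorem kv_iff_transportEq (hρ : IsKVRadius 𝔤 ρ) (h𝒪 : 𝒪 ⊆ Metric.ball 0 ρ)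
    (ho : IsOpen 𝒪) (h0 : (0 : 𝔤) ∈ 𝒪) {n : ℕ} (e : Module.Basis (Fin n) ℝ 𝔤)
    {β : 𝔤 × 𝔤 → 𝔤 × 𝔤} (hβ : ContDiffOn ℝ ∞ β (𝒪 ×ˢ 𝒪)) (hβ0 : β 0 = 0) :
    (∀ X ∈ 𝒪, ∀ Y ∈ 𝒪, KVFirst β X Y ∧ KVTrace β X Y) ↔
      ∀ t ∈ Set.Icc (0 : ℝ) 1, TransportEq e 𝒪 β t := by
  have hβd {q : 𝔤 × 𝔤} (hq : q ∈ 𝒪 ×ˢ 𝒪) : ContDiffAt ℝ ∞ β q :=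
    hβ.contDiffAt ((ho.prod ho).mem_nhds hq)
  have hiff {t : ℝ} (ht : t ≠ 0) {p : 𝔤 × 𝔤} (hp : p ∈ dilDom 𝒪 t) :=
    pointTransport_iff hρ (β := β) ht (mem_ball_of_mem_dilDom h𝒪 hp)
      ((hβd (q := t • p) hp).differentiableAt (by simp))
  constructor
  · intro h t ht
    refine transportEq_of_pointTransport hρ h𝒪 e hβ ht fun p hp => ?_
    have hne {s : ℝ} (hs : s ≠ 0) (hp : p ∈ dilDom 𝒪 s) : PointTransport β s p :=
      (hiff hs hp).2 (h _ hp.1 _ hp.2)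
    by_cases h0t : t = 0
    · subst h0t
      refine pointTransport_zero hρ (hβd ⟨h0, h0⟩) hβ0 ?_
      -- For any fixed $p$, however large, $sp$ lies in $\mathcal O\times\mathcal O$ for small $s$
      -- of either sign, so the transport equations hold at all small nonzero times.
      have h1 : ∀ᶠ s in 𝓝 (0 : ℝ), s • p ∈ 𝒪 ×ˢ 𝒪 := by
        have h2 : Continuous fun s : ℝ => s • p := by fun_prop
        exact ((ho.prod ho).preimage h2).mem_nhds hp
      filter_upwards [self_mem_nhdsWithin, nhdsWithin_le_nhds h1] with s hs hsp
      exact hne hs hsp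
    · exact hne h0t hp
  · intro h X hX Y hY
    have hp : ((X, Y) : 𝔤 × 𝔤) ∈ dilDom 𝒪 1 := by simpa [dilDom] using ⟨hX, hY⟩
    have h1 : (1 : ℝ) ∈ Set.Icc (0 : ℝ) 1 := by simp
    -- The converse uses the transport equation at $t=1$ only, where no rescaling takes place.
    have h2 := (hiff one_ne_zero hp).1 (pointTransport_of_transportEq hρ h𝒪 ho e hβ h1 (h 1 h1) hp)
    simpa only [one_smul] using h2

end Equivalence

end KV

end

theorem proposition3p1 {𝔤 : Type*} [KV.NormedLieRing 𝔤] [KV.NormedLieAlgebra 𝔤]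
    [FiniteDimensional ℝ 𝔤] :
    ∃ 𝒪₀ : Set 𝔤, KV.IsSmall 𝒪₀ ∧
      ∀ 𝒪 ⊆ 𝒪₀, IsOpen 𝒪 → (0 : 𝔤) ∈ 𝒪 →
        ∀ {n : ℕ} (e : Module.Basis (Fin n) ℝ 𝔤) (β : 𝔤 × 𝔤 → 𝔤 × 𝔤),
          ContDiffOn ℝ ∞ β (𝒪 ×ˢ 𝒪) → β 0 = 0 →
            ((∀ X ∈ 𝒪, ∀ Y ∈ 𝒪, KV.KVFirst β X Y ∧ KV.KVTrace β X Y) ↔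
              ∀ t ∈ Set.Icc (0 : ℝ) 1, KV.TransportEq e 𝒪 β t) := by
  obtain ⟨ρ, hρ⟩ := KV.exists_isKVRadius 𝔤
  exact ⟨Metric.ball 0 ρ, KV.isSmall_ball hρ, fun 𝒪 h𝒪 ho h0 n e β hβ hβ0 =>
    KV.kv_iff_transportEq hρ h𝒪 ho h0 e hβ hβ0⟩
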